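/- Let $\mathbb{K}$ be a field of characteristic zero, $g,n\ge 0$, let $F=F_{2g+n}$ be a free group with a free-generating system $\mathcal C=(x_i)_{1\le i\le 2g+n}$, $A=\mathbb{K}F$ its group algebra (a Hopf algebra with $\Delta(x)=x\otimes x$ for $x\in F$), and $\hat A=\varprojlim_m A/I^m$ its completion with respect to the augmentation ideal $I=\operatorname{Ker}(\varepsilon\colon A\to\mathbb{K})$, filtered by the kernels of $\hat A\to A/I^m$, a complete Hopf algebra. Conventions. For an algebra $B$, $B^{\mathrm e}=B\otimes B^{\mathrm{op}}$ with elements written $x\bar y$; $\Omega^1B=\operatorname{Ker}(B\otimes B\to B)$ is the left $B^{\mathrm e}$-module of non-commutative $1$-forms with $da=1\otimes a-a\otimes 1$; a connection on a left $B$-module $M$ is a $\mathbb{K}$-linear map $\nabla\colon M\to\Omega^1B\otimes_BM$ with $\nabla(bm)=db\otimes m+b\nabla(m)$. For filtered algebras and modules all these spaces carry the induced (tensor, subspace, quotient) filtrations, are replaced by their completions, and connections are required to be continuous. For a Hopf algebra $H$ and an $H$-module $M$, $\Phi_H(M)=M\otimes H$ is the $H^{\mathrm e}$-module with $x\cdot(m\otimes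 a)\cdot y=x^{(1)}m\otimes x^{(2)}ay$; put $\tilde\Delta=(\mathrm{id}\otimes S)\Delta\colon H\to H^{\mathrm e}$ and $j_M(m)=m\otimes1$. For a connection $\nabla$ on $M$, $\Phi_H(\nabla)$ denotes the unique connection on $\Phi_H(M)$ with $\Phi_H(\nabla)\circ j_M=(\tilde\Delta\otimes j_M)\circ\nabla$. For a filtered Lie algebra $\mathfrak g$, $U\mathfrak g$ has the induced filtration (spanned in degree $\ge m$ by products $y_1\cdots y_k$ with $y_l$ of degree $\ge m_l$ and $\sum m_l\ge m$), and $\Omega^1_{\mathrm{Lie}}\mathfrak g$ is the completion of $\operatorname{Ker}(\varepsilon\colon U\mathfrak g\to\mathbb{K})$, with $dz=z$ for $z\in\mathfrak g$. Let $\nabla_{\mathcal C}$ be the unique connection on the $A^{\mathrm e}$-module $\Omega^1A$ with $\nabla_{\mathcal C}(dx_i\,x_i^{-1})=0$ for all $i$, and let $\mathfrak g=\mathbb{P}(\hat A)=\{x\in\hat A:\Delta x=x\otimes1+1\otimes x\}$ be the Lie algebra of primitive elements, with the filtration induced from $\hat A$. Then: 1. There is an isomorphism of filtered Lie algebras from the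 completed free Lie algebra $L(\!(z_1,\dots,z_{2g+n})\!)$ (the completion of the free Lie algebra along its lower central series) onto $\mathfrak g$ such that, identifying $z_i$ with its image in $\mathfrak g\subset\hat A$, $e^{z_i}=x_i$ for all $i$. 2. The canonical map $\widehat{U\mathfrak g}\to\hat A$ is an isomorphism of filtered algebras, and the map $\Phi_{U\mathfrak g}(\Omega^1_{\mathrm{Lie}}\mathfrak g)\to\Omega^1\hat A$, $\omega\otimes b\mapsto\bar b\,\tilde\Delta(\omega)$, is an isomorphism of filtered bimodules. 3. There is a unique continuous connection $\hat\nabla_{\mathcal C}$ on the completed module $\Omega^1\hat A$ that extends $\nabla_{\mathcal C}$, and there is a unique continuous connection $\nabla''$ on $\Omega^1_{\mathrm{Lie}}\mathfrak g$ with $$\nabla''\Big(\frac{e^{z_i}-1}{z_i}\,dz_i\Big)=0\qquad(1\le i\le 2g+n).$$ 4. $\hat\nabla_{\mathcal C}$ is induced from $\nabla''$: the connection $\Phi_{U\mathfrak g}(\nabla'')$ exists, is unique, and corresponds to $\hat\nabla_{\mathcal C}$ under the isomorphism of 2. -/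

import Mathlib

noncomputable section

open scoped TensorProduct
open MulOpposite

namespace CompletedConn

/-! ### Filtered vector spaces and their completions -/

/-- A decreasing filtration `V = F 0 ⊇ F 1 ⊇ F 2 ⊇ ⋯` of a `K`-vector space, defining a linear
topology on `V`. -/
class Filt (K V : Type*) [Field K] [AddCommGroup V] [Module K V] where
  F : ℕ → Submodule K V
  anti : Antitone F
  zero : F 0 = ⊤

/-- The `m`-th step of the filtration of `V`. -/
abbrev fil (K : Type*) (V : Type*) [Field K] [AddCommGroup V] [Module K V] [Filt K V] (m : ℕ) :
    Submodule K V := Filt.F m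

section Basic

variable (K : Type*) [Field K]
variable {V W X Y : Type*} [AddCommGroup V] [Module K V] [AddCommGroup W] [Module K W]
  [AddCommGroup X] [Module K X] [AddCommGroup Y] [Module K Y]

/-- The filtration induced on the source of a linear map. -/
abbrev Filt.comap [Filt K W] (f : V →ₗ[K] W) : Filt K V where
  F m := (fil K W m).comap f
  anti _ _ h := Submodule.comap_mono (Filt.anti h)
  zero := by simp [fil, Filt.zero]

/-- The filtration induced on the target of a surjective linear map. -/
abbrev Filt.map [Filt K V] (f : V →ₗ[K] W) (hf : Function.Surjective f) : Filt K W where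
  F m := (fil K V m).map f
  anti _ _ h := Submodule.map_mono (Filt.anti h)
  zero := by simp [fil, Filt.zero, LinearMap.range_eq_top.2 hf]

variable {K}

/-- Linear maps that respect the filtrations. -/
def IsFilt [Filt K V] [Filt K W] (f : V →ₗ[K] W) : Prop :=
  ∀ m, ∀ v ∈ fil K V m, f v ∈ fil K W m

/-- Linear maps that are isomorphisms of filtered vector spaces. -/
def IsFiltIso [Filt K V] [Filt K W] (f : V →ₗ[K] W) : Prop :=
  Function.Bijective f ∧ ∀ m v, v ∈ fil K V m ↔ f v ∈ fil K W m

/-- Continuity of linear maps for the topologies defined by the filtrations. -/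
def IsCont [Filt K V] [Filt K W] (f : V →ₗ[K] W) : Prop :=
  ∀ m, ∃ k, ∀ v ∈ fil K V k, f v ∈ fil K W m

variable (K V)

/-- The inverse limit of the quotients `V ⧸ F m`, as a subspace of their product. -/
def invLim [Filt K V] : Submodule K (∀ m, V ⧸ fil K V m) where
  carrier := {f | ∀ m n (h : m ≤ n), Submodule.factor (Filt.anti h) (f n) = f m}
  add_mem' hf hg m n h := by simp [hf m n h, hg m n h]
  zero_mem' m n h := by simp
  smul_mem' c f hf m n h := by simp [hf m n h]

/-- The completion `lim V ⧸ F m` of a filtered vector space. -/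
def Comp [Filt K V] : Type _ := invLim K V

instance compAddCommGroup [Filt K V] : AddCommGroup (Comp K V) := inferInstanceAs (AddCommGroup (invLim K V))
instance compModule [Filt K V] : Module K (Comp K V) := inferInstanceAs (Module K (invLim K V))

variable {K V}

namespace Comp

variable [Filt K V] [Filt K W] [Filt K X] [Filt K Y]

/-- The projection to the `m`-th quotient. -/
def proj (m : ℕ) : Comp K V →ₗ[K] V ⧸ fil K V m :=
  LinearMap.proj m ∘ₗ (invLim K V).subtype

theorem factor_proj {m n : ℕ} (h : m ≤ n) (x : Comp K V) :
    Submodule.factor (Filt.anti h) (proj n x) = proj m x := x.2 m n h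

@[ext]
theorem ext {x y : Comp K V} (h : ∀ m, proj m x = proj m y) : x = y :=
  Subtype.ext (funext h)

/-- Build an element of the completion from a compatible family. -/
def mk (f : ∀ m, V ⧸ fil K V m)
    (h : ∀ m n (h : m ≤ n), Submodule.factor (Filt.anti h) (f n) = f m) : Comp K V := ⟨f, h⟩

@[simp]
theorem proj_mk (f : ∀ m, V ⧸ fil K V m) (h) (m : ℕ) : proj m (mk f h) = f m := rfl

theorem exists_rep (m : ℕ) (x : Comp K V) :
    ∃ v : V, proj m x = Submodule.Quotient.mk v ∧
      ∀ k ≤ m, proj k x = Submodule.Quotient.mk v := by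
  obtain ⟨v, hv⟩ := Submodule.Quotient.mk_surjective _ (proj m x)
  refine ⟨v, hv.symm, fun k hk => ?_⟩
  rw [← factor_proj hk, ← hv]; rfl

/-- The canonical map from `V` to its completion. -/
def of : V →ₗ[K] Comp K V where
  toFun v := mk (fun _ => Submodule.Quotient.mk v) (fun _ _ _ => rfl)
  map_add' _ _ := rfl
  map_smul' _ _ := rfl

@[simp]
theorem proj_of (m : ℕ) (v : V) : proj m (of (K := K) v) = Submodule.Quotient.mk v := rfl

/-- The map induced on completions by a filtered linear map. -/
def map (f : V →ₗ[K] W) (hf : IsFilt f) : Comp K V →ₗ[K] Comp K W where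
  toFun x := mk (fun m => Submodule.mapQ _ _ f (hf m) (proj m x)) (fun m n h => by
    obtain ⟨v, hn, hv⟩ := exists_rep n x
    rw [hn, hv m h]; rfl)
  map_add' x y := by ext m; simp
  map_smul' c x := by ext m; simp

theorem proj_map (f : V →ₗ[K] W) (hf : IsFilt f) {m : ℕ} {x : Comp K V} {v : V}
    (hv : proj m x = Submodule.Quotient.mk v) :
    proj m (map f hf x) = Submodule.Quotient.mk (f v) := by
  simp [map, hv]

/-- The bilinear map induced on completions by a bilinear map that is compatible with the
filtrations in each variable. -/
def map₂ (f : V →ₗ[K] W →ₗ[K] X)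
    (h₁ : ∀ m, ∀ v ∈ fil K V m, ∀ w, f v w ∈ fil K X m)
    (h₂ : ∀ m v, ∀ w ∈ fil K W m, f v w ∈ fil K X m) :
    Comp K V →ₗ[K] Comp K W →ₗ[K] Comp K X :=
  let q (m : ℕ) : V ⧸ fil K V m →ₗ[K] W ⧸ fil K W m →ₗ[K] X ⧸ fil K X m :=
    Submodule.liftQ _
      { toFun v := Submodule.mapQ _ _ (f v) (h₂ m v)
        map_add' a b := by ext w; simp
        map_smul' c a := by ext w; simp }
      (fun v hv => by
        rw [LinearMap.mem_ker]; ext w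
        simpa [Submodule.Quotient.mk_eq_zero] using h₁ m v hv w)
  LinearMap.mk₂ K
    (fun x y => mk (fun m => q m (proj m x) (proj m y)) (fun m n h => by
      obtain ⟨v, hn, hv⟩ := exists_rep n x
      obtain ⟨w, hn', hw⟩ := exists_rep n y
      rw [hn, hv m h, hn', hw m h]; rfl))
    (fun _ _ _ => by ext m; simp) (fun _ _ _ => by ext m; simp)
    (fun _ _ _ => by ext m; simp) (fun _ _ _ => by ext m; simp)

theorem proj_map₂ (f : V →ₗ[K] W →ₗ[K] X) (h₁) (h₂) {m : ℕ} {x : Comp K V} {y : Comp K W}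
    {v : V} {w : W} (hv : proj m x = Submodule.Quotient.mk v)
    (hw : proj m y = Submodule.Quotient.mk w) :
    proj m (map₂ f h₁ h₂ x y) = Submodule.Quotient.mk (f v w) := by
  simp [map₂, hv, hw]

/-- The completion is filtered by the kernels of the projections. -/
instance compFilt : Filt K (Comp K V) where
  F m := LinearMap.ker (proj m)
  anti m n h x hx := by
    rw [LinearMap.mem_ker] at hx ⊢
    rw [← factor_proj h, hx, map_zero]
  zero := by
    refine eq_top_iff.2 fun x _ => ?_
    obtain ⟨v, hv, -⟩ := exists_rep 0 x
    rw [LinearMap.mem_ker, hv, Submodule.Quotient.mk_eq_zero]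
    simp [fil, Filt.zero]

theorem mem_fil {m : ℕ} {x : Comp K V} : x ∈ fil K (Comp K V) m ↔ proj m x = 0 := Iff.rfl

theorem isFilt_of : IsFilt (of : V →ₗ[K] Comp K V) := fun m v hv => by
  rw [mem_fil, proj_of, Submodule.Quotient.mk_eq_zero]; exact hv

end Comp

/-! ### Constructions of filtered spaces -/

/-- The tensor product filtration `F m (V ⊗ W) = ∑_{i + j = m} F i V ⊗ F j W`. -/
instance tensorFilt [Filt K V] [Filt K W] : Filt K (V ⊗[K] W) where
  F m := Submodule.span K
    {t | ∃ i j, m ≤ i + j ∧ ∃ v ∈ fil K V i, ∃ w ∈ fil K W j, t = v ⊗ₜ[K] w}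
  anti m n h := Submodule.span_mono fun _ ⟨i, j, hij, ht⟩ => ⟨i, j, h.trans hij, ht⟩
  zero := by
    rw [eq_top_iff, ← TensorProduct.span_tmul_eq_top]
    refine Submodule.span_mono ?_
    rintro _ ⟨v, w, rfl⟩
    exact ⟨0, 0, le_rfl, v, by simp [fil, Filt.zero], w, by simp [fil, Filt.zero], rfl⟩

theorem tmul_mem [Filt K V] [Filt K W] {i j m : ℕ} (h : m ≤ i + j) {v : V} {w : W}
    (hv : v ∈ fil K V i) (hw : w ∈ fil K W j) : v ⊗ₜ[K] w ∈ fil K (V ⊗[K] W) m :=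
  Submodule.subset_span ⟨i, j, h, v, hv, w, hw, rfl⟩

theorem mem_zero [Filt K V] (v : V) : v ∈ fil K V 0 := by simp [fil, Filt.zero]

theorem tensor_le [Filt K V] [Filt K W] {m : ℕ} {p : Submodule K (V ⊗[K] W)}
    (h : ∀ i j, m ≤ i + j → ∀ v ∈ fil K V i, ∀ w ∈ fil K W j, v ⊗ₜ[K] w ∈ p) :
    fil K (V ⊗[K] W) m ≤ p := by
  refine Submodule.span_le.2 ?_
  rintro _ ⟨i, j, hij, v, hv, w, hw, rfl⟩
  exact h i j hij v hv w hw

theorem isFilt_map [Filt K V] [Filt K W] [Filt K X] [Filt K Y] {f : V →ₗ[K] X} {g : W →ₗ[K] Y}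
    (hf : IsFilt f) (hg : IsFilt g) : IsFilt (TensorProduct.map f g) := fun m =>
  tensor_le (p := (fil K (X ⊗[K] Y) m).comap (TensorProduct.map f g)) fun i j hij v hv w hw => by
    simpa using tmul_mem hij (hf i v hv) (hg j w hw)

instance opFilt [Filt K V] : Filt K Vᵐᵒᵖ := Filt.comap K (opLinearEquiv K).symm.toLinearMap

end Basic

/-! ### Filtered algebras, modules and Lie algebras -/

/-- A filtered algebra. -/
class FiltAlg (K R : Type*) [Field K] [Ring R] [Algebra K R] extends Filt K R where
  mul_mem : ∀ {i j : ℕ} {a b : R}, a ∈ F i → b ∈ F j → a * b ∈ F (i + j)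

/-- A filtered module over a filtered algebra. -/
class FiltSMul (K R M : Type*) [Field K] [Ring R] [Algebra K R] [FiltAlg K R]
    [AddCommGroup M] [Module K M] [Filt K M] [Module R M] : Prop where
  smul_mem : ∀ {i j : ℕ} {a : R} {v : M}, a ∈ fil K R i → v ∈ fil K M j → a • v ∈ fil K M (i + j)

/-- A Lie algebra with a filtration by ideals. -/
class FiltLie (K L : Type*) [Field K] [LieRing L] [LieAlgebra K L] extends Filt K L where
  lie_mem : ∀ {m : ℕ} (a : L) {b : L}, b ∈ F m → ⁅a, b⁆ ∈ F m

section Alg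

variable {K : Type*} [Field K]
variable {R S : Type*} [Ring R] [Algebra K R] [FiltAlg K R] [Ring S] [Algebra K S] [FiltAlg K S]
variable {M : Type*} [AddCommGroup M] [Module K M] [Filt K M] [Module R M] [IsScalarTower K R M]
  [FiltSMul K R M]
variable {L : Type*} [LieRing L] [LieAlgebra K L] [FiltLie K L]

theorem mul_mem {i j : ℕ} {a b : R} (ha : a ∈ fil K R i) (hb : b ∈ fil K R j) :
    a * b ∈ fil K R (i + j) := FiltAlg.mul_mem ha hb

instance opFiltAlg : FiltAlg K Rᵐᵒᵖ where
  mul_mem {i j a b} ha hb := by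
    have h : unop b * unop a ∈ fil K R (j + i) := mul_mem hb ha
    rw [add_comm] at h
    exact h

instance tensorFiltAlg : FiltAlg K (R ⊗[K] S) where
  mul_mem {i j a b} ha hb := by
    refine tensor_le (p := (fil K (R ⊗[K] S) (i + j)).comap (LinearMap.mulRight K b)) ?_ ha
    intro i₁ j₁ h₁ v hv w hw
    refine tensor_le (p := (fil K (R ⊗[K] S) (i + j)).comap (LinearMap.mulLeft K (v ⊗ₜ[K] w)))
      ?_ hb
    intro i₂ j₂ h₂ v' hv' w' hw'
    simp only [Submodule.mem_comap, LinearMap.mulLeft_apply, Algebra.TensorProduct.tmul_mul_tmul]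
    exact tmul_mem (by omega) (mul_mem hv hv') (mul_mem hw hw')

namespace Comp

/-- The product on the completion of a filtered algebra. -/
def mul : Comp K R →ₗ[K] Comp K R →ₗ[K] Comp K R :=
  map₂ (LinearMap.mul K R) (fun _ _ hv w => mul_mem hv (mem_zero w))
    (fun m v _ hw => by simpa using mul_mem (mem_zero v) hw)

instance instMul : Mul (Comp K R) := ⟨fun x y => mul x y⟩
instance instOne : One (Comp K R) := ⟨of 1⟩

theorem proj_mul {m : ℕ} {x y : Comp K R} {v w : R} (hv : proj m x = Submodule.Quotient.mk v)
    (hw : proj m y = Submodule.Quotient.mk w) :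
    proj m (x * y) = Submodule.Quotient.mk (v * w) :=
  proj_map₂ _ _ _ hv hw

theorem proj_one (m : ℕ) : proj m (1 : Comp K R) = Submodule.Quotient.mk 1 := rfl

instance instRing : Ring (Comp K R) :=
  { (inferInstance : AddCommGroup (Comp K R)), (inferInstance : Mul (Comp K R)),
    (inferInstance : One (Comp K R)) with
    left_distrib := fun x y z => (mul x).map_add y z
    right_distrib := fun x y z => by
      change mul (x + y) z = mul x z + mul y z
      simp
    zero_mul := fun x => by change mul 0 x = 0; simp
    mul_zero := fun x => (mul x).map_zero
    mul_assoc := fun x y z => by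
      ext m
      obtain ⟨a, ha, -⟩ := exists_rep m x
      obtain ⟨b, hb, -⟩ := exists_rep m y
      obtain ⟨c, hc, -⟩ := exists_rep m z
      rw [proj_mul (proj_mul ha hb) hc, proj_mul ha (proj_mul hb hc), mul_assoc]
    one_mul := fun x => by
      ext m
      obtain ⟨a, ha, -⟩ := exists_rep m x
      rw [proj_mul (proj_one m) ha, one_mul, ha]
    mul_one := fun x => by
      ext m
      obtain ⟨a, ha, -⟩ := exists_rep m x
      rw [proj_mul ha (proj_one m), mul_one, ha] }

instance instAlgebra : Algebra K (Comp K R) :=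
  Algebra.ofModule (fun c x y => by change mul (c • x) y = c • mul x y; simp)
    (fun c x y => by change mul x (c • y) = c • mul x y; simp)

instance instFiltAlg : FiltAlg K (Comp K R) where
  mul_mem {i j x y} hx hy := by
    obtain ⟨a, ha, ha'⟩ := exists_rep (i + j) x
    obtain ⟨b, hb, hb'⟩ := exists_rep (i + j) y
    have h1 : a ∈ fil K R i := by
      rw [← Submodule.Quotient.mk_eq_zero, ← ha' i (by omega)]; exact hx
    have h2 : b ∈ fil K R j := by
      rw [← Submodule.Quotient.mk_eq_zero, ← hb' j (by omega)]; exact hy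
    change proj (i + j) (x * y) = 0
    rw [proj_mul ha hb, Submodule.Quotient.mk_eq_zero]
    exact mul_mem h1 h2

/-- The canonical map to the completion as a homomorphism of algebras. -/
def ofAlg : R →ₐ[K] Comp K R :=
  AlgHom.ofLinearMap of rfl (fun _ _ => rfl)

theorem map_mul {f : R →ₐ[K] S} (hf : IsFilt f.toLinearMap) (x y : Comp K R) :
    map f.toLinearMap hf (x * y) = map f.toLinearMap hf x * map f.toLinearMap hf y := by
  ext m
  obtain ⟨a, ha, -⟩ := exists_rep m x
  obtain ⟨b, hb, -⟩ := exists_rep m y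
  rw [proj_map _ _ (proj_mul ha hb), proj_mul (proj_map _ hf ha) (proj_map _ hf hb)]
  simp

/-- The action of the completed algebra on a completed module. -/
def act : Comp K R →ₗ[K] Comp K M →ₗ[K] Comp K M :=
  map₂ (Algebra.lsmul K K M).toLinearMap
    (fun _ _ hv w => FiltSMul.smul_mem hv (mem_zero w))
    (fun m v _ hw => by simpa using FiltSMul.smul_mem (mem_zero (K := K) v) hw)

theorem proj_act {m : ℕ} {x : Comp K R} {y : Comp K M} {v : R} {w : M}
    (hv : proj m x = Submodule.Quotient.mk v)
    (hw : proj m y = Submodule.Quotient.mk w) :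
    proj m (act x y) = Submodule.Quotient.mk (v • w) :=
  proj_map₂ _ _ _ hv hw

instance instModule : Module (Comp K R) (Comp K M) where
  smul x y := act x y
  one_smul y := by
    ext m
    obtain ⟨b, hb, -⟩ := exists_rep m y
    change proj m (act 1 y) = _
    rw [proj_act (proj_one m) hb, one_smul, hb]
  mul_smul x x' y := by
    ext m
    obtain ⟨a, ha, -⟩ := exists_rep m x
    obtain ⟨a', ha', -⟩ := exists_rep m x'
    obtain ⟨b, hb, -⟩ := exists_rep m y
    change proj m (act (x * x') y) = proj m (act x (act x' y))
    rw [proj_act (proj_mul ha ha') hb, proj_act ha (proj_act ha' hb), mul_smul]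
  smul_zero x := (act x).map_zero
  smul_add x := (act x).map_add
  add_smul x x' y := by
    change act (x + x') y = act x y + act x' y
    simp
  zero_smul y := by
    change act 0 y = 0
    simp

/-- The bracket on the completion of a filtered Lie algebra. -/
def lie : Comp K L →ₗ[K] Comp K L →ₗ[K] Comp K L :=
  map₂ (LinearMap.mk₂ K (fun a b : L => ⁅a, b⁆) add_lie (fun c a b => smul_lie c a b) lie_add
      (fun c a b => lie_smul c a b))
    (fun _ v hv w => by
      have h := neg_mem (FiltLie.lie_mem (K := K) w hv)
      rw [lie_skew] at h
      exact h)
    (fun _ v _ hw => FiltLie.lie_mem (K := K) v hw)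

instance instBracket : Bracket (Comp K L) (Comp K L) := ⟨fun x y => lie x y⟩

theorem proj_lie {m : ℕ} {x y : Comp K L} {v w : L} (hv : proj m x = Submodule.Quotient.mk v)
    (hw : proj m y = Submodule.Quotient.mk w) :
    proj m ⁅x, y⁆ = Submodule.Quotient.mk ⁅v, w⁆ :=
  proj_map₂ _ _ _ hv hw

instance instLieRing : LieRing (Comp K L) where
  add_lie x y z := by
    change lie (x + y) z = lie x z + lie y z
    simp
  lie_add x y z := (lie x).map_add y z
  lie_self x := by
    ext m
    obtain ⟨a, ha, -⟩ := exists_rep m x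
    rw [proj_lie ha ha, lie_self]; rfl
  leibniz_lie x y z := by
    ext m
    obtain ⟨a, ha, -⟩ := exists_rep m x
    obtain ⟨b, hb, -⟩ := exists_rep m y
    obtain ⟨c, hc, -⟩ := exists_rep m z
    rw [_root_.map_add, proj_lie ha (proj_lie hb hc), proj_lie (proj_lie ha hb) hc,
      proj_lie hb (proj_lie ha hc), leibniz_lie a b c]; rfl

instance instLieAlgebra : LieAlgebra K (Comp K L) where
  lie_smul c x y := (lie x).map_smul c y

end Comp

open Classical in
/-- The value `∑ pₖ xᵏ` of a power series `p` at an element `x` of filtration degree `≥ 1` of a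
complete filtered algebra (and `0` by convention at other elements). -/
def evalSeries (p : PowerSeries K) (x : Comp K R) : Comp K R :=
  if hx : x ∈ fil K (Comp K R) 1 then
    Comp.mk (fun m => Comp.proj m (∑ k ∈ Finset.range m, p.coeff k • x ^ k)) (fun m n h => by
      have hpow : ∀ k, x ^ k ∈ fil K (Comp K R) k := fun k => by
        induction k with
        | zero => exact mem_zero _
        | succ k ih => rw [pow_succ]; exact mul_mem ih hx
      rw [Comp.factor_proj h, ← sub_eq_zero, ← map_sub, ← Finset.sum_range_add_sum_Ico _ h,
        add_sub_cancel_left, ← Comp.mem_fil]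
      refine Submodule.sum_mem _ fun k hk => Submodule.smul_mem _ _ ?_
      exact Filt.anti (Finset.mem_Ico.1 hk).1 (hpow k))
  else 0

end Alg

/-! ### Non-commutative differential forms and connections -/

section Forms

variable (K : Type*) [Field K]

/-- The enveloping algebra `R ⊗ Rᵒᵖ`; the element `x ⊗ op y` is the element `x ȳ`. -/
abbrev Env (R : Type*) [Ring R] [Algebra K R] : Type _ := R ⊗[K] Rᵐᵒᵖ

section

variable (R : Type*) [Ring R] [Algebra K R]

/-- The multiplication `x ⊗ op y ↦ x y`. -/
def envMul : Env K R →ₗ[K] R :=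
  TensorProduct.lift ((LinearMap.mul K R).compl₂ (opLinearEquiv K).symm.toLinearMap)

variable {K R}

@[simp]
theorem envMul_tmul (x : R) (y : Rᵐᵒᵖ) : envMul K R (x ⊗ₜ y) = x * unop y := rfl

theorem envMul_tmul_mul (x : R) (y : Rᵐᵒᵖ) (t : Env K R) :
    envMul K R ((x ⊗ₜ y) * t) = x * envMul K R t * unop y := by
  induction t using TensorProduct.induction_on with
  | zero => simp
  | tmul a b => simp [mul_assoc]
  | add a b ha hb => simp only [mul_add, map_add, ha, hb, add_mul]

variable (K R)

/-- The kernel of the multiplication map, a left submodule of the enveloping algebra. -/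
def omIdeal : Ideal (Env K R) where
  carrier := {t | envMul K R t = 0}
  add_mem' ha hb := by simp_all
  zero_mem' := by simp
  smul_mem' c t ht := by
    have ht : envMul K R t = 0 := ht
    change envMul K R (c * t) = 0
    induction c using TensorProduct.induction_on with
    | zero => simp
    | tmul x y => simp [envMul_tmul_mul, ht]
    | add a b ha hb => simp [add_mul, ha, hb]

/-- The space `Ω¹R` of non-commutative `1`-forms, as a left module over the enveloping algebra;
its left `R`-module structure is multiplication by `r ⊗ 1`, its right `R`-module structure is
multiplication by `1 ⊗ op r`. -/
def Om : Type _ := omIdeal K R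

instance omAddCommGroup : AddCommGroup (Om K R) := inferInstanceAs (AddCommGroup (omIdeal K R))
instance omModuleEnv : Module (Env K R) (Om K R) := inferInstanceAs (Module (Env K R) (omIdeal K R))
instance omModuleK : Module K (Om K R) := Module.compHom (Om K R) (algebraMap K (Env K R))
instance omModuleR : Module R (Om K R) :=
  Module.compHom (Om K R) (Algebra.TensorProduct.includeLeft : R →ₐ[K] Env K R).toRingHom

instance omTowerEnv : IsScalarTower K (Env K R) (Om K R) where
  smul_assoc c x t :=
    (congrArg (· • t) (Algebra.smul_def c x)).trans (mul_smul (algebraMap K (Env K R) c) x t)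

instance omTowerR : IsScalarTower K R (Om K R) where
  smul_assoc c x t := by
    change ((c • x) ⊗ₜ[K] (1 : Rᵐᵒᵖ)) • t = c • ((x ⊗ₜ[K] (1 : Rᵐᵒᵖ)) • t)
    rw [← TensorProduct.smul_tmul', smul_assoc]

instance omSMulComm : SMulCommClass K R (Om K R) where
  smul_comm c x t := by
    change algebraMap K (Env K R) c • ((x ⊗ₜ[K] (1 : Rᵐᵒᵖ)) • t) =
      (x ⊗ₜ[K] (1 : Rᵐᵒᵖ)) • (algebraMap K (Env K R) c • t)
    rw [← mul_smul, ← mul_smul, Algebra.commutes]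

instance omSMulComm' : SMulCommClass R K (Om K R) := SMulCommClass.symm _ _ _

/-- The inclusion of `Ω¹R` in the enveloping algebra. -/
def omIncl : Om K R →ₗ[K] Env K R where
  toFun t := t.1
  map_add' _ _ := rfl
  map_smul' c t := (Algebra.smul_def c (show Env K R from t.1)).symm

variable {K R}

theorem omIncl_injective : Function.Injective (omIncl K R) := Subtype.val_injective

theorem omIncl_smul (x : Env K R) (t : Om K R) : omIncl K R (x • t) = x * omIncl K R t := rfl

theorem envMul_omIncl (t : Om K R) : envMul K R (omIncl K R t) = 0 := t.2

/-- Elements of the kernel of the multiplication as `1`-forms. -/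
def omMk (t : Env K R) (ht : envMul K R t = 0) : Om K R := ⟨t, ht⟩

@[simp]
theorem omIncl_omMk (t : Env K R) (ht) : omIncl K R (omMk t ht) = t := rfl

theorem smul_om (r : R) (t : Om K R) : r • t = (r ⊗ₜ[K] (1 : Rᵐᵒᵖ)) • t := rfl

variable (K R)

/-- The universal derivation `d a = 1 ⊗ a - a ⊗ 1`. -/
def dOm : R →ₗ[K] Om K R where
  toFun a := omMk (1 ⊗ₜ op a - a ⊗ₜ 1) (by simp)
  map_add' a b := omIncl_injective (by
    simp only [op_add, TensorProduct.tmul_add, TensorProduct.add_tmul, map_add, omIncl_omMk]; abel)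
  map_smul' c a := omIncl_injective (by
    simp [TensorProduct.smul_tmul', smul_sub])

end

section

variable (R : Type*) [Ring R] [Algebra K R]
variable (M : Type*) [AddCommGroup M] [Module K M] [Module R M]

/-- The relations `ω r ⊗ m = ω ⊗ r m`. -/
def btRel : Submodule R (Om K R ⊗[K] M) :=
  Submodule.span R {t | ∃ (ω : Om K R) (r : R) (m : M),
    t = (((1 : R) ⊗ₜ[K] op r) • ω) ⊗ₜ[K] m - ω ⊗ₜ[K] (r • m)}

/-- The tensor product `Ω¹R ⊗_R M` over the non-commutative algebra `R`, a left `R`-module. -/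
def BT : Type _ := (Om K R ⊗[K] M) ⧸ btRel K R M

instance btAddCommGroup : AddCommGroup (BT K R M) := inferInstanceAs (AddCommGroup (_ ⧸ btRel K R M))
instance btModuleR : Module R (BT K R M) := inferInstanceAs (Module R (_ ⧸ btRel K R M))
instance btModuleK : Module K (BT K R M) := inferInstanceAs (Module K (_ ⧸ btRel K R M))
instance btTower : IsScalarTower K R (BT K R M) :=
  inferInstanceAs (IsScalarTower K R (_ ⧸ btRel K R M))

/-- The quotient map `Ω¹R ⊗_K M → Ω¹R ⊗_R M`. -/
def btMk : Om K R ⊗[K] M →ₗ[K] BT K R M := (btRel K R M).mkQ.restrictScalars K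

theorem btMk_surjective : Function.Surjective (btMk K R M) := fun x => by
  obtain ⟨t, ht⟩ := Submodule.mkQ_surjective (btRel K R M) x
  exact ⟨t, ht⟩

variable {K R M}

theorem btMk_smul (r : R) (t : Om K R ⊗[K] M) : btMk K R M (r • t) = r • btMk K R M t := rfl

/-- A connection on the left `R`-module `M`. -/
def IsConn (D : M →ₗ[K] BT K R M) : Prop :=
  ∀ (r : R) (m : M), D (r • m) = btMk K R M (dOm K R r ⊗ₜ m) + r • D m

end

section

variable {K}
variable {R S : Type*} [Ring R] [Algebra K R] [Ring S] [Algebra K S]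
variable {M N : Type*} [AddCommGroup M] [Module K M] [Module R M]
  [AddCommGroup N] [Module K N] [Module S N]

/-- Functoriality of the enveloping algebra. -/
def envMap (f : R →ₐ[K] S) : Env K R →ₐ[K] Env K S := Algebra.TensorProduct.map f f.op

theorem envMul_envMap (f : R →ₐ[K] S) (t : Env K R) :
    envMul K S (envMap f t) = f (envMul K R t) := by
  induction t using TensorProduct.induction_on with
  | zero => simp
  | tmul a b => simp [envMap]
  | add a b ha hb => simp only [map_add, ha, hb]

/-- Functoriality of `Ω¹`: `a db ↦ f(a) df(b)`. -/
def omMap (f : R →ₐ[K] S) : Om K R →ₗ[K] Om K S where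
  toFun t := omMk (envMap f (omIncl K R t)) (by rw [envMul_envMap, envMul_omIncl, map_zero])
  map_add' a b := omIncl_injective (by simp)
  map_smul' c a := omIncl_injective (by simp)

theorem omIncl_omMap (f : R →ₐ[K] S) (t : Om K R) :
    omIncl K S (omMap f t) = envMap f (omIncl K R t) := rfl

theorem omMap_smul (f : R →ₐ[K] S) (x : Env K R) (t : Om K R) :
    omMap f (x • t) = envMap f x • omMap f t :=
  omIncl_injective (by simp [omIncl_omMap, omIncl_smul])

/-- The map `Ω¹R ⊗_R M → Ω¹S ⊗_S N`, `ω ⊗ m ↦ f(ω) ⊗ h(m)`, induced by an algebra homomorphism `f`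
and a module homomorphism `h` over `f`. -/
def btMap (f : R →ₐ[K] S) (h : M →ₗ[K] N) (hh : ∀ (r : R) (m : M), h (r • m) = f r • h m) :
    BT K R M →ₗ[K] BT K S N :=
  (Submodule.liftQ ((btRel K R M).restrictScalars K)
    (btMk K S N ∘ₗ TensorProduct.map (omMap f) h) (by
      intro t ht
      rw [LinearMap.mem_ker]
      replace ht : t ∈ btRel K R M := ht
      unfold btRel at ht
      induction ht using Submodule.span_induction with
      | mem t ht =>
        obtain ⟨ω, r, m, rfl⟩ := ht
        simp only [map_sub, LinearMap.comp_apply, TensorProduct.map_tmul, omMap_smul, hh]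
        rw [← map_sub]
        refine (Submodule.Quotient.mk_eq_zero _).2 (Submodule.subset_span ?_)
        exact ⟨omMap f ω, f r, h m, by simp [envMap]⟩
      | zero => simp
      | add a b _ _ ha hb => rw [map_add, ha, hb, add_zero]
      | smul r t _ ht =>
        have key : (btMk K S N ∘ₗ TensorProduct.map (omMap f) h) (r • t) =
            f r • (btMk K S N ∘ₗ TensorProduct.map (omMap f) h) t := by
          simp only [LinearMap.comp_apply]
          rw [← btMk_smul]
          congr 1
          clear * -
          induction t with
          | zero => simp
          | tmul ω m =>
            have hω : omMap f (r • ω) = f r • omMap f ω := by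
              rw [smul_om, smul_om, omMap_smul]; simp [envMap]
            simp [TensorProduct.smul_tmul', hω]
          | add a b ha hb => simp only [smul_add, map_add, ha, hb]
        rw [key, ht, smul_zero])) ∘ₗ
    (Submodule.Quotient.restrictScalarsEquiv K (btRel K R M)).symm.toLinearMap

theorem btMap_mk (f : R →ₐ[K] S) (h : M →ₗ[K] N) (hh) (t : Om K R ⊗[K] M) :
    btMap f h hh (btMk K R M t) = btMk K S N (TensorProduct.map (omMap f) h t) := rfl

end

end Forms

section FiltForms

variable {K : Type*} [Field K]
variable {R S : Type*} [Ring R] [Algebra K R] [FiltAlg K R] [Ring S] [Algebra K S] [FiltAlg K S]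
variable {M : Type*} [AddCommGroup M] [Module K M] [Filt K M] [Module R M]
variable {N : Type*} [AddCommGroup N] [Module K N] [Filt K N] [Module S N]

instance omFilt : Filt K (Om K R) := Filt.comap K (omIncl K R)

theorem mem_om {m : ℕ} {t : Om K R} : t ∈ fil K (Om K R) m ↔ omIncl K R t ∈ fil K (Env K R) m :=
  Iff.rfl

theorem op_mem {m : ℕ} {a : R} (ha : a ∈ fil K R m) : op a ∈ fil K Rᵐᵒᵖ m := ha

instance omFiltSMul : FiltSMul K (Env K R) (Om K R) where
  smul_mem {_ _ _ _} ha ht := mul_mem (K := K) (R := Env K R) ha ht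

theorem isFilt_dOm : IsFilt (dOm K R) := fun m a ha => by
  rw [mem_om]
  refine Submodule.sub_mem _ ?_ ?_
  · exact tmul_mem (i := 0) (j := m) (by simp) (mem_zero _) (op_mem ha)
  · exact tmul_mem (i := m) (j := 0) (by simp) ha (mem_zero _)

instance btFilt : Filt K (BT K R M) := Filt.map K (btMk K R M) (btMk_surjective K R M)

theorem btMk_mem {m : ℕ} {t : Om K R ⊗[K] M} (ht : t ∈ fil K (Om K R ⊗[K] M) m) :
    btMk K R M t ∈ fil K (BT K R M) m := Submodule.mem_map_of_mem ht

instance btFiltSMul : FiltSMul K R (BT K R M) where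
  smul_mem {i j r x} hr hx := by
    obtain ⟨t, ht, rfl⟩ := hx
    rw [← btMk_smul]
    refine btMk_mem ?_
    let L : Om K R ⊗[K] M →ₗ[K] Om K R ⊗[K] M :=
      { toFun := fun t => r • t
        map_add' := smul_add r
        map_smul' := fun c t => smul_comm r c t }
    refine tensor_le (p := (fil K (Om K R ⊗[K] M) (i + j)).comap L) ?_ ht
    intro a b hab ω hω m hm
    change r • (ω ⊗ₜ[K] m) ∈ fil K (Om K R ⊗[K] M) (i + j)
    rw [TensorProduct.smul_tmul']
    refine tmul_mem (i := i + a) (j := b) (by omega) ?_ hm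
    rw [smul_om]
    refine FiltSMul.smul_mem (K := K) (R := Env K R) ?_ hω
    exact tmul_mem (i := i) (j := 0) (by simp) hr (mem_zero _)

theorem isFilt_envMap {f : R →ₐ[K] S} (hf : IsFilt f.toLinearMap) :
    IsFilt (envMap f).toLinearMap := by
  have h : (envMap f).toLinearMap = TensorProduct.map f.toLinearMap f.op.toLinearMap := by
    ext; rfl
  rw [h]
  exact isFilt_map hf (fun m a ha => hf m (unop a) ha)

theorem isFilt_omMap {f : R →ₐ[K] S} (hf : IsFilt f.toLinearMap) : IsFilt (omMap f) :=
  fun m t ht => isFilt_envMap hf m (omIncl K R t) ht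

theorem isFilt_btMap {f : R →ₐ[K] S} (hf : IsFilt f.toLinearMap) {h : M →ₗ[K] N} (hN : IsFilt h)
    (hh : ∀ (r : R) (m : M), h (r • m) = f r • h m) : IsFilt (btMap f h hh) := by
  rintro m _ ⟨t, ht, rfl⟩
  rw [btMap_mk]
  exact btMk_mem (isFilt_map (isFilt_omMap hf) hN m t ht)

variable (K R M)

/-- The completed exterior derivative `R̂ → Ω̂¹R`. -/
def dHat : Comp K R →ₗ[K] Comp K (Om K R) := Comp.map (dOm K R) isFilt_dOm

/-- The completed tensor product of elements, `Ω̂¹R × M̂ → Ω̂¹R ⊗̂_R M̂`. -/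
def tensorHat : Comp K (Om K R) →ₗ[K] Comp K M →ₗ[K] Comp K (BT K R M) :=
  Comp.map₂ ((TensorProduct.mk K (Om K R) M).compr₂ (btMk K R M))
    (fun m _ hv w => btMk_mem (tmul_mem (i := m) (j := 0) (by simp) hv (mem_zero w)))
    (fun m v _ hw => btMk_mem (tmul_mem (i := 0) (j := m) (by simp) (mem_zero v) hw))

variable {K R M}

variable (K R M) in
/-- The space of `K`-linear maps `M̂ → Ω̂¹R ⊗̂_R M̂`, in which continuous connections live. -/
abbrev PreConn : Type _ := Comp K M →ₗ[K] Comp K (BT K R M)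

/-- A continuous connection on the completion `M̂` of a filtered `R`-module `M`: a continuous
`K`-linear map `D : M̂ → Ω̂¹R ⊗̂_R M̂` with `D(r m) = dr ⊗ m + r D(m)` for `r ∈ R̂`, `m ∈ M̂`. -/
structure IsContConn [IsScalarTower K R M] [FiltSMul K R M]
    (D : PreConn K R M) : Prop where
  cont : IsCont D
  leibniz : ∀ (r : Comp K R) (m : Comp K M), D (r • m) = tensorHat K R M (dHat K R r) m + r • D m

end FiltForms

/-! ### Hopf algebras -/

open Coalgebra Bialgebra HopfAlgebra

section Hopf

variable (K : Type*) [Field K] (H : Type*) [Ring H] [HopfAlgebra K H]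

/-- The homomorphism `Δ̃ = (id ⊗ S) ∘ Δ : H → H ⊗ Hᵒᵖ`. -/
def deltaTilde : H →ₐ[K] Env K H :=
  (Algebra.TensorProduct.map (AlgHom.id K H) (antipodeAlgHomOp K H)).comp (comulAlgHom K H)

variable (M : Type*) [AddCommGroup M] [Module K M] [Module H M] [IsScalarTower K H M]

/-- The underlying space `M ⊗ H` of the bimodule `Φ_H(M)`. -/
def Phi : Type _ := M ⊗[K] H

instance phiAddCommGroup : AddCommGroup (Phi K H M) := inferInstanceAs (AddCommGroup (M ⊗[K] H))
instance phiModuleK : Module K (Phi K H M) := inferInstanceAs (Module K (M ⊗[K] H))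

/-- The action `(x ⊗ y) • (m ⊗ a) = x m ⊗ y a` of `H ⊗ H` on `M ⊗ H`. -/
def phiLeft₂ : H ⊗[K] H →ₐ[K] Module.End K (M ⊗[K] H) :=
  (Module.endTensorEndAlgHom (R := K) (S := K) (A := K) (M := M) (N := H)).comp
    (Algebra.TensorProduct.map (Algebra.lsmul K K M) (Algebra.lsmul K K H))

@[simp]
theorem phiLeft₂_tmul (x y : H) (m : M) (a : H) :
    phiLeft₂ K H M (x ⊗ₜ y) (m ⊗ₜ a) = (x • m) ⊗ₜ (y * a) := rfl

/-- The action `x • (m ⊗ a) = x₁ m ⊗ x₂ a` of `H` on `M ⊗ H`. -/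
def phiLeft : H →ₐ[K] Module.End K (M ⊗[K] H) := (phiLeft₂ K H M).comp (comulAlgHom K H)

/-- The action `(m ⊗ a) • y = m ⊗ a y` of `Hᵒᵖ` on `M ⊗ H`. -/
def phiRight : Hᵐᵒᵖ →ₐ[K] Module.End K (M ⊗[K] H) :=
  (Module.End.lTensorAlgHom K H M).comp (Algebra.lsmul K K H)

@[simp]
theorem phiRight_tmul (y : Hᵐᵒᵖ) (m : M) (a : H) :
    phiRight K H M y (m ⊗ₜ a) = m ⊗ₜ (a * unop y) := rfl

theorem phi_commute₂ (x : H ⊗[K] H) (y : Hᵐᵒᵖ) :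
    Commute (phiLeft₂ K H M x) (phiRight K H M y) := by
  induction x with
  | zero => simp
  | tmul a b =>
    refine TensorProduct.ext' fun m c => ?_
    simp [Module.End.mul_apply, mul_assoc]
  | add a b ha hb => rw [map_add]; exact ha.add_left hb

theorem phi_commute (x : H) (y : Hᵐᵒᵖ) : Commute (phiLeft K H M x) (phiRight K H M y) :=
  phi_commute₂ K H M _ y

/-- The action of the enveloping algebra on `Φ_H(M)`:
`x • (m ⊗ a) • y = x₁ m ⊗ x₂ a y`. -/
def phiAct : Env K H →ₐ[K] Module.End K (M ⊗[K] H) :=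
  Algebra.TensorProduct.lift (phiLeft K H M) (phiRight K H M) (phi_commute K H M)

instance phiModuleEnv : Module (Env K H) (Phi K H M) :=
  Module.compHom (M ⊗[K] H) (phiAct K H M).toRingHom

variable {K H M}

theorem smul_phi (x : Env K H) (t : Phi K H M) : x • t = phiAct K H M x t := rfl

instance phiTower : IsScalarTower K (Env K H) (Phi K H M) where
  smul_assoc c x t := by
    rw [smul_phi, smul_phi, map_smul]; rfl

variable (K H M)

/-- The map `j_M : M → Φ_H(M)`, `m ↦ m ⊗ 1`. -/
def phiJ : M →ₗ[K] Phi K H M := (TensorProduct.mk K M H).flip 1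

variable {K H M}

/-- `j_M` is a module homomorphism over `Δ̃`. -/
theorem phiJ_smul (x : H) (m : M) : phiJ K H M (x • m) = deltaTilde K H x • phiJ K H M m := by
  let G : H ⊗[K] (H ⊗[K] H) →ₗ[K] M ⊗[K] H :=
    TensorProduct.map ((Algebra.lsmul K K M).toLinearMap.flip m)
      (LinearMap.mul' K H ∘ₗ (antipode K).lTensor H)
  have h1 : ∀ t : H ⊗[K] H, phiAct K H M
      (Algebra.TensorProduct.map (AlgHom.id K H) (antipodeAlgHomOp K H) t) (m ⊗ₜ[K] 1) =
      G (TensorProduct.assoc K H H H ((comul (R := K)).rTensor H t)) := by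
    intro t
    induction t with
    | zero => simp
    | add a b ha hb => simp only [map_add, LinearMap.add_apply, ha, hb]
    | tmul a c =>
      have h2 : ∀ s : H ⊗[K] H, phiLeft₂ K H M s (m ⊗ₜ[K] antipode K c) =
          G (TensorProduct.assoc K H H H (s ⊗ₜ c)) := by
        intro s
        induction s with
        | zero => simp
        | add a b ha hb => simp only [map_add, LinearMap.add_apply, TensorProduct.add_tmul, ha, hb]
        | tmul p q => simp [G]
      simp only [Algebra.TensorProduct.map_tmul, AlgHom.id_apply, LinearMap.rTensor_tmul, ← h2,
        phiAct, Algebra.TensorProduct.lift_tmul, Module.End.mul_apply, phiRight_tmul]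
      simp [phiLeft]
  have h3 : ∀ t : H ⊗[K] H, G ((comul (R := K)).lTensor H t) =
      (TensorProduct.rid K H ((counit (R := K)).lTensor H t) • m) ⊗ₜ[K] (1 : H) := by
    intro t
    induction t with
    | zero => simp
    | add a b ha hb => simp only [map_add, add_smul, TensorProduct.add_tmul, ha, hb]
    | tmul a c =>
      simp [G, Algebra.algebraMap_eq_smul_one, TensorProduct.smul_tmul]
  change (x • m) ⊗ₜ[K] (1 : H) = phiAct K H M (deltaTilde K H x) (m ⊗ₜ[K] 1)
  simp only [deltaTilde, AlgHom.comp_apply]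
  rw [h1, comulAlgHom_apply, coassoc_apply, h3, lTensor_counit_comul]
  simp

variable (K H)

/-- The augmentation ideal `Ker ε`, a left `H`-module. -/
abbrev Aug : Type _ := (RingHom.ker (counitAlgHom K H) : Ideal H)

theorem envMul_deltaTilde (x : H) :
    envMul K H (deltaTilde K H x) = algebraMap K H (counit (R := K) x) := by
  rw [← mul_antipode_lTensor_comul_apply]
  have h : ∀ t : H ⊗[K] H, envMul K H
      (Algebra.TensorProduct.map (AlgHom.id K H) (antipodeAlgHomOp K H) t) =
      LinearMap.mul' K H ((antipode K).lTensor H t) := by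
    intro t
    induction t with
    | zero => simp
    | add a b ha hb => simp only [map_add, ha, hb]
    | tmul a b => simp
  exact h _

theorem deltaTilde_comul (x : H) :
    TensorProduct.lift ((LinearMap.mul K (Env K H)).flip.compl₁₂ (deltaTilde K H).toLinearMap
      ((Algebra.TensorProduct.includeRight : Hᵐᵒᵖ →ₐ[K] Env K H).toLinearMap ∘ₗ
        (opLinearEquiv K).toLinearMap)) (comul x) = x ⊗ₜ[K] (1 : Hᵐᵒᵖ) := by
  let G : H ⊗[K] (H ⊗[K] H) →ₗ[K] Env K H :=
    TensorProduct.map LinearMap.id ((opLinearEquiv K).toLinearMap ∘ₗ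
      LinearMap.mul' K H ∘ₗ (antipode K).rTensor H)
  have h1 : ∀ t : H ⊗[K] H, TensorProduct.lift ((LinearMap.mul K (Env K H)).flip.compl₁₂
      (deltaTilde K H).toLinearMap
      ((Algebra.TensorProduct.includeRight : Hᵐᵒᵖ →ₐ[K] Env K H).toLinearMap ∘ₗ
        (opLinearEquiv K).toLinearMap)) t =
      G (TensorProduct.assoc K H H H ((comul (R := K)).rTensor H t)) := by
    intro t
    induction t with
    | zero => simp
    | add a b ha hb => simp only [map_add, ha, hb]
    | tmul a c =>
      have h2 : ∀ s : H ⊗[K] H, ((1 : H) ⊗ₜ[K] op c) *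
          Algebra.TensorProduct.map (AlgHom.id K H) (antipodeAlgHomOp K H) s =
          G (TensorProduct.assoc K H H H (s ⊗ₜ c)) := by
        intro s
        induction s with
        | zero => simp
        | add a b ha hb => simp only [map_add, mul_add, TensorProduct.add_tmul, ha, hb]
        | tmul p q => simp [G]
      rw [LinearMap.rTensor_tmul, ← h2]
      rfl
  have h3 : ∀ t : H ⊗[K] H, G ((comul (R := K)).lTensor H t) =
      TensorProduct.rid K H ((counit (R := K)).lTensor H t) ⊗ₜ[K] (1 : Hᵐᵒᵖ) := by
    intro t
    induction t with
    | zero => simp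
    | add a b ha hb => simp only [map_add, TensorProduct.add_tmul, ha, hb]
    | tmul a c =>
      simp [G, Algebra.algebraMap_eq_smul_one, TensorProduct.smul_tmul]
  rw [h1, coassoc_apply, h3, lTensor_counit_comul]
  simp

/-- The map `Ker ε ⊗ H → H ⊗ Hᵒᵖ`, `ω ⊗ b ↦ b̄ Δ̃(ω)`, that is, the restriction of the isomorphism
`Φ_H(H) → H ⊗ H`, `x ⊗ y ↦ x₁ ⊗ S(x₂) y`. -/
def phiEnv : Aug K H ⊗[K] H →ₗ[K] Env K H :=
  TensorProduct.lift ((LinearMap.mul K (Env K H)).flip.compl₁₂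
    ((deltaTilde K H).toLinearMap ∘ₗ
      (Submodule.subtype (RingHom.ker (counitAlgHom K H) : Ideal H)).restrictScalars K)
    ((Algebra.TensorProduct.includeRight : Hᵐᵒᵖ →ₐ[K] Env K H).toLinearMap ∘ₗ
      (opLinearEquiv K).toLinearMap))

theorem phiEnv_tmul (m : Aug K H) (b : H) :
    phiEnv K H (m ⊗ₜ[K] b) = ((1 : H) ⊗ₜ[K] op b) * deltaTilde K H m.1 := rfl

theorem envMul_phiEnv (t : Aug K H ⊗[K] H) : envMul K H (phiEnv K H t) = 0 := by
  induction t with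
  | zero => simp
  | add a b ha hb => rw [map_add, map_add, ha, hb, add_zero]
  | tmul m b =>
    rw [phiEnv_tmul, envMul_tmul_mul, envMul_deltaTilde, show counit (R := K) m.1 = 0 from m.2]
    simp

theorem phiEnv_act (x : Env K H) (t : Aug K H ⊗[K] H) :
    phiEnv K H (phiAct K H (Aug K H) x t) = x * phiEnv K H t := by
  have key : ∀ (x y b : H) (m : Aug K H),
      phiEnv K H (phiAct K H (Aug K H) (x ⊗ₜ op y) (m ⊗ₜ[K] b)) =
      (x ⊗ₜ op y) * phiEnv K H (m ⊗ₜ[K] b) := by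
    intro x y b m
    have h2 : ∀ s : H ⊗[K] H, phiEnv K H
        (phiLeft₂ K H (Aug K H) s (m ⊗ₜ[K] (b * y))) = ((1 : H) ⊗ₜ[K] op (b * y)) *
        (TensorProduct.lift ((LinearMap.mul K (Env K H)).flip.compl₁₂ (deltaTilde K H).toLinearMap
          ((Algebra.TensorProduct.includeRight : Hᵐᵒᵖ →ₐ[K] Env K H).toLinearMap ∘ₗ
            (opLinearEquiv K).toLinearMap)) s) * deltaTilde K H m.1 := by
      intro s
      induction s with
      | zero => simp
      | add a b ha hb => simp only [map_add, LinearMap.add_apply, mul_add, add_mul, ha, hb]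
      | tmul p q =>
        rw [phiLeft₂_tmul, phiEnv_tmul]
        simp [← mul_assoc]
    have h3 : phiAct K H (Aug K H) (x ⊗ₜ op y) (m ⊗ₜ[K] b) =
        phiLeft₂ K H (Aug K H) (comul x) (m ⊗ₜ[K] (b * y)) := rfl
    rw [h3, h2, deltaTilde_comul, phiEnv_tmul]
    simp [← mul_assoc]
  induction x using TensorProduct.induction_on with
  | zero => simp
  | add a b ha hb => simp only [map_add, LinearMap.add_apply, add_mul, ha, hb]
  | tmul x y =>
    induction t with
    | zero => simp
    | add a b ha hb => simp only [map_add, mul_add, ha, hb]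
    | tmul m b => exact key x (unop y) b m

/-- The homomorphism of bimodules `Φ_H(Ker ε) → Ω¹H`, `ω ⊗ b ↦ b̄ Δ̃(ω)`. -/
def phiOm : Phi K H (Aug K H) →ₗ[K] Om K H where
  toFun t := omMk (phiEnv K H t) (envMul_phiEnv K H t)
  map_add' a b := omIncl_injective ((phiEnv K H).map_add a b)
  map_smul' c a := omIncl_injective (by
    rw [map_smul]; exact (phiEnv K H).map_smul c a)

variable {K H}

theorem phiOm_smul (x : Env K H) (t : Phi K H (Aug K H)) :
    phiOm K H (x • t) = x • phiOm K H t :=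
  omIncl_injective (phiEnv_act K H x t)

end Hopf

/-- A filtered Hopf algebra: the coproduct and the antipode respect the filtrations. -/
class FiltHopf (K H : Type*) [Field K] [Ring H] [HopfAlgebra K H] extends FiltAlg K H where
  comul_mem : IsFilt (comul : H →ₗ[K] H ⊗[K] H)
  antipode_mem : IsFilt (antipode K : H →ₗ[K] H)

section FiltHopf

variable {K : Type*} [Field K] {H : Type*} [Ring H] [HopfAlgebra K H] [FiltHopf K H]
variable {M : Type*} [AddCommGroup M] [Module K M] [Filt K M] [Module H M] [IsScalarTower K H M]
  [FiltSMul K H M]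

theorem isFilt_deltaTilde : IsFilt (deltaTilde K H).toLinearMap := by
  have h : (deltaTilde K H).toLinearMap = TensorProduct.map LinearMap.id
      (antipodeAlgHomOp K H).toLinearMap ∘ₗ comul := rfl
  intro m x hx
  rw [h]
  have h1 : IsFilt (LinearMap.id : H →ₗ[K] H) := fun _ _ hv => hv
  have h2 : IsFilt (antipodeAlgHomOp K H).toLinearMap :=
    fun m x hx => FiltHopf.antipode_mem (K := K) m x hx
  exact isFilt_map h1 h2 m _ (FiltHopf.comul_mem m x hx)

instance phiFilt : Filt K (Phi K H M) := inferInstanceAs (Filt K (M ⊗[K] H))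

instance phiFiltSMul : FiltSMul K (Env K H) (Phi K H M) where
  smul_mem {i j x t} hx ht := by
    change phiAct K H M x t ∈ fil K (M ⊗[K] H) (i + j)
    refine tensor_le (p := (fil K (M ⊗[K] H) (i + j)).comap
      ((phiAct K H M).toLinearMap.flip t)) ?_ hx
    intro a b hab v hv w hw
    refine tensor_le (p := (fil K (M ⊗[K] H) (i + j)).comap (phiAct K H M (v ⊗ₜ w))) ?_ ht
    intro c e hce m hm y hy
    have h : phiAct K H M (v ⊗ₜ w) (m ⊗ₜ y) = phiLeft₂ K H M (comul v) (m ⊗ₜ (y * unop w)) := rfl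
    rw [Submodule.mem_comap, h]
    refine tensor_le (p := (fil K (M ⊗[K] H) (i + j)).comap
      ((phiLeft₂ K H M).toLinearMap.flip (m ⊗ₜ (y * unop w)))) ?_ (FiltHopf.comul_mem a v hv)
    intro p q hpq u hu u' hu'
    exact tmul_mem (i := p + c) (j := q + (e + b)) (by omega) (FiltSMul.smul_mem hu hm)
      (mul_mem hu' (mul_mem hy hw))

theorem isFilt_phiJ : IsFilt (phiJ K H M) := fun m v hv =>
  tmul_mem (i := m) (j := 0) (by simp) hv (mem_zero (1 : H))

instance augFilt : Filt K (Aug K H) :=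
  Filt.comap K ((Submodule.subtype (RingHom.ker (counitAlgHom K H) : Ideal H)).restrictScalars K)

instance augFiltSMul : FiltSMul K H (Aug K H) where
  smul_mem {_ _ _ _} ha ht := mul_mem (K := K) (R := H) ha ht

theorem isFilt_phiOm : IsFilt (phiOm K H) := fun k => by
  refine tensor_le (V := Aug K H) (W := H)
    (p := (fil K (Env K H) k).comap (phiEnv K H)) fun i j hij m hm b hb => ?_
  rw [Submodule.mem_comap, phiEnv_tmul]
  refine Filt.anti (show k ≤ j + i by omega) (mul_mem (K := K) (R := Env K H) ?_ ?_)
  · exact tmul_mem (i := 0) (j := j) (by simp) (mem_zero _) (op_mem hb)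
  · exact isFilt_deltaTilde i m.1 hm

variable (K H) in
theorem isFilt_includeLeft :
    IsFilt (Algebra.TensorProduct.includeLeft : H →ₐ[K] H ⊗[K] H).toLinearMap := fun m _ hv =>
  tmul_mem (i := m) (j := 0) (by simp) hv (mem_zero (1 : H))

variable (K H) in
theorem isFilt_includeRight :
    IsFilt (Algebra.TensorProduct.includeRight : H →ₐ[K] H ⊗[K] H).toLinearMap := fun m _ hv =>
  tmul_mem (i := 0) (j := m) (by simp) (mem_zero (1 : H)) hv

/-! ### The primitive part of a complete Hopf algebra -/

attribute [local instance 100] LieRing.ofAssociativeRing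

variable (K H)

/-- The completed coproduct `Ĥ → Ĥ ⊗̂ Ĥ`. -/
def comulHat : Comp K H →ₗ[K] Comp K (H ⊗[K] H) :=
  Comp.map (comulAlgHom K H).toLinearMap FiltHopf.comul_mem

/-- `x ↦ x ⊗̂ 1` -/
def inlHat : Comp K H →ₗ[K] Comp K (H ⊗[K] H) := Comp.map _ (isFilt_includeLeft K H)

/-- `x ↦ 1 ⊗̂ x` -/
def inrHat : Comp K H →ₗ[K] Comp K (H ⊗[K] H) := Comp.map _ (isFilt_includeRight K H)

theorem inl_mul_inr (x y : Comp K H) : inlHat K H x * inrHat K H y = inrHat K H y * inlHat K H x := by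
  ext m
  obtain ⟨a, ha, -⟩ := Comp.exists_rep m x
  obtain ⟨b, hb, -⟩ := Comp.exists_rep m y
  have h1 := Comp.proj_map _ (isFilt_includeLeft K H) ha
  have h2 := Comp.proj_map _ (isFilt_includeRight K H) hb
  rw [inlHat, inrHat, Comp.proj_mul h1 h2, Comp.proj_mul h2 h1]
  simp

/-- The Lie algebra of primitive elements `Δ(x) = x ⊗̂ 1 + 1 ⊗̂ x` of the complete Hopf algebra `Ĥ`,
with the commutator bracket. -/
def prim : LieSubalgebra K (Comp K H) where
  carrier := {x | comulHat K H x = inlHat K H x + inrHat K H x}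
  add_mem' {x y} hx hy := by
    simp only [Set.mem_ofPred_eq, map_add] at *
    rw [hx, hy]; abel
  zero_mem' := by simp
  smul_mem' c x hx := by
    simp only [Set.mem_ofPred_eq, map_smul] at *
    rw [hx, smul_add]
  lie_mem' {x y} hx hy := by
    have hx : comulHat K H x = inlHat K H x + inrHat K H x := hx
    have hy : comulHat K H y = inlHat K H y + inrHat K H y := hy
    have h1 : ∀ a b, comulHat K H (a * b) = comulHat K H a * comulHat K H b :=
      Comp.map_mul FiltHopf.comul_mem
    have h2 : ∀ a b, inlHat K H (a * b) = inlHat K H a * inlHat K H b :=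
      Comp.map_mul (isFilt_includeLeft K H)
    have h3 : ∀ a b, inrHat K H (a * b) = inrHat K H a * inrHat K H b :=
      Comp.map_mul (isFilt_includeRight K H)
    change comulHat K H ⁅x, y⁆ = inlHat K H ⁅x, y⁆ + inrHat K H ⁅x, y⁆
    rw [LieRing.of_associative_ring_bracket, map_sub, map_sub, map_sub, h1, h1, h2, h2, h3, h3, hx,
      hy]
    have e1 := inl_mul_inr K H x y
    have e2 := inl_mul_inr K H y x
    simp only [mul_add, add_mul, e1, e2]
    abel

/-- The primitive part of the completion of `H`. -/
def Prim : Type _ := prim K H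

instance primLieRing : LieRing (Prim K H) := inferInstanceAs (LieRing (prim K H))
instance primLieAlgebra : LieAlgebra K (Prim K H) := inferInstanceAs (LieAlgebra K (prim K H))

/-- The inclusion of the primitive part. -/
def primIncl : Prim K H →ₗ⁅K⁆ Comp K H := (prim K H).incl

instance primFilt : Filt K (Prim K H) := Filt.comap K (primIncl K H : Prim K H →ₗ[K] Comp K H)

end FiltHopf

/-! ### The group algebra, filtered by the powers of the augmentation ideal -/

section Group

variable (K : Type*) [Field K] (G : Type*) [Group G]

/-- The augmentation ideal of the group algebra. -/
def grpAug : Ideal (MonoidAlgebra K G) := RingHom.ker (counitAlgHom K (MonoidAlgebra K G))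

instance grpAugTwoSided : (grpAug K G).IsTwoSided := inferInstanceAs (RingHom.ker _).IsTwoSided

instance grpFiltAlg : FiltAlg K (MonoidAlgebra K G) where
  F m := (grpAug K G ^ m).restrictScalars K
  anti m n h := Ideal.pow_le_pow_right h
  zero := by simp [Submodule.pow_zero, Ideal.one_eq_top]
  mul_mem {i j a b} ha hb := by
    simp only [Submodule.restrictScalars_mem] at *
    rw [Ideal.IsTwoSided.pow_add]
    exact Ideal.mul_mem_mul ha hb

theorem grp_le {V : Type*} [Ring V] [Algebra K V] [FiltAlg K V]
    (f : MonoidAlgebra K G →ₗ[K] V)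
    (h : ∀ x ∈ grpAug K G, ∀ m, ∀ y, f y ∈ fil K V m → f (x * y) ∈ fil K V (m + 1)) :
    IsFilt f := by
  intro m
  induction m with
  | zero => intro x _; exact mem_zero _
  | succ m ih =>
    intro x hx
    have hx : x ∈ grpAug K G ^ (m + 1) := hx
    rw [Ideal.IsTwoSided.pow_succ] at hx
    refine Submodule.smul_induction_on hx ?_ ?_
    · intro a ha b hb
      exact h a ha m b (ih b hb)
    · intro a b ha hb
      rw [map_add]; exact Submodule.add_mem _ ha hb

theorem mem_grpAug (x : MonoidAlgebra K G) :
    x ∈ grpAug K G ↔ counit (R := K) x = 0 := Iff.rfl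

theorem grpAug_comul (x : MonoidAlgebra K G) (hx : x ∈ grpAug K G) :
    comul (R := K) x ∈ fil K (MonoidAlgebra K G ⊗[K] MonoidAlgebra K G) 1 := by
  have key : ∀ y : MonoidAlgebra K G, comul (R := K) y - counit (R := K) y •
      ((1 : MonoidAlgebra K G) ⊗ₜ[K] (1 : MonoidAlgebra K G)) ∈
      fil K (MonoidAlgebra K G ⊗[K] MonoidAlgebra K G) 1 := by
    intro y
    induction y using MonoidAlgebra.induction_linear with
    | zero => simp
    | add a b ha hb =>
      have := Submodule.add_mem _ ha hb
      rw [map_add, map_add, add_smul]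
      convert this using 1
      abel
    | single g c =>
      have hg : MonoidAlgebra.single g (1 : K) - 1 ∈ fil K (MonoidAlgebra K G) 1 := by
        change _ ∈ grpAug K G ^ 1
        rw [Submodule.pow_one, mem_grpAug]
        simp
      have h1 := tmul_mem (K := K) (i := 1) (j := 0) (m := 1) (by simp) hg
        (mem_zero (MonoidAlgebra.single g (1 : K)))
      have h2 := tmul_mem (K := K) (i := 0) (j := 1) (m := 1) (by simp)
        (mem_zero (1 : MonoidAlgebra K G)) hg
      have h3 := Submodule.smul_mem _ c (Submodule.add_mem _ h1 h2)
      have hs : MonoidAlgebra.single g c = c • MonoidAlgebra.single g (1 : K) := by simp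
      rw [hs, map_smul, map_smul]
      convert h3 using 1
      simp [TensorProduct.sub_tmul, TensorProduct.tmul_sub, smul_sub]
  have := key x
  rwa [(mem_grpAug K G x).1 hx, zero_smul, sub_zero] at this

instance grpFiltHopf : FiltHopf K (MonoidAlgebra K G) where
  comul_mem := by
    refine grp_le K G (comulAlgHom K (MonoidAlgebra K G)).toLinearMap ?_
    intro x hx m y hy
    have := mul_mem (K := K) (grpAug_comul K G x hx) hy
    rw [add_comm] at this
    simpa using this
  antipode_mem := by
    refine grp_le K G (antipode K) ?_
    intro x hx m y hy
    rw [antipode_mul_antidistrib]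
    refine mul_mem hy ?_
    change _ ∈ grpAug K G ^ 1
    rw [Submodule.pow_one, mem_grpAug, counit_antipode]
    exact hx

end Group

/-! ### The enveloping algebra of a Lie algebra -/

section Lie

attribute [local instance 100] LieRing.ofAssociativeRing

variable (K : Type*) [Field K] (L : Type*) [LieRing L] [LieAlgebra K L]

/-- The universal enveloping algebra of `L`. -/
abbrev UEA : Type _ := UniversalEnvelopingAlgebra K L

/-- The inclusion of a Lie algebra in its enveloping algebra as a linear map. -/
def ueaι : L →ₗ[K] UEA K L := (UniversalEnvelopingAlgebra.ι K : L →ₗ⁅K⁆ UEA K L)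

variable {K L}

theorem ueaι_lie (x y : L) :
    ueaι K L ⁅x, y⁆ = ueaι K L x * ueaι K L y - ueaι K L y * ueaι K L x :=
  LieHom.map_lie (UniversalEnvelopingAlgebra.ι K) x y

/-- The algebra homomorphism on the enveloping algebra defined by a linear map that takes brackets
to commutators. -/
def ueaLift {A : Type*} [Ring A] [Algebra K A] (f : L →ₗ[K] A)
    (hf : ∀ x y, f ⁅x, y⁆ = f x * f y - f y * f x) : UEA K L →ₐ[K] A :=
  UniversalEnvelopingAlgebra.lift K { f with map_lie' := fun {x y} => hf x y }

@[simp]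
theorem ueaLift_ι {A : Type*} [Ring A] [Algebra K A] (f : L →ₗ[K] A) (hf) (x : L) :
    ueaLift f hf (ueaι K L x) = f x :=
  UniversalEnvelopingAlgebra.lift_ι_apply K _ x

theorem uea_hom_ext {A : Type*} [Ring A] [Algebra K A] {f g : UEA K L →ₐ[K] A}
    (h : ∀ x, f (ueaι K L x) = g (ueaι K L x)) : f = g :=
  UniversalEnvelopingAlgebra.hom_ext K (LieHom.ext h)

theorem uea_subalgebra_eq_top (S : Subalgebra K (UEA K L)) (h : ∀ x, ueaι K L x ∈ S) (u : UEA K L) : u ∈ S := by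
  let f : UEA K L →ₐ[K] S := ueaLift
    { toFun := fun x => (⟨ueaι K L x, h x⟩ : S)
      map_add' := fun x y => Subtype.ext (by simp)
      map_smul' := fun c x => Subtype.ext (by simp) }
    (fun x y => Subtype.ext (ueaι_lie x y))
  have hf : S.val.comp f = AlgHom.id K (UEA K L) := uea_hom_ext fun x => by
    simp [f]
  have := congrArg (fun g : UEA K L →ₐ[K] UEA K L => g u) hf
  simp only [AlgHom.comp_apply, AlgHom.id_apply] at this
  rw [← this]
  exact (f u).2

/-- A subspace of the enveloping algebra that contains `1` and is stable under left multiplication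
by elements of the Lie algebra is everything. -/
theorem uea_submodule_eq_top (P : Submodule K (UEA K L)) (h1 : 1 ∈ P)
    (h : ∀ x, ∀ v ∈ P, ueaι K L x * v ∈ P) (u : UEA K L) : u ∈ P := by
  let S : Subalgebra K (UEA K L) :=
    { carrier := {u | ∀ v ∈ P, u * v ∈ P}
      mul_mem' := fun {a b} ha hb v hv => by rw [mul_assoc]; exact ha _ (hb v hv)
      add_mem' := fun {a b} ha hb v hv => by rw [add_mul]; exact P.add_mem (ha v hv) (hb v hv)
      algebraMap_mem' := fun c v hv => by rw [← Algebra.smul_def]; exact P.smul_mem c hv }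
  have := uea_subalgebra_eq_top S h u 1 h1
  rwa [mul_one] at this

variable (K L)

/-- `Δ(x) = x ⊗ 1 + 1 ⊗ x` for `x ∈ L`. -/
def ueaComul : UEA K L →ₐ[K] UEA K L ⊗[K] UEA K L :=
  ueaLift ((TensorProduct.mk K (UEA K L) (UEA K L)).flip 1 ∘ₗ ueaι K L + TensorProduct.mk K (UEA K L) (UEA K L) 1 ∘ₗ ueaι K L)
    (fun x y => by
      simp only [LinearMap.add_apply, LinearMap.comp_apply, LinearMap.flip_apply,
        TensorProduct.mk_apply, ueaι_lie, TensorProduct.sub_tmul, TensorProduct.tmul_sub, add_mul,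
        mul_add, Algebra.TensorProduct.tmul_mul_tmul, one_mul, mul_one]
      abel)

/-- `ε(x) = 0` for `x ∈ L`. -/
def ueaCounit : UEA K L →ₐ[K] K := ueaLift 0 (by simp)

/-- `S(x) = -x` for `x ∈ L`. -/
def ueaAntipode : UEA K L →ₐ[K] (UEA K L)ᵐᵒᵖ :=
  ueaLift (-((opLinearEquiv K).toLinearMap ∘ₗ ueaι K L)) (fun x y => by
    simp [ueaι_lie])

variable {K L}

theorem ueaComul_ι (x : L) :
    ueaComul K L (ueaι K L x) = ueaι K L x ⊗ₜ[K] 1 + 1 ⊗ₜ[K] ueaι K L x := by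
  simp [ueaComul]

theorem ueaCounit_ι (x : L) : ueaCounit K L (ueaι K L x) = 0 := by
  simp [ueaCounit]

theorem ueaAntipode_ι (x : L) : ueaAntipode K L (ueaι K L x) = - op (ueaι K L x) := by
  simp [ueaAntipode]

instance ueaBialgebra : Bialgebra K (UEA K L) :=
  Bialgebra.ofAlgHom (ueaComul K L) (ueaCounit K L)
    (uea_hom_ext fun x => by
      simp [ueaComul_ι, TensorProduct.add_tmul, TensorProduct.tmul_add,
        Algebra.TensorProduct.one_def, add_assoc])
    (uea_hom_ext fun x => by simp [ueaComul_ι, ueaCounit_ι])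
    (uea_hom_ext fun x => by simp [ueaComul_ι, ueaCounit_ι])

theorem uea_comul_apply (u : UEA K L) : comul (R := K) u = ueaComul K L u := rfl
theorem uea_counit_apply (u : UEA K L) : counit (R := K) u = ueaCounit K L u := rfl

variable (K L)

/-- The antipode as a linear map. -/
def ueaS : UEA K L →ₗ[K] UEA K L :=
  (opLinearEquiv K).symm.toLinearMap ∘ₗ (ueaAntipode K L).toLinearMap

variable {K L}

theorem ueaS_mul (u v : UEA K L) : ueaS K L (u * v) = ueaS K L v * ueaS K L u := by
  simp [ueaS]

theorem ueaS_ι (x : L) : ueaS K L (ueaι K L x) = - ueaι K L x := by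
  simp [ueaS, ueaAntipode_ι]

theorem uea_antipode_left (u : UEA K L) :
    LinearMap.mul' K (UEA K L) ((ueaS K L).rTensor (UEA K L) (ueaComul K L u)) =
      algebraMap K (UEA K L) (ueaCounit K L u) := by
  let P : Submodule K (UEA K L) := LinearMap.ker
    (LinearMap.mul' K (UEA K L) ∘ₗ (ueaS K L).rTensor (UEA K L) ∘ₗ (ueaComul K L).toLinearMap -
      Algebra.linearMap K (UEA K L) ∘ₗ (ueaCounit K L).toLinearMap)
  have h := uea_submodule_eq_top P ?_ ?_ u
  · simpa [P, sub_eq_zero] using h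
  · simp [P, ueaS, Algebra.TensorProduct.one_def]
  · intro x v _
    have h2 : ∀ t : UEA K L ⊗[K] UEA K L, LinearMap.mul' K (UEA K L) ((ueaS K L).rTensor (UEA K L)
        ((ueaι K L x ⊗ₜ[K] 1 + 1 ⊗ₜ[K] ueaι K L x) * t)) = 0 := by
      intro t
      induction t with
      | zero => simp
      | add a b ha hb => rw [mul_add, map_add, map_add, ha, hb, add_zero]
      | tmul a b => simp [add_mul, ueaS_mul, ueaS_ι, mul_assoc]
    simp [P, ueaComul_ι, ueaCounit_ι, h2]

theorem uea_antipode_right (u : UEA K L) :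
    LinearMap.mul' K (UEA K L) ((ueaS K L).lTensor (UEA K L) (ueaComul K L u)) =
      algebraMap K (UEA K L) (ueaCounit K L u) := by
  let P : Submodule K (UEA K L) := LinearMap.ker
    (LinearMap.mul' K (UEA K L) ∘ₗ (ueaS K L).lTensor (UEA K L) ∘ₗ (ueaComul K L).toLinearMap -
      Algebra.linearMap K (UEA K L) ∘ₗ (ueaCounit K L).toLinearMap)
  have h := uea_submodule_eq_top P ?_ ?_ u
  · simpa [P, sub_eq_zero] using h
  · simp [P, ueaS, Algebra.TensorProduct.one_def]
  · intro x v hv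
    have hv : LinearMap.mul' K (UEA K L) ((ueaS K L).lTensor (UEA K L) (ueaComul K L v)) =
      algebraMap K (UEA K L) (ueaCounit K L v) := by simpa [P, sub_eq_zero] using hv
    have h2 : ∀ t : UEA K L ⊗[K] UEA K L, LinearMap.mul' K (UEA K L) ((ueaS K L).lTensor (UEA K L)
        ((ueaι K L x ⊗ₜ[K] 1 + 1 ⊗ₜ[K] ueaι K L x) * t)) =
        ueaι K L x * LinearMap.mul' K (UEA K L) ((ueaS K L).lTensor (UEA K L) t) -
        LinearMap.mul' K (UEA K L) ((ueaS K L).lTensor (UEA K L) t) * ueaι K L x := by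
      intro t
      induction t with
      | zero => simp
      | add a b ha hb =>
        rw [mul_add, map_add, map_add, ha, hb]
        simp only [map_add, mul_add, add_mul]
        abel
      | tmul a b => simp [add_mul, ueaS_mul, ueaS_ι, mul_assoc, sub_eq_add_neg]
    simp [P, ueaComul_ι, ueaCounit_ι, h2, hv, Algebra.commutes]

instance ueaHopfAlgebra : HopfAlgebra K (UEA K L) where
  antipode := ueaS K L
  mul_antipode_rTensor_comul := LinearMap.ext uea_antipode_left
  mul_antipode_lTensor_comul := LinearMap.ext uea_antipode_right

variable [Filt K L]

/-- The filtration of `U(L)` induced by a filtration of `L`: the `m`-th step is spanned by the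
products `x₁ ⋯ xₖ` of elements `xᵢ ∈ F mᵢ L` with `m₁ + ⋯ + mₖ ≥ m`. -/
instance ueaFiltAlg : FiltAlg K (UEA K L) where
  F m := Submodule.span K {u | ∃ l : List (ℕ × L), (∀ p ∈ l, p.2 ∈ fil K L p.1) ∧
    m ≤ (l.map Prod.fst).sum ∧ u = (l.map fun p => ueaι K L p.2).prod}
  anti m n h := Submodule.span_mono fun _ ⟨l, h1, h2, h3⟩ => ⟨l, h1, h.trans h2, h3⟩
  zero := by
    refine eq_top_iff.2 fun u _ => uea_submodule_eq_top _ ?_ ?_ u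
    · exact Submodule.subset_span ⟨[], by simp⟩
    · intro x v hv
      induction hv using Submodule.span_induction with
      | mem v hv =>
        obtain ⟨l, h1, -, rfl⟩ := hv
        refine Submodule.subset_span ⟨(0, x) :: l, ?_, by simp, by simp⟩
        intro p hp
        rcases List.mem_cons.1 hp with rfl | hp
        · exact mem_zero x
        · exact h1 p hp
      | zero => simp
      | add a b _ _ ha hb => rw [mul_add]; exact Submodule.add_mem _ ha hb
      | smul c a _ ha => rw [mul_smul_comm]; exact Submodule.smul_mem _ c ha
  mul_mem {i j a b} ha hb := by
    induction ha using Submodule.span_induction with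
    | mem a ha =>
      obtain ⟨l, h1, h2, rfl⟩ := ha
      induction hb using Submodule.span_induction with
      | mem b hb =>
        obtain ⟨l', h1', h2', rfl⟩ := hb
        refine Submodule.subset_span ⟨l ++ l', ?_, ?_, by simp⟩
        · intro p hp
          rcases List.mem_append.1 hp with hp | hp
          · exact h1 p hp
          · exact h1' p hp
        · simp only [List.map_append, List.sum_append]; omega
      | zero => simp
      | add a b _ _ ha hb => rw [mul_add]; exact Submodule.add_mem _ ha hb
      | smul c a _ ha => rw [mul_smul_comm]; exact Submodule.smul_mem _ c ha
    | zero => simp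
    | add a b _ _ ha hb => rw [add_mul]; exact Submodule.add_mem _ ha hb
    | smul c a _ ha => rw [smul_mul_assoc]; exact Submodule.smul_mem _ c ha

theorem ueaι_mem {m : ℕ} {x : L} (hx : x ∈ fil K L m) : ueaι K L x ∈ fil K (UEA K L) m :=
  Submodule.subset_span ⟨[(m, x)], by simpa using hx, by simp, by simp⟩

/-- A multiplicative linear map that respects the filtrations on `L` does so on `U(L)`. -/
theorem uea_isFilt {A : Type*} [Ring A] [Algebra K A] [FiltAlg K A] (f : UEA K L →ₐ[K] A)
    (h : ∀ m, ∀ x ∈ fil K L m, f (ueaι K L x) ∈ fil K A m) : IsFilt f.toLinearMap := by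
  intro m u hu
  induction hu using Submodule.span_induction with
  | mem u hu =>
    obtain ⟨l, h1, h2, rfl⟩ := hu
    refine Filt.anti h2 ?_
    clear h2
    induction l with
    | nil => simpa using mem_zero (1 : A)
    | cons p l ih =>
      simp only [List.map_cons, List.prod_cons, List.sum_cons, AlgHom.toLinearMap_apply, map_mul]
      exact mul_mem (h p.1 p.2 (h1 p (by simp))) (ih fun q hq => h1 q (by simp [hq]))
  | zero => simp
  | add a b _ _ ha hb => rw [map_add]; exact Submodule.add_mem _ ha hb
  | smul c a _ ha => rw [map_smul]; exact Submodule.smul_mem _ c ha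

instance ueaFiltHopf : FiltHopf K (UEA K L) where
  comul_mem := uea_isFilt (ueaComul K L) fun m x hx => by
    rw [ueaComul_ι]
    refine Submodule.add_mem _ ?_ ?_
    · exact tmul_mem (i := m) (j := 0) (by simp) (ueaι_mem hx) (mem_zero _)
    · exact tmul_mem (i := 0) (j := m) (by simp) (mem_zero _) (ueaι_mem hx)
  antipode_mem := fun m u hu => uea_isFilt (ueaAntipode K L) (fun m x hx => by
    rw [ueaAntipode_ι]
    exact Submodule.neg_mem _ (op_mem (ueaι_mem hx))) m u hu

variable (K L)

/-- The space of Lie `1`-forms: the augmentation ideal of the enveloping algebra. -/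
abbrev OmLie : Type _ := Aug K (UEA K L)

/-- The universal derivation `L → Ω¹_Lie L`. -/
def dLie : L →ₗ[K] OmLie K L where
  toFun x := ⟨ueaι K L x, ueaCounit_ι x⟩
  map_add' x y := Subtype.ext (by simp)
  map_smul' c x := Subtype.ext (by simp)

/-- The free Lie algebra, filtered by its lower central series (so that the `m`-th step, `m ≥ 1`,
consists of the elements of degree at least `m`). -/
instance freeLieFiltLie (X : Type*) : FiltLie K (FreeLieAlgebra K X) where
  F m := (LieModule.lowerCentralSeries K (FreeLieAlgebra K X) (FreeLieAlgebra K X) (m - 1) :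
    Submodule K (FreeLieAlgebra K X))
  anti m n h := LieModule.antitone_lowerCentralSeries K _ _ (Nat.sub_le_sub_right h 1)
  zero := by simp
  lie_mem a _ hb := LieSubmodule.lie_mem _ hb

end Lie

/-! ### Induced connections -/

section Induced

variable {K : Type*} [Field K]

section

variable {H : Type*} [Ring H] [HopfAlgebra K H] [FiltHopf K H]
variable {M : Type*} [AddCommGroup M] [Module K M] [Filt K M] [Module H M] [IsScalarTower K H M]
  [FiltSMul K H M]

theorem isFilt_btDelta : IsFilt (btMap (deltaTilde K H) (phiJ K H M) phiJ_smul) :=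
  isFilt_btMap (f := deltaTilde K H) isFilt_deltaTilde (h := phiJ K H M) isFilt_phiJ phiJ_smul

/-- `E` is the connection `Φ_H(D)` on (the completion of) `Φ_H(M)` induced by the connection `D`
on `M`: it is a connection and `E ∘ j_M = (Δ̃ ⊗ j_M) ∘ D`. -/
structure IsPhiConn (D : PreConn K H M) (E : PreConn K (Env K H) (Phi K H M)) : Prop where
  conn : IsContConn E
  comm : ∀ m : Comp K M, E (Comp.map (phiJ K H M) isFilt_phiJ m) =
    Comp.map (btMap (deltaTilde K H) (phiJ K H M) phiJ_smul) isFilt_btDelta (D m)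

end

section

variable {A : Type*} [Ring A] [Algebra K A] [FiltAlg K A]

/-- `E` is a continuous extension of the connection `D` on `Ω¹A` to a connection on the
`1`-forms of the completed algebra `Â`. -/
structure IsContExt (D : Om K A →ₗ[K] BT K (Env K A) (Om K A))
    (E : PreConn K (Env K (Comp K A)) (Om K (Comp K A))) : Prop where
  conn : IsContConn E
  extends_ : ∀ ω : Om K A, E (Comp.of (omMap (Comp.ofAlg : A →ₐ[K] Comp K A) ω)) =
    Comp.of (btMap (envMap (Comp.ofAlg : A →ₐ[K] Comp K A)) (omMap Comp.ofAlg)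
      (omMap_smul Comp.ofAlg) (D ω))

end

section

variable (K) (H : Type*) [Ring H] [HopfAlgebra K H] [FiltHopf K H]

theorem primIncl_lie (x y : Prim K H) : (primIncl K H : Prim K H →ₗ[K] Comp K H) ⁅x, y⁆ =
    (primIncl K H : Prim K H →ₗ[K] Comp K H) x * (primIncl K H : Prim K H →ₗ[K] Comp K H) y -
    (primIncl K H : Prim K H →ₗ[K] Comp K H) y * (primIncl K H : Prim K H →ₗ[K] Comp K H) x := rfl

/-- The canonical homomorphism `U(P(Ĥ)) → Ĥ`. -/
def primHom : UEA K (Prim K H) →ₐ[K] Comp K H :=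
  ueaLift (primIncl K H : Prim K H →ₗ[K] Comp K H) (primIncl_lie K H)

theorem isFilt_primHom : IsFilt (primHom K H).toLinearMap :=
  uea_isFilt _ fun m x hx => by
    rw [primHom, ueaLift_ι]
    exact hx

/-- The map `Φ(Ω¹_Lie P(Ĥ)) → Ω¹ U(P(Ĥ)) → Ω¹Ĥ`. -/
def primPhiOm : Phi K (UEA K (Prim K H)) (OmLie K (Prim K H)) →ₗ[K] Om K (Comp K H) :=
  omMap (primHom K H) ∘ₗ phiOm K (UEA K (Prim K H))

theorem primPhiOm_smul (x : Env K (UEA K (Prim K H)))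
    (t : Phi K (UEA K (Prim K H)) (OmLie K (Prim K H))) :
    primPhiOm K H (x • t) = envMap (primHom K H) x • primPhiOm K H t := by
  simp only [primPhiOm, LinearMap.comp_apply, phiOm_smul, omMap_smul]

theorem isFilt_primPhiOm : IsFilt (primPhiOm K H) := fun m t ht =>
  isFilt_omMap (isFilt_primHom K H) m _ (isFilt_phiOm m t ht)

theorem isFilt_primPhiBT : IsFilt (btMap (envMap (primHom K H)) (primPhiOm K H)
    (primPhiOm_smul K H)) :=
  isFilt_btMap (f := envMap (primHom K H)) (isFilt_envMap (isFilt_primHom K H))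
    (h := primPhiOm K H) (isFilt_primPhiOm K H) (primPhiOm_smul K H)

/-- The completed homomorphism `Û(P(Ĥ)) → Ĥ`. -/
def primHomHat : Comp K (UEA K (Prim K H)) →ₗ[K] Comp K (Comp K H) :=
  Comp.map _ (isFilt_primHom K H)

/-- The map `Φ(Ω¹_Lie P(Ĥ)) → Ω¹Ĥ` between the completed spaces. -/
def primPhiOmHat : Comp K (Phi K (UEA K (Prim K H)) (OmLie K (Prim K H))) →ₗ[K]
    Comp K (Om K (Comp K H)) :=
  Comp.map _ (isFilt_primPhiOm K H)

/-- The map induced by `primPhiOmHat` on the spaces in which connections take their values. -/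
def primPhiBTHat : Comp K (BT K (Env K (UEA K (Prim K H)))
      (Phi K (UEA K (Prim K H)) (OmLie K (Prim K H)))) →ₗ[K]
    Comp K (BT K (Env K (Comp K H)) (Om K (Comp K H))) :=
  Comp.map _ (isFilt_primPhiBT K H)

end

section

variable (K) {G : Type*} [Group G]

/-- The `1`-form `dc c⁻¹` on the group algebra. -/
def dlog (c : G) : Om K (MonoidAlgebra K G) :=
  ((1 : MonoidAlgebra K G) ⊗ₜ[K] op (MonoidAlgebra.of K G c⁻¹)) •
    dOm K (MonoidAlgebra K G) (MonoidAlgebra.of K G c)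

variable {K}

/-- `D` is the connection `∇_𝒞` on `Ω¹KG`: `∇_𝒞(dc c⁻¹) = 0` for all `c` in the generating
system `𝒞`. -/
structure IsNablaC {ι : Type*} (C : ι → G)
    (D : Om K (MonoidAlgebra K G) →ₗ[K]
      BT K (Env K (MonoidAlgebra K G)) (Om K (MonoidAlgebra K G))) : Prop where
  conn : IsConn D
  vanish : ∀ i, D (dlog K (C i)) = 0

end

section

variable {L : Type*} [LieRing L] [LieAlgebra K L] [Filt K L]

variable (K) in
/-- The power series `(eᵗ - 1) / t = ∑ tᵏ / (k + 1)!`. -/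
def expSubOneDiv : PowerSeries K := PowerSeries.mk fun k => ((k + 1).factorial : K)⁻¹

/-- The completed Lie `1`-form `((e^z - 1) / z) dz`. -/
def expForm (z : L) : Comp K (OmLie K L) :=
  evalSeries (expSubOneDiv K) (Comp.of (ueaι K L z)) • Comp.of (dLie K L z)

/-- `D` is a continuous connection on the completed Lie `1`-forms with
`D(((e^{z_i} - 1) / z_i) dz_i) = 0` for all `i`. -/
structure IsNablaLie {ι : Type*} (z : ι → L)
    (D : PreConn K (UEA K L) (OmLie K L)) : Prop where
  conn : IsContConn D
  vanish : ∀ i, D (expForm (z i)) = 0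

end

end Induced

end CompletedConn

end

noncomputable section

open scoped TensorProduct
open MulOpposite

namespace CompletedConn

/-! ### Filtered maps that induce isomorphisms of completions -/

section QIso

variable {K : Type*} [Field K]
variable {V W X Y : Type*} [AddCommGroup V] [Module K V] [AddCommGroup W] [Module K W]
  [AddCommGroup X] [Module K X] [AddCommGroup Y] [Module K Y]
variable [Filt K V] [Filt K W] [Filt K X] [Filt K Y]

/-! Every space in the statement is a completion, so every claim is a compatible family of claims
modulo F m. The organising notion is `IsQIso`: a filtered map that is bijective modulo each F m.
Such maps become filtered isomorphisms after completion, and the class contains V → V̂ and is stable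
under composition, tensor products (linear sections exist over a field) and passage to `1`-forms.

The Lie algebra. Let L be the free Lie algebra on the z_i. In a complete algebra in characteristic
zero, exp is a bijection from F 1 onto 1 + F 1; so log x_i exists, and it is primitive because x_i
is group-like. Sending z_i to log x_i gives U(L) → Â, and sending x_i to e^{z_i} gives Â → Û(L).
Their composite is the canonical map of U(L) to its completion, so U(L) → Â reflects filtrations; it
has dense image because x_i and its inverse are limits of polynomials in log x_i
(`isQIso_malcevHom`). To descend from U(L) to L, one needs that an element primitive modulo F m is a
Lie element modulo F m, and that L → U(L) reflects degrees. Both come from the Dynkin map r: the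
convolution of r with the identity is the derivation of U(L) that multiplies by the degree, so a
primitive u of degree j > 0 satisfies j u ≡ r(u), and j is invertible (`exists_sub_ueaι_mem`,
`mem_fil_of_ueaι_mem`). No Poincaré–Birkhoff–Witt theorem is involved. Hence L → P(Â) is an
isomorphism modulo every F m, and U(P(Â)) → Â follows by cancellation, since U(L) → Â factors
through it.

The bimodule. For a filtered Hopf algebra H whose counit kills F 1, the map from Φ(Ker ε) to Ω¹H has
a filtered inverse induced by x ⊗ y ↦ x₁ ⊗ x₂ y (`isQIso_phiOm`).

The connections. On a module with a finite basis e_i, the Leibniz rule leaves exactly one connection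
that kills the basis: Σ c_i e_i ↦ Σ dc_i ⊗ e_i. The forms dx_i x_i⁻¹ are a basis of Ω¹A whose
coordinates are Fox derivatives; these lower the filtration by at most one, so the basis survives
completion (`omHatBasis`). The link is `primPhiOmHat_expForm`: Δ̃(z) = z ⊗ 1 - 1 ⊗ z, so the form
((e^z - 1)/z) dz, which is e^z - 1 inside the enveloping algebra, goes to e^z ⊗ e^{-z} - 1 = -dx x⁻¹
for z = log x. These forms, tensored with 1, are therefore a topological basis of the completed
Φ(Ω¹_Lie), and applying the counit to the second factor makes them a topological basis of Ω¹_Lie.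
The three completed connections are those that vanish on corresponding bases, which gives existence,
uniqueness and compatibility together. -/

theorem fil_anti {m n : ℕ} (h : m ≤ n) {v : V} (hv : v ∈ fil K V n) : v ∈ fil K V m :=
  Filt.anti h hv

theorem IsFilt.comp {g : W →ₗ[K] X} {f : V →ₗ[K] W} (hg : IsFilt g) (hf : IsFilt f) :
    IsFilt (g ∘ₗ f) := fun m v hv => hg m _ (hf m v hv)

theorem IsFilt.isCont {f : V →ₗ[K] W} (hf : IsFilt f) : IsCont f := fun m => ⟨m, hf m⟩

theorem IsCont.comp {g : W →ₗ[K] X} {f : V →ₗ[K] W} (hg : IsCont g) (hf : IsCont f) :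
    IsCont (g ∘ₗ f) := fun m => by
  obtain ⟨k, hk⟩ := hg m
  obtain ⟨l, hl⟩ := hf k
  exact ⟨l, fun v hv => hk _ (hl v hv)⟩

/-- Filtered maps that induce isomorphisms `V ⧸ F m ≃ W ⧸ F m` for all `m`. -/
structure IsQIso (f : V →ₗ[K] W) : Prop where
  isFilt : IsFilt f
  reflects : ∀ {m v}, f v ∈ fil K W m → v ∈ fil K V m
  dense : ∀ m w, ∃ v, w - f v ∈ fil K W m

theorem IsQIso.comp {g : W →ₗ[K] X} {f : V →ₗ[K] W} (hg : IsQIso g) (hf : IsQIso f) :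
    IsQIso (g ∘ₗ f) where
  isFilt := hg.isFilt.comp hf.isFilt
  reflects h := hf.reflects (hg.reflects h)
  dense m x := by
    obtain ⟨w, hw⟩ := hg.dense m x
    obtain ⟨v, hv⟩ := hf.dense m w
    refine ⟨v, ?_⟩
    have := add_mem hw (hg.isFilt m _ hv)
    rwa [map_sub, sub_add_sub_cancel] at this

/-- Cancellation that asks only for dense image on f: modulo F m each w is some f v, so g w can be
tested through the composite. It avoids having to show beforehand that f reflects the filtration. -/
theorem IsQIso.of_comp_right {g : W →ₗ[K] X} {f : V →ₗ[K] W} (hg : IsFilt g) (hf : IsFilt f)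
    (hd : ∀ m w, ∃ v, w - f v ∈ fil K W m) (h : IsQIso (g ∘ₗ f)) : IsQIso g where
  isFilt := hg
  reflects {m w} hw := by
    obtain ⟨v, hv⟩ := hd m w
    have h1 : (g ∘ₗ f) v ∈ fil K X m := by
      have := sub_mem hw (hg m _ hv)
      rwa [map_sub, sub_sub_cancel] at this
    have := add_mem hv (hf m _ (h.reflects h1))
    rwa [sub_add_cancel] at this
  dense m x := by
    obtain ⟨v, hv⟩ := h.dense m x
    exact ⟨f v, hv⟩

theorem IsFiltIso.isQIso {f : V →ₗ[K] W} (h : IsFiltIso f) : IsQIso f where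
  isFilt m v hv := (h.2 m v).1 hv
  reflects hv := (h.2 _ _).2 hv
  dense m w := by
    obtain ⟨v, rfl⟩ := h.1.2 w
    exact ⟨v, by simp⟩

namespace Comp

theorem of_mem_fil {m : ℕ} {v : V} : of v ∈ fil K (Comp K V) m ↔ v ∈ fil K V m := by
  rw [mem_fil, proj_of, Submodule.Quotient.mk_eq_zero]

/-- Turns equalities in quotients into differences lying in F m, the form in which approximations
are handled from here on. -/
theorem proj_eq_iff {m : ℕ} {x : Comp K V} {v : V} :
    proj m x = Submodule.Quotient.mk v ↔ x - of v ∈ fil K (Comp K V) m := by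
  rw [mem_fil, map_sub, sub_eq_zero, proj_of]

theorem exists_sub_mem (m : ℕ) (x : Comp K V) : ∃ v : V, x - of v ∈ fil K (Comp K V) m := by
  obtain ⟨v, hv, -⟩ := exists_rep m x
  exact ⟨v, proj_eq_iff.1 hv⟩

theorem eq_zero_of_mem {x : Comp K V} (h : ∀ m, x ∈ fil K (Comp K V) m) : x = 0 :=
  ext fun m => by rw [map_zero]; exact h m

theorem eq_of_sub_mem {x y : Comp K V} (h : ∀ m, x - y ∈ fil K (Comp K V) m) : x = y :=
  sub_eq_zero.1 (eq_zero_of_mem h)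

theorem isQIso_of : IsQIso (of : V →ₗ[K] Comp K V) where
  isFilt := isFilt_of
  reflects := of_mem_fil.1
  dense := exists_sub_mem

/-- Completeness with a rate: the m-th component of the limit is read off from y m, so the limit
agrees with y k modulo F k. -/
theorem exists_lim (y : ℕ → Comp K V) (h : ∀ k, y (k + 1) - y k ∈ fil K (Comp K V) k) :
    ∃ x, ∀ k, x - y k ∈ fil K (Comp K V) k := by
  have h' : ∀ m n, m ≤ n → y n - y m ∈ fil K (Comp K V) m := by
    intro m n hmn
    induction n, hmn using Nat.le_induction with
    | base => simp
    | succ n hmn ih =>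
      have := add_mem (fil_anti hmn (h n)) ih
      rwa [sub_add_sub_cancel] at this
  refine ⟨mk (fun m => proj m (y m)) fun m n hmn => ?_, fun k => ?_⟩
  · rw [factor_proj hmn, ← sub_eq_zero, ← map_sub]
    exact h' m n hmn
  · rw [mem_fil, map_sub, proj_mk, sub_self]

theorem map_of {f : V →ₗ[K] W} (hf : IsFilt f) (v : V) : map f hf (of v) = of (f v) := rfl

theorem isFilt_map {f : V →ₗ[K] W} (hf : IsFilt f) : IsFilt (map f hf) := fun m x hx => by
  have : proj m x = Submodule.Quotient.mk 0 := hx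
  rw [mem_fil, proj_map f hf this, map_zero]; rfl

/-- Continuous maps from a completion are determined by their values on the image of `of`. -/
theorem hom_ext {f g : Comp K V →ₗ[K] Comp K W} (hf : IsCont f) (hg : IsCont g)
    (h : ∀ v, f (of v) = g (of v)) : f = g := by
  refine LinearMap.ext fun x => eq_of_sub_mem fun m => ?_
  obtain ⟨k, hk⟩ := hf m
  obtain ⟨l, hl⟩ := hg m
  obtain ⟨v, hv⟩ := exists_sub_mem (max k l) x
  have := sub_mem (hk _ (fil_anti (le_max_left k l) hv)) (hl _ (fil_anti (le_max_right k l) hv))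
  rw [map_sub, map_sub, h] at this
  simpa using this

/-- Compatible isomorphisms of all quotients give one of inverse limits. Reflection gives
injectivity; for surjectivity, approximate preimages of y modulo F k form a Cauchy sequence, again
by reflection. -/
theorem isFiltIso_map {f : V →ₗ[K] W} (h : IsQIso f) : IsFiltIso (map f h.isFilt) := by
  have h1 : ∀ m x, map f h.isFilt x ∈ fil K (Comp K W) m → x ∈ fil K (Comp K V) m := by
    intro m x hx
    obtain ⟨v, hv⟩ := exists_sub_mem m x
    have h2 := sub_mem hx (isFilt_map h.isFilt m _ hv)
    rw [map_sub, sub_sub_cancel, map_of, of_mem_fil] at h2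
    have := add_mem hv (of_mem_fil.2 (h.reflects h2))
    rwa [sub_add_cancel] at this
  refine ⟨⟨?_, fun y => ?_⟩, fun m x => ⟨isFilt_map h.isFilt m x, h1 m x⟩⟩
  · rw [injective_iff_map_eq_zero]
    intro x hx
    exact eq_zero_of_mem fun m => h1 m x (by rw [hx]; exact zero_mem _)
  · have : ∀ m, ∃ v, y - of (f v) ∈ fil K (Comp K W) m := fun m => by
      obtain ⟨w, hw⟩ := exists_sub_mem m y
      obtain ⟨v, hv⟩ := h.dense m w
      refine ⟨v, ?_⟩
      have := add_mem hw (of_mem_fil.2 hv)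
      rwa [map_sub, sub_add_sub_cancel] at this
    choose v hv using this
    obtain ⟨x, hx⟩ := exists_lim (fun k => of (K := K) (v k)) fun k => by
      rw [← map_sub, of_mem_fil]
      refine h.reflects ?_
      have := sub_mem (hv k) (fil_anti k.le_succ (hv (k + 1)))
      rwa [sub_sub_sub_cancel_left, ← map_sub, of_mem_fil, ← map_sub] at this
    refine ⟨x, eq_of_sub_mem fun m => ?_⟩
    have := sub_mem (isFilt_map h.isFilt m _ (hx m)) (hv m)
    rwa [map_sub, map_of, sub_sub_sub_cancel_right] at this

/-- The map induced on completions by a linear map that lowers the filtration by at most `s`. -/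
def mapShift (s : ℕ) (f : V →ₗ[K] W) (hf : ∀ m, ∀ v ∈ fil K V (m + s), f v ∈ fil K W m) :
    Comp K V →ₗ[K] Comp K W where
  toFun x := mk (fun m => Submodule.mapQ _ _ f (hf m) (proj (m + s) x)) (fun m n h => by
    obtain ⟨v, hn, hv⟩ := exists_rep (n + s) x
    rw [hn, hv (m + s) (by omega)]; rfl)
  map_add' x y := by ext m; simp
  map_smul' c x := by ext m; simp

theorem mapShift_of (s : ℕ) (f : V →ₗ[K] W) (hf) (v : V) :
    mapShift s f hf (of v) = of (f v) := rfl

theorem isCont_mapShift (s : ℕ) (f : V →ₗ[K] W) (hf) : IsCont (mapShift s f hf) := fun m =>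
  ⟨m + s, fun x hx => by
    have hx : proj (m + s) x = 0 := hx
    change Submodule.mapQ _ _ f (hf m) (proj (m + s) x) = 0
    rw [hx, map_zero]⟩

/-- The completion of a filtered space is complete. -/
def ofEquiv : Comp K V ≃ₗ[K] Comp K (Comp K V) :=
  LinearEquiv.ofBijective of (by
    -- The canonical map of the completion and the completion of the canonical map are both
    -- continuous and agree on V; the second is an isomorphism.
    have h : (of : Comp K V →ₗ[K] Comp K (Comp K V)) = map of isFilt_of :=
      hom_ext isFilt_of.isCont (isFilt_map _).isCont fun _ => rfl
    rw [h]
    exact (isFiltIso_map isQIso_of).1)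

theorem ofEquiv_apply (x : Comp K V) : ofEquiv x = of x := rfl

/-- The extension of a filtered map with values in a complete space to the completion. -/
def extend (f : V →ₗ[K] Comp K W) (hf : IsFilt f) : Comp K V →ₗ[K] Comp K W :=
  ofEquiv.symm.toLinearMap ∘ₗ map f hf

theorem of_extend (f : V →ₗ[K] Comp K W) (hf : IsFilt f) (x : Comp K V) :
    of (extend f hf x) = map f hf x :=
  ofEquiv.apply_symm_apply _

theorem extend_of (f : V →ₗ[K] Comp K W) (hf : IsFilt f) (v : V) : extend f hf (of v) = f v :=
  ofEquiv.injective (of_extend f hf (of v))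

theorem isFilt_extend (f : V →ₗ[K] Comp K W) (hf : IsFilt f) : IsFilt (extend f hf) :=
  fun m x hx => by
    rw [← of_mem_fil, of_extend]
    exact isFilt_map hf m x hx

end Comp

/-- An inverse modulo `F m` of a map that induces an isomorphism modulo `F m`. -/
theorem IsQIso.exists_inverse {f : V →ₗ[K] W} (h : IsQIso f) (m : ℕ) :
    ∃ s : W →ₗ[K] V, (∀ w, w - f (s w) ∈ fil K W m) ∧ (∀ v, v - s (f v) ∈ fil K V m) ∧
      ∀ i, i ≤ m → ∀ w ∈ fil K W i, s w ∈ fil K V i := by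
  -- Over a field the surjection V → W / F m has a linear section; composed with W → W / F m it is
  -- the required s. The other properties follow from f (s w) ≡ w by reflection.
  let q : V →ₗ[K] W ⧸ fil K W m := (fil K W m).mkQ ∘ₗ f
  have hq : LinearMap.range q = ⊤ := LinearMap.range_eq_top.2 fun y => by
    obtain ⟨w, rfl⟩ := Submodule.mkQ_surjective _ y
    obtain ⟨v, hv⟩ := h.dense m w
    exact ⟨v, ((Submodule.Quotient.eq _).2 hv).symm⟩
  obtain ⟨t, ht⟩ := q.exists_rightInverse_of_surjective hq
  have h1 : ∀ w, w - f (t ((fil K W m).mkQ w)) ∈ fil K W m := fun w => by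
    rw [← Submodule.Quotient.eq]
    exact (LinearMap.congr_fun ht (Submodule.Quotient.mk w)).symm
  refine ⟨t ∘ₗ (fil K W m).mkQ, h1, fun v => h.reflects ?_, fun i hi w hw => h.reflects ?_⟩
  · rw [map_sub]; exact h1 (f v)
  · have := sub_mem hw (fil_anti hi (h1 w))
    rwa [sub_sub_cancel] at this

/-- Inverses s and t modulo F m of the two factors tensor to an inverse modulo F m of the tensor
product, provided s ⊗ t respects the mixed filtration. -/
theorem IsQIso.tensor {f : V →ₗ[K] X} {g : W →ₗ[K] Y} (hf : IsQIso f) (hg : IsQIso g) :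
    IsQIso (TensorProduct.map f g) := by
  have key : ∀ m, ∀ (s : X →ₗ[K] V) (t : Y →ₗ[K] W), (∀ w, w - f (s w) ∈ fil K X m) →
      (∀ w, w - g (t w) ∈ fil K Y m) → ∀ z, z - TensorProduct.map f g (TensorProduct.map s t z) ∈
        fil K (X ⊗[K] Y) m := by
    intro m s t hs ht z
    induction z with
    | zero => simp
    | add a b ha hb =>
      have := add_mem ha hb
      rw [map_add, map_add]
      convert this using 1
      abel
    | tmul x y =>
      have h1 := tmul_mem (K := K) (m := m) (i := m) (j := 0) (by simp) (hs x) (mem_zero y)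
      have h2 := tmul_mem (K := K) (m := m) (i := 0) (j := m) (by simp) (mem_zero (f (s x))) (ht y)
      have := add_mem h1 h2
      rwa [TensorProduct.sub_tmul, TensorProduct.tmul_sub, sub_add_sub_cancel] at this
  refine ⟨isFilt_map hf.isFilt hg.isFilt, fun {m z} hz => ?_, fun m z => ?_⟩
  · obtain ⟨s, hs1, hs2, hs3⟩ := hf.exists_inverse m
    obtain ⟨t, ht1, ht2, ht3⟩ := hg.exists_inverse m
    have h1 : TensorProduct.map s t (TensorProduct.map f g z) ∈ fil K (V ⊗[K] W) m := by
      refine tensor_le (p := (fil K (V ⊗[K] W) m).comap (TensorProduct.map s t)) ?_ hz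
      intro i j hij v hv w hw
      -- The maps s and t preserve F i only for i ≤ m. Cutting both degrees down to m costs nothing,
      -- since min i m + min j m ≥ m whenever i + j ≥ m.
      refine tmul_mem (i := min i m) (j := min j m) (by omega) ?_ ?_
      · exact hs3 _ (min_le_right _ _) _ (fil_anti (min_le_left _ _) hv)
      · exact ht3 _ (min_le_right _ _) _ (fil_anti (min_le_left _ _) hw)
    have h2 : z - TensorProduct.map s t (TensorProduct.map f g z) ∈ fil K (V ⊗[K] W) m := by
      clear hz h1
      induction z with
      | zero => simp
      | add a b ha hb =>
        have := add_mem ha hb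
        rw [map_add, map_add]
        convert this using 1
        abel
      | tmul x y =>
        have h1 := tmul_mem (K := K) (m := m) (i := m) (j := 0) (by simp) (hs2 x) (mem_zero y)
        have h2 := tmul_mem (K := K) (m := m) (i := 0) (j := m) (by simp)
          (mem_zero (s (f x))) (ht2 y)
        have := add_mem h1 h2
        rwa [TensorProduct.sub_tmul, TensorProduct.tmul_sub, sub_add_sub_cancel] at this
    have := add_mem h2 h1
    rwa [sub_add_cancel] at this
  · obtain ⟨s, hs1, -⟩ := hf.exists_inverse m
    obtain ⟨t, ht1, -⟩ := hg.exists_inverse m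
    exact ⟨_, key m s t hs1 ht1 z⟩

end QIso

/-! ### Quotient isomorphisms of algebras and of their `1`-forms -/

section QIsoAlg

variable {K : Type*} [Field K]
variable {R S : Type*} [Ring R] [Algebra K R] [FiltAlg K R] [Ring S] [Algebra K S] [FiltAlg K S]

theorem isQIso_envMap {f : R →ₐ[K] S} (hf : IsQIso f.toLinearMap) :
    IsQIso (envMap f).toLinearMap := by
  have h : (envMap f).toLinearMap = TensorProduct.map f.toLinearMap f.op.toLinearMap := by
    ext; rfl
  rw [h]
  refine hf.tensor ⟨fun m a ha => hf.isFilt m (unop a) ha, fun {m a} ha => ?_, fun m a => ?_⟩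
  · exact hf.reflects (m := m) (v := unop a) ha
  · obtain ⟨v, hv⟩ := hf.dense m (unop a)
    exact ⟨op v, hv⟩

theorem isFilt_envMul : IsFilt (envMul K R) := fun m => by
  refine tensor_le (p := (fil K R m).comap (envMul K R)) fun i j hij v hv w hw => ?_
  exact fil_anti hij (mul_mem hv hw)

/-- Reflection is inherited because the forms carry the subspace filtration. For density, an
approximation x in the enveloping algebra need not have product zero; but f of its product lies in F
m, so the product itself does, and subtracting it from x corrects x within F m. -/
theorem isQIso_omMap {f : R →ₐ[K] S} (hf : IsQIso f.toLinearMap) : IsQIso (omMap f) := by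
  have h := isQIso_envMap hf
  refine ⟨isFilt_omMap hf.isFilt, fun {m t} ht => h.reflects ht, fun m t => ?_⟩
  obtain ⟨x, hx⟩ := h.dense m (omIncl K S t)
  have hx' : envMul K R x ∈ fil K R m := hf.reflects (by
    have := neg_mem (isFilt_envMul m _ hx)
    rw [map_sub, envMul_omIncl, zero_sub, neg_neg, AlgHom.toLinearMap_apply, envMul_envMap] at this
    exact this)
  have h1 : envMul K R x ⊗ₜ[K] (1 : Rᵐᵒᵖ) ∈ fil K (Env K R) m :=
    tmul_mem (i := m) (j := 0) (by simp) hx' (mem_zero _)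
  refine ⟨omMk (x - envMul K R x ⊗ₜ[K] (1 : Rᵐᵒᵖ)) (by simp), ?_⟩
  rw [mem_om, map_sub, omIncl_omMap, omIncl_omMk, map_sub, ← sub_add]
  exact add_mem hx (h.isFilt m _ h1)

namespace Comp

theorem ofAlg_apply (r : R) : (ofAlg r : Comp K R) = of r := rfl

theorem of_mul (a b : R) : (of (a * b) : Comp K R) = of a * of b := rfl

theorem of_one : (of 1 : Comp K R) = 1 := rfl

/-- The extension of a filtered homomorphism with values in a complete algebra. -/
def extendAlg (f : R →ₐ[K] Comp K S) (hf : IsFilt f.toLinearMap) : Comp K R →ₐ[K] Comp K S :=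
  AlgHom.ofLinearMap (extend f.toLinearMap hf)
    (by rw [← of_one, extend_of]; exact map_one f)
    (fun x y => ofEquiv.injective (by
      rw [ofEquiv_apply, ofEquiv_apply, of_mul, of_extend, of_extend, of_extend, map_mul]))

theorem extendAlg_of (f : R →ₐ[K] Comp K S) (hf : IsFilt f.toLinearMap) (r : R) :
    extendAlg f hf (of r) = f r := extend_of _ hf r

theorem isFilt_extendAlg (f : R →ₐ[K] Comp K S) (hf : IsFilt f.toLinearMap) :
    IsFilt (extendAlg f hf).toLinearMap := isFilt_extend _ hf

/-- The homomorphism of completed algebras induced by a filtered homomorphism. -/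
def mapAlg (f : R →ₐ[K] S) (hf : IsFilt f.toLinearMap) : Comp K R →ₐ[K] Comp K S :=
  AlgHom.ofLinearMap (map f.toLinearMap hf)
    (by rw [← of_one, map_of, AlgHom.toLinearMap_apply, _root_.map_one f]; rfl)
    (map_mul hf)

theorem mapAlg_apply (f : R →ₐ[K] S) (hf : IsFilt f.toLinearMap) (x : Comp K R) :
    mapAlg f hf x = map f.toLinearMap hf x := rfl

end Comp

end QIsoAlg

end CompletedConn

end

noncomputable section

open scoped TensorProduct
open MulOpposite

namespace CompletedConn

/-! ### Power series in complete filtered algebras -/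

section Exp

variable {K : Type*} [Field K]
variable {R S : Type*} [Ring R] [Algebra K R] [FiltAlg K R] [Ring S] [Algebra K S] [FiltAlg K S]

theorem pow_mem {x : R} {i : ℕ} (hx : x ∈ fil K R i) (k : ℕ) : x ^ k ∈ fil K R (i * k) := by
  induction k with
  | zero => exact mem_zero _
  | succ k ih => rw [pow_succ, Nat.mul_succ]; exact mul_mem ih hx

theorem pow_mem_one {x : R} (hx : x ∈ fil K R 1) (k : ℕ) : x ^ k ∈ fil K R k := by
  simpa using pow_mem hx k

theorem mul_mem_left (a : R) {b : R} {m : ℕ} (hb : b ∈ fil K R m) : a * b ∈ fil K R m := by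
  simpa using mul_mem (mem_zero a) hb

theorem mul_mem_right {a : R} (b : R) {m : ℕ} (ha : a ∈ fil K R m) : a * b ∈ fil K R m := by
  simpa using mul_mem ha (mem_zero b)

theorem mul_sub_mul_mem {a a' b b' : R} {m : ℕ} (ha : a - a' ∈ fil K R m)
    (hb : b - b' ∈ fil K R m) : a * b - a' * b' ∈ fil K R m := by
  have := add_mem (mul_mem_right b ha) (mul_mem_left a' hb)
  rwa [sub_mul, mul_sub, sub_add_sub_cancel] at this

/-- Telescoping x^(j+2) - y^(j+2) = (x^(j+1) - y^(j+1)) x + y^(j+1) (x - y), valid without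
commutativity; each further factor of degree one gains one degree. -/
theorem pow_sub_pow_mem {x y : R} {k : ℕ} (hx : x ∈ fil K R 1) (hy : y ∈ fil K R 1)
    (h : x - y ∈ fil K R k) (j : ℕ) : x ^ (j + 1) - y ^ (j + 1) ∈ fil K R (k + j) := by
  induction j with
  | zero => simpa using h
  | succ j ih =>
    have h1 := mul_mem ih hx
    have h2 := mul_mem (pow_mem_one hy (j + 1)) h
    rw [show j + 1 + k = k + j + 1 by omega] at h2
    have := add_mem h1 h2
    rwa [sub_mul, mul_sub, ← pow_succ, ← pow_succ, sub_add_sub_cancel] at this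

/-- The working characterisation of the value of a series: its truncation at m is correct modulo F
m. -/
theorem evalSeries_sub_mem (p : PowerSeries K) {x : Comp K R} (hx : x ∈ fil K (Comp K R) 1)
    (m : ℕ) : evalSeries p x - ∑ k ∈ Finset.range m, p.coeff k • x ^ k ∈ fil K (Comp K R) m := by
  rw [evalSeries, dif_pos hx, Comp.mem_fil, map_sub, Comp.proj_mk, sub_self]

/-- Maps that are compatible with the powers of an element are compatible with power series. -/
theorem map_evalSeries (p : PowerSeries K) {f : Comp K R →ₗ[K] Comp K S} (hf : IsFilt f)
    {x : Comp K R} {y : Comp K S} (hx : x ∈ fil K (Comp K R) 1) (h : ∀ k, f (x ^ k) = y ^ k) :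
    f (evalSeries p x) = evalSeries p y := by
  have hy : y ∈ fil K (Comp K S) 1 := by
    have := hf 1 x hx
    rwa [← pow_one x, h, pow_one] at this
  refine Comp.eq_of_sub_mem fun m => ?_
  have h1 := hf m _ (evalSeries_sub_mem p hx m)
  have h2 := evalSeries_sub_mem p hy m
  rw [map_sub, map_sum] at h1
  simp only [map_smul, h] at h1
  have := sub_mem h1 h2
  rwa [sub_sub_sub_cancel_right] at this

theorem map_evalSeries_algHom (p : PowerSeries K) {f : Comp K R →ₐ[K] Comp K S}
    (hf : IsFilt f.toLinearMap) {x : Comp K R} (hx : x ∈ fil K (Comp K R) 1) :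
    f (evalSeries p x) = evalSeries p (f x) :=
  map_evalSeries p (f := f.toLinearMap) hf hx fun k => map_pow f x k

/-- First-order expansion: the terms of order at least two gain a degree, so only the linear
coefficient is visible modulo F (k + 1). This drives both injectivity and surjectivity of the
exponential. -/
theorem evalSeries_sub_evalSeries_mem (p : PowerSeries K) {x y : Comp K R} {k : ℕ}
    (hx : x ∈ fil K (Comp K R) 1) (hy : y ∈ fil K (Comp K R) 1)
    (h : x - y ∈ fil K (Comp K R) k) :
    evalSeries p x - evalSeries p y - p.coeff 1 • (x - y) ∈ fil K (Comp K R) (k + 1) := by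
  -- Truncation at k + 2, one more than precision needs, keeps the linear term in range even for k =
  -- 0.
  have h1 := fil_anti (show k + 1 ≤ k + 2 by omega) (evalSeries_sub_mem p hx (k + 2))
  have h2 := fil_anti (show k + 1 ≤ k + 2 by omega) (evalSeries_sub_mem p hy (k + 2))
  have h3 : ∑ j ∈ Finset.range (k + 2), p.coeff j • x ^ j -
      ∑ j ∈ Finset.range (k + 2), p.coeff j • y ^ j - p.coeff 1 • (x - y) ∈
      fil K (Comp K R) (k + 1) := by
    rw [← Finset.sum_sub_distrib, Finset.sum_range_succ', Finset.sum_range_succ']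
    simp only [← smul_sub, pow_zero, sub_self, add_zero, zero_add, pow_one,
      add_sub_cancel_right]
    refine Submodule.sum_mem _ fun j _ => Submodule.smul_mem _ _ ?_
    exact fil_anti (by omega) (pow_sub_pow_mem hx hy h (j + 1))
  have := add_mem (sub_mem h1 h2) h3
  convert this using 1
  abel

variable [CharZero K]

theorem exp_coeff_one : (PowerSeries.exp K).coeff 1 = 1 := by
  simp [PowerSeries.coeff_exp]

/-- If x - y lies in F m and the exponentials agree, the first-order expansion places x - y in F (m
+ 1); the completion is separated. -/
theorem exp_injOn {x y : Comp K R} (hx : x ∈ fil K (Comp K R) 1) (hy : y ∈ fil K (Comp K R) 1)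
    (h : evalSeries (PowerSeries.exp K) x = evalSeries (PowerSeries.exp K) y) : x = y := by
  refine Comp.eq_of_sub_mem fun m => ?_
  induction m with
  | zero => exact mem_zero _
  | succ m ih =>
    have := neg_mem (evalSeries_sub_evalSeries_mem (PowerSeries.exp K) hx hy ih)
    simpa [h, exp_coeff_one] using this

theorem exp_sub_one_mem {x : Comp K R} (hx : x ∈ fil K (Comp K R) 1) :
    evalSeries (PowerSeries.exp K) x - 1 ∈ fil K (Comp K R) 1 := by
  simpa using evalSeries_sub_mem (PowerSeries.exp K) hx 1

theorem exp_zero : evalSeries (PowerSeries.exp K) (0 : Comp K R) = 1 := by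
  refine Comp.eq_of_sub_mem fun m => ?_
  cases m with
  | zero => exact mem_zero _
  | succ m =>
    have := evalSeries_sub_mem (PowerSeries.exp K) (zero_mem (fil K (Comp K R) 1)) (m + 1)
    rw [Finset.sum_range_succ'] at this
    simpa using this

/-- The exponential maps `F 1` onto `1 + F 1`. -/
theorem exists_exp_eq {u : Comp K R} (hu : u - 1 ∈ fil K (Comp K R) 1) :
    ∃ y ∈ fil K (Comp K R) 1, evalSeries (PowerSeries.exp K) y = u := by
  let e : Comp K R → Comp K R := evalSeries (PowerSeries.exp K)
  -- Newton-type iteration y ↦ y - (e(y) - u). As the linear coefficient of exp is 1, one step moves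
  -- the error from F (k + 1) to F (k + 2).
  let y : ℕ → Comp K R := fun k => Nat.rec 0 (fun _ a => a - (e a - u)) k
  have hsucc : ∀ k, y (k + 1) = y k - (e (y k) - u) := fun _ => rfl
  have hy : ∀ k, y k ∈ fil K (Comp K R) 1 ∧ e (y k) - u ∈ fil K (Comp K R) (k + 1) := by
    intro k
    induction k with
    | zero =>
      refine ⟨zero_mem _, ?_⟩
      have := neg_mem hu
      rw [neg_sub, ← exp_zero] at this
      exact this
    | succ k ih =>
      have h1 : y (k + 1) ∈ fil K (Comp K R) 1 := by
        rw [hsucc]; exact sub_mem ih.1 (fil_anti (by omega) ih.2)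
      refine ⟨h1, ?_⟩
      have h2 : y k - y (k + 1) = e (y k) - u := by rw [hsucc, sub_sub_cancel]
      have h3 := evalSeries_sub_evalSeries_mem (PowerSeries.exp K) ih.1 h1 (h2 ▸ ih.2)
      rw [exp_coeff_one, one_smul, h2] at h3
      have := neg_mem h3
      convert this using 1
      simp only [e]
      abel
  obtain ⟨x, hx⟩ := Comp.exists_lim y fun k => by
    rw [hsucc, sub_sub_cancel_left]
    exact neg_mem (fil_anti k.le_succ (hy k).2)
  have hx1 : x ∈ fil K (Comp K R) 1 := by
    have := add_mem (hx 1) (hy 1).1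
    rwa [sub_add_cancel] at this
  refine ⟨x, hx1, Comp.eq_of_sub_mem fun m => ?_⟩
  have h1 := evalSeries_sub_evalSeries_mem (PowerSeries.exp K) hx1 (hy m).1 (hx m)
  rw [exp_coeff_one, one_smul] at h1
  have := add_mem (add_mem (fil_anti m.le_succ h1) (hx m)) (fil_anti m.le_succ (hy m).2)
  convert this using 1
  simp only [e]
  abel

/-- The product of the truncations is a sum over the square of pairs below m. The pairs with sum
below m give the binomial expansion of the truncated exponential of a + b; the remaining terms lie
in F m. -/
theorem exp_add {a b : Comp K R} (ha : a ∈ fil K (Comp K R) 1) (hb : b ∈ fil K (Comp K R) 1)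
    (hab : Commute a b) : evalSeries (PowerSeries.exp K) (a + b) =
      evalSeries (PowerSeries.exp K) a * evalSeries (PowerSeries.exp K) b := by
  refine Comp.eq_of_sub_mem fun m => ?_
  have h1 := evalSeries_sub_mem (PowerSeries.exp K) (add_mem ha hb) m
  have h2 := mul_sub_mul_mem (evalSeries_sub_mem (PowerSeries.exp K) ha m)
    (evalSeries_sub_mem (PowerSeries.exp K) hb m)
  let f : ℕ × ℕ → Comp K R := fun p =>
    ((p.1.factorial : K)⁻¹ * (p.2.factorial : K)⁻¹) • (a ^ p.1 * b ^ p.2)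
  have hl : ∑ k ∈ Finset.range m, (PowerSeries.exp K).coeff k • (a + b) ^ k =
      ∑ p ∈ (Finset.range m ×ˢ Finset.range m) with p.1 + p.2 < m, f p := by
    rw [← Finset.sum_fiberwise_of_maps_to (t := Finset.range m) (g := fun p : ℕ × ℕ => p.1 + p.2)
      (fun p hp => by simpa using (Finset.mem_filter.1 hp).2)]
    refine Finset.sum_congr rfl fun n hn => ?_
    have hs : ({p ∈ ({p ∈ Finset.range m ×ˢ Finset.range m | p.1 + p.2 < m} : Finset (ℕ × ℕ)) |
        p.1 + p.2 = n}) = Finset.HasAntidiagonal.antidiagonal n := by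
      ext p
      simp only [Finset.mem_filter, Finset.mem_product, Finset.mem_range,
        Finset.HasAntidiagonal.mem_antidiagonal] at hn ⊢
      omega
    rw [hs, hab.add_pow', Finset.smul_sum]
    refine Finset.sum_congr rfl fun p hp => ?_
    have hp : p.1 + p.2 = n := Finset.HasAntidiagonal.mem_antidiagonal.1 hp
    subst hp
    simp only [f, PowerSeries.coeff_exp]
    rw [← Nat.cast_smul_eq_nsmul K, smul_smul, Nat.choose_symm_add, Nat.add_choose]
    congr 1
    rw [Nat.cast_div (Nat.factorial_mul_factorial_dvd_factorial_add _ _)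
      (by exact_mod_cast (mul_ne_zero (Nat.factorial_ne_zero _) (Nat.factorial_ne_zero _)))]
    have := Nat.factorial_ne_zero (p.1 + p.2)
    simp
    field_simp
  have hr : (∑ k ∈ Finset.range m, (PowerSeries.exp K).coeff k • a ^ k) *
      (∑ k ∈ Finset.range m, (PowerSeries.exp K).coeff k • b ^ k) =
      ∑ p ∈ Finset.range m ×ˢ Finset.range m, f p := by
    rw [Finset.sum_mul_sum, ← Finset.sum_product']
    refine Finset.sum_congr rfl fun p _ => ?_
    simp [f, PowerSeries.coeff_exp, smul_smul, mul_comm]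
  have h3 : ∑ p ∈ (Finset.range m ×ˢ Finset.range m) with ¬ p.1 + p.2 < m, f p ∈
      fil K (Comp K R) m := by
    refine Submodule.sum_mem _ fun p hp => Submodule.smul_mem _ _ ?_
    exact fil_anti (not_lt.1 (Finset.mem_filter.1 hp).2)
      (mul_mem (pow_mem_one ha _) (pow_mem_one hb _))
  rw [hr, ← Finset.sum_filter_add_sum_filter_not _ (fun p : ℕ × ℕ => p.1 + p.2 < m), ← hl] at h2
  have := sub_mem h1 (add_mem h2 h3)
  convert this using 1
  abel

theorem exp_mul_exp_neg {a : Comp K R} (ha : a ∈ fil K (Comp K R) 1) :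
    evalSeries (PowerSeries.exp K) a * evalSeries (PowerSeries.exp K) (-a) = 1 := by
  rw [← exp_add ha (neg_mem ha) (Commute.refl a).neg_right, add_neg_cancel, exp_zero]

theorem exp_neg_mul_exp {a : Comp K R} (ha : a ∈ fil K (Comp K R) 1) :
    evalSeries (PowerSeries.exp K) (-a) * evalSeries (PowerSeries.exp K) a = 1 := by
  rw [← exp_add (neg_mem ha) ha (Commute.refl a).neg_left, neg_add_cancel, exp_zero]

theorem expSubOneDiv_mul {a : Comp K R} (ha : a ∈ fil K (Comp K R) 1) :
    evalSeries (expSubOneDiv K) a * a = evalSeries (PowerSeries.exp K) a - 1 := by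
  refine Comp.eq_of_sub_mem fun m => ?_
  have h1 := mul_mem_right a (evalSeries_sub_mem (expSubOneDiv K) ha m)
  -- Multiplying by a shifts exponents by one, so truncation at m on the left matches truncation at
  -- m + 1, minus the constant term, on the right.
  have h2 := fil_anti m.le_succ (evalSeries_sub_mem (PowerSeries.exp K) ha (m + 1))
  rw [Finset.sum_range_succ'] at h2
  rw [sub_mul, Finset.sum_mul] at h1
  have h3 : ∀ k, (expSubOneDiv K).coeff k • a ^ k * a =
      (PowerSeries.exp K).coeff (k + 1) • a ^ (k + 1) := fun k => by
    rw [smul_mul_assoc, ← pow_succ]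
    simp [expSubOneDiv, PowerSeries.coeff_exp]
  simp only [h3] at h1
  have := sub_mem h1 h2
  convert this using 1
  simp [PowerSeries.coeff_exp]
  abel

end Exp

end CompletedConn

end

noncomputable section

open scoped TensorProduct
open MulOpposite

namespace CompletedConn

/-! ### Connections on free modules -/

section FreeConn

variable {K : Type*} [Field K] {R : Type*} [Ring R] [Algebra K R]
variable {M : Type*} [AddCommGroup M] [Module K M] [Module R M]

theorem dOm_mul (a b : R) :
    dOm K R (a * b) = ((1 : R) ⊗ₜ[K] op b) • dOm K R a + (a ⊗ₜ[K] (1 : Rᵐᵒᵖ)) • dOm K R b := by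
  apply omIncl_injective
  rw [map_add, omIncl_smul, omIncl_smul]
  simp [dOm, mul_sub]

theorem dOm_one : dOm K R 1 = 0 := omIncl_injective (by simp [dOm])

theorem btMk_balanced (ω : Om K R) (r : R) (m : M) :
    btMk K R M ((((1 : R) ⊗ₜ[K] op r) • ω) ⊗ₜ[K] m) = btMk K R M (ω ⊗ₜ[K] (r • m)) := by
  rw [← sub_eq_zero, ← map_sub]
  exact (Submodule.Quotient.mk_eq_zero _).2 (Submodule.subset_span ⟨ω, r, m, rfl⟩)

/-- Leibniz rule followed by balancing over R: the right factor s of dr · s moves across the tensor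
sign. Taken coordinate by coordinate, it makes Σ dc_i ⊗ e_i a connection. -/
theorem btMk_dOm_mul (r s : R) (m : M) : btMk K R M (dOm K R (r * s) ⊗ₜ[K] m) =
    btMk K R M (dOm K R r ⊗ₜ[K] (s • m)) + r • btMk K R M (dOm K R s ⊗ₜ[K] m) := by
  rw [dOm_mul, TensorProduct.add_tmul, map_add, btMk_balanced, ← smul_om, ← btMk_smul,
    TensorProduct.smul_tmul']

variable {ι : Type*} [Fintype ι] [DecidableEq ι]

/-- On a free module there is a unique connection that vanishes on a given basis. -/
theorem existsUnique_isConn (e : ι → M) (c : ι → M →ₗ[K] R)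
    (hc : ∀ i (r : R) m, c i (r • m) = r * c i m) (he : ∀ i j, c i (e j) = if i = j then 1 else 0)
    (hs : ∀ m, ∑ i, c i m • e i = m) :
    ∃! D : M →ₗ[K] BT K R M, IsConn D ∧ ∀ i, D (e i) = 0 := by
  -- Forced by the Leibniz rule: if the e_i are killed, Σ c_i e_i must go to Σ dc_i ⊗ e_i.
  let D : M →ₗ[K] BT K R M :=
    ∑ i, btMk K R M ∘ₗ (TensorProduct.mk K (Om K R) M).flip (e i) ∘ₗ dOm K R ∘ₗ c i
  have hD : ∀ m, D m = ∑ i, btMk K R M (dOm K R (c i m) ⊗ₜ[K] e i) := fun m => by simp [D]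
  refine ⟨D, ⟨fun r m => ?_, fun j => ?_⟩, fun D' hD' => LinearMap.ext fun m => ?_⟩
  · conv_rhs => rw [← hs m, TensorProduct.tmul_sum, map_sum, hs m, hD, Finset.smul_sum,
      ← Finset.sum_add_distrib]
    rw [hD]
    exact Finset.sum_congr rfl fun i _ => by rw [hc, btMk_dOm_mul]
  · rw [hD]
    refine Finset.sum_eq_zero fun i _ => ?_
    rw [he]
    split_ifs <;> simp [dOm_one]
  · conv_lhs => rw [← hs m, map_sum]
    rw [hD]
    refine Finset.sum_congr rfl fun i _ => ?_
    rw [hD'.1, hD'.2, smul_zero, add_zero]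

end FreeConn

/-! ### Fox derivatives -/

section Fox

variable (K : Type*) [Field K] {G : Type*} [Group G] {ι : Type*}

/-- The basis lifts to a homomorphism G → S; followed by the inclusion it fixes the generators, so
it is the identity of G. -/
theorem basis_induction (C : FreeGroupBasis ι G) (S : Subgroup G) (h : ∀ i, C i ∈ S) (x : G) :
    x ∈ S := by
  have hf : S.subtype.comp (C.lift fun i => (⟨C i, h i⟩ : S)) = MonoidHom.id G :=
    C.ext_hom _ _ fun i => by simp
  have := congrArg (fun f : G →* G => f x) hf
  simp only [MonoidHom.comp_apply, MonoidHom.id_apply] at this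
  rw [← this]
  exact SetLike.coe_mem _

theorem grpAlg_hom_ext {N : Type*} [AddCommGroup N] [Module K N] {f g : MonoidAlgebra K G →ₗ[K] N}
    (h : ∀ x, f (MonoidAlgebra.of K G x) = g (MonoidAlgebra.of K G x)) : f = g :=
  MonoidAlgebra.lhom_ext' fun x => LinearMap.ext_ring (h x)

/-- The element `x ⊗ x⁻¹` of the enveloping algebra. -/
def adEnv : G →* Env K (MonoidAlgebra K G) where
  toFun x := MonoidAlgebra.of K G x ⊗ₜ[K] op (MonoidAlgebra.of K G x⁻¹)
  map_one' := by rw [inv_one, map_one, op_one, ← Algebra.TensorProduct.one_def]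
  map_mul' x y := by
    rw [Algebra.TensorProduct.tmul_mul_tmul, ← op_mul, ← map_mul, ← map_mul, mul_inv_rev]

theorem adEnv_apply (x : G) :
    adEnv K x = MonoidAlgebra.of K G x ⊗ₜ[K] op (MonoidAlgebra.of K G x⁻¹) := rfl

/-- Shows the logarithmic form to be the coboundary 1 - x ⊗ x⁻¹ of the adjoint action; its crossed
homomorphism rule is then multiplicativity of x ⊗ x⁻¹. -/
theorem dlog_eq (x : G) : omIncl K _ (dlog K x) = 1 - adEnv K x := by
  rw [dlog, omIncl_smul]
  simp only [dOm, LinearMap.coe_mk, AddHom.coe_mk, omIncl_omMk, mul_sub,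
    Algebra.TensorProduct.tmul_mul_tmul, ← op_mul, ← map_mul, mul_inv_cancel, map_one, one_mul,
    mul_one, op_one]
  rfl

theorem dlog_mul (x y : G) : dlog K (x * y) = dlog K x + adEnv K x • dlog K y := by
  apply omIncl_injective
  rw [map_add, omIncl_smul, dlog_eq, dlog_eq, dlog_eq, map_mul, mul_sub, mul_one,
    sub_add_sub_cancel]

variable [DecidableEq ι] (C : FreeGroupBasis ι G)

/-- The action of `G` on the enveloping algebra by left multiplication by `x ⊗ x⁻¹`. -/
def adAut : G →* MulAut (Multiplicative (Env K (MonoidAlgebra K G))) :=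
  (MulAutMultiplicative (G := Env K (MonoidAlgebra K G))).symm.toMonoidHom.comp
    ((DistribMulAction.toAddAut (Env K (MonoidAlgebra K G))ˣ (Env K (MonoidAlgebra K G))).comp
      (adEnv K).toHomUnits)

/-- The homomorphism to the semidirect product whose first component is a crossed homomorphism. -/
def foxHom (i : ι) : G →* Multiplicative (Env K (MonoidAlgebra K G)) ⋊[adAut K] G :=
  C.lift fun k => ⟨Multiplicative.ofAdd (if i = k then 1 else 0), C k⟩

/-- The crossed homomorphism `G → KG ⊗ KGᵒᵖ` with value `1` at `C i` and `0` at the other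
generators. -/
def foxCocycle (i : ι) (x : G) : Env K (MonoidAlgebra K G) :=
  Multiplicative.toAdd (foxHom K C i x).left

/-- A section of a semidirect product over G amounts to a crossed homomorphism, and freeness
provides a section with any prescribed values on generators. -/
theorem foxHom_right (i : ι) (x : G) : (foxHom K C i x).right = x := by
  have h : SemidirectProduct.rightHom.comp (foxHom K C i) = MonoidHom.id G :=
    C.ext_hom _ _ fun k => by simp [foxHom]
  exact congrArg (fun f : G →* G => f x) h

theorem foxCocycle_mul (i : ι) (x y : G) :
    foxCocycle K C i (x * y) = foxCocycle K C i x + adEnv K x * foxCocycle K C i y := by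
  rw [foxCocycle, map_mul, SemidirectProduct.mul_left, foxHom_right]
  rfl

theorem foxCocycle_basis (i k : ι) : foxCocycle K C i (C k) = if i = k then 1 else 0 := by
  simp [foxCocycle, foxHom]

/-- The Fox derivative `KG → KG ⊗ KGᵒᵖ`. -/
def fox (i : ι) : MonoidAlgebra K G →ₗ[K] Env K (MonoidAlgebra K G) :=
  Finsupp.linearCombination K (fun x : G =>
    -- The cocycle is the coefficient of dx x⁻¹; right multiplication by x turns it into that of dx.
    ((1 : MonoidAlgebra K G) ⊗ₜ[K] op (MonoidAlgebra.of K G x)) * foxCocycle K C i x) ∘ₗ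
    (MonoidAlgebra.coeffLinearEquiv K).toLinearMap

theorem fox_of (i : ι) (x : G) : fox K C i (MonoidAlgebra.of K G x) =
    ((1 : MonoidAlgebra K G) ⊗ₜ[K] op (MonoidAlgebra.of K G x)) * foxCocycle K C i x := by
  simp [fox]

/-- By bilinearity it suffices to take group elements x, y. There the twist x ⊗ x⁻¹ of the cocycle
rule meets the right factor x y, leaving x on the left and y on the right. -/
theorem fox_mul (i : ι) (a b : MonoidAlgebra K G) : fox K C i (a * b) =
    ((1 : MonoidAlgebra K G) ⊗ₜ[K] op b) * fox K C i a +
      (a ⊗ₜ[K] (1 : (MonoidAlgebra K G)ᵐᵒᵖ)) * fox K C i b := by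
  let E := Env K (MonoidAlgebra K G)
  let f₁ : MonoidAlgebra K G →ₗ[K] MonoidAlgebra K G →ₗ[K] E :=
    (LinearMap.mul K (MonoidAlgebra K G)).compr₂ (fox K C i)
  let f₂ : MonoidAlgebra K G →ₗ[K] MonoidAlgebra K G →ₗ[K] E :=
    (LinearMap.mul K E).flip.compl₁₂ (fox K C i)
      ((Algebra.TensorProduct.includeRight : _ →ₐ[K] E).toLinearMap ∘ₗ
        (opLinearEquiv K).toLinearMap)
  let f₃ : MonoidAlgebra K G →ₗ[K] MonoidAlgebra K G →ₗ[K] E :=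
    (LinearMap.mul K E).compl₁₂ (Algebra.TensorProduct.includeLeft : _ →ₐ[K] E).toLinearMap
      (fox K C i)
  have h : f₁ = f₂ + f₃ := by
    refine grpAlg_hom_ext K fun x => grpAlg_hom_ext K fun y => ?_
    change fox K C i (MonoidAlgebra.of K G x * MonoidAlgebra.of K G y) =
      ((1 : MonoidAlgebra K G) ⊗ₜ[K] op (MonoidAlgebra.of K G y)) *
        fox K C i (MonoidAlgebra.of K G x) +
      (MonoidAlgebra.of K G x ⊗ₜ[K] (1 : (MonoidAlgebra K G)ᵐᵒᵖ)) *
        fox K C i (MonoidAlgebra.of K G y)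
    rw [← map_mul, fox_of, fox_of, fox_of, foxCocycle_mul, mul_add, ← mul_assoc, ← mul_assoc,
      ← mul_assoc, adEnv_apply]
    simp only [Algebra.TensorProduct.tmul_mul_tmul, ← op_mul, ← map_mul, one_mul, mul_one,
      inv_mul_cancel_left]
  exact LinearMap.congr_fun (LinearMap.congr_fun h a) b

theorem fox_one (i : ι) : fox K C i 1 = 0 := by
  have h := fox_mul K C i 1 1
  rw [op_one, ← Algebra.TensorProduct.one_def] at h
  simpa using h

/-- For a in I and b in I^(m+1), the derivative of a b is ∂a with right factor b, of degree m + 1,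
plus a ∂b, of degree 1 + m. Only one degree is lost, however long the product. -/
theorem fox_mem (i : ι) (m : ℕ) : ∀ a ∈ fil K (MonoidAlgebra K G) (m + 1),
    fox K C i a ∈ fil K (Env K (MonoidAlgebra K G)) m := by
  induction m with
  | zero => exact fun _ _ => mem_zero _
  | succ m ih =>
    intro x hx
    have hx : x ∈ grpAug K G ^ (m + 1 + 1) := hx
    rw [Ideal.IsTwoSided.pow_succ] at hx
    refine Submodule.smul_induction_on hx (fun a ha b hb => ?_) (fun a b ha hb => ?_)
    · have ha : a ∈ fil K (MonoidAlgebra K G) 1 := by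
        change a ∈ grpAug K G ^ 1
        rwa [Submodule.pow_one]
      rw [smul_eq_mul, fox_mul]
      refine add_mem (mul_mem_right _ ?_) ?_
      · exact tmul_mem (i := 0) (j := m + 1) (by simp) (mem_zero _) (op_mem hb)
      · rw [add_comm m 1]
        exact mul_mem (tmul_mem (i := 1) (j := 0) (by simp) ha (mem_zero _)) (ih b hb)
    · rw [map_add]; exact add_mem ha hb

/-- The map `a ⊗ b ↦ a ∂ᵢ b`. -/
def foxEnv (i : ι) : Env K (MonoidAlgebra K G) →ₗ[K] Env K (MonoidAlgebra K G) :=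
  TensorProduct.lift ((LinearMap.mul K (Env K (MonoidAlgebra K G))).compl₁₂
    (Algebra.TensorProduct.includeLeft : _ →ₐ[K] Env K (MonoidAlgebra K G)).toLinearMap
    (fox K C i ∘ₗ (opLinearEquiv K).symm.toLinearMap))

theorem foxEnv_tmul (i : ι) (a : MonoidAlgebra K G) (b : (MonoidAlgebra K G)ᵐᵒᵖ) :
    foxEnv K C i (a ⊗ₜ[K] b) = (a ⊗ₜ[K] 1) * fox K C i (unop b) := rfl

/-- Linearity over the enveloping algebra fails only by a term containing the product of t, hence
holds on `1`-forms. -/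
theorem foxEnv_mul (i : ι) (x : MonoidAlgebra K G) (y : (MonoidAlgebra K G)ᵐᵒᵖ)
    (t : Env K (MonoidAlgebra K G)) : foxEnv K C i ((x ⊗ₜ[K] y) * t) =
      (x ⊗ₜ[K] y) * foxEnv K C i t +
        ((x * envMul K _ t) ⊗ₜ[K] 1) * fox K C i (unop y) := by
  induction t using TensorProduct.induction_on with
  | zero => simp
  | add a b ha hb =>
    rw [mul_add, map_add, map_add, map_add, ha, hb, mul_add, mul_add, TensorProduct.add_tmul,
      add_mul]
    abel
  | tmul a b =>
    rw [Algebra.TensorProduct.tmul_mul_tmul, foxEnv_tmul, foxEnv_tmul, unop_mul, fox_mul, mul_add,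
      ← mul_assoc, ← mul_assoc, ← mul_assoc, envMul_tmul]
    simp [mul_assoc]

/-- The coordinates of `1`-forms with respect to the forms `dcᵢ cᵢ⁻¹`. -/
def foxCoord (i : ι) : Om K (MonoidAlgebra K G) →ₗ[K] Env K (MonoidAlgebra K G) :=
  foxEnv K C i ∘ₗ omIncl K _

theorem foxCoord_smul (i : ι) (r : Env K (MonoidAlgebra K G)) (ω : Om K (MonoidAlgebra K G)) :
    foxCoord K C i (r • ω) = r * foxCoord K C i ω := by
  simp only [foxCoord, LinearMap.comp_apply, omIncl_smul]
  induction r using TensorProduct.induction_on with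
  | zero => simp
  | add a b ha hb => rw [add_mul, map_add, ha, hb, add_mul]
  | tmul x y => rw [foxEnv_mul, envMul_omIncl]; simp

theorem foxCoord_dOm (i : ι) (a : MonoidAlgebra K G) :
    foxCoord K C i (dOm K _ a) = fox K C i a := by
  simp only [foxCoord, dOm, LinearMap.comp_apply, LinearMap.coe_mk, AddHom.coe_mk, omIncl_omMk,
    map_sub, foxEnv_tmul, unop_one, fox_one, mul_zero, sub_zero]
  rw [← Algebra.TensorProduct.one_def, one_mul, unop_op]

theorem foxCoord_dlog (i k : ι) : foxCoord K C i (dlog K (C k)) = if i = k then 1 else 0 := by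
  rw [dlog, foxCoord_smul, foxCoord_dOm, fox_of, ← mul_assoc, foxCocycle_basis,
    Algebra.TensorProduct.tmul_mul_tmul, ← op_mul, ← map_mul, mul_inv_cancel, one_mul, map_one,
    op_one, ← Algebra.TensorProduct.one_def, one_mul]

theorem foxEnv_mem (i : ι) (m : ℕ) : ∀ t ∈ fil K (Env K (MonoidAlgebra K G)) (m + 1),
    foxEnv K C i t ∈ fil K (Env K (MonoidAlgebra K G)) m := by
  refine tensor_le (p := (fil K (Env K (MonoidAlgebra K G)) m).comap (foxEnv K C i)) ?_
  intro p q hpq a ha b hb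
  rw [Submodule.mem_comap, foxEnv_tmul]
  -- In degree q = 0 truncated subtraction records no loss; then p ≥ m + 1 already, so p + (q - 1) ≥
  -- m in all cases.
  have h1 : fox K C i (unop b) ∈ fil K (Env K (MonoidAlgebra K G)) (q - 1) := by
    cases q with
    | zero => exact mem_zero _
    | succ q => exact fox_mem K C i q _ hb
  exact fil_anti (show m ≤ p + (q - 1) by omega)
    (mul_mem (tmul_mem (i := p) (j := 0) (by simp) ha (mem_zero _)) h1)

theorem foxCoord_mem (i : ι) (m : ℕ) : ∀ ω ∈ fil K (Om K (MonoidAlgebra K G)) (m + 1),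
    foxCoord K C i ω ∈ fil K (Env K (MonoidAlgebra K G)) m := fun ω hω =>
  foxEnv_mem K C i m (omIncl K _ ω) hω

variable [Fintype ι]

/-- Both sides are crossed homomorphisms into the `1`-forms, so they agree on a subgroup, and that
subgroup contains the generators. -/
theorem sum_foxCocycle (x : G) : ∑ i, foxCocycle K C i x • dlog K (C i) = dlog K x := by
  have h1 : ∀ x y, ∑ i, foxCocycle K C i (x * y) • dlog K (C i) =
      ∑ i, foxCocycle K C i x • dlog K (C i) +
        adEnv K x • ∑ i, foxCocycle K C i y • dlog K (C i) := fun x y => by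
    simp only [foxCocycle_mul, add_smul, Finset.sum_add_distrib, mul_smul, Finset.smul_sum]
  have h2 : ∀ (f : G → Om K (MonoidAlgebra K G)),
      (∀ x y, f (x * y) = f x + adEnv K x • f y) → f 1 = 0 := fun f hf => by
    have := hf 1 1
    rwa [mul_one, map_one, one_smul, left_eq_add] at this
  have h3 : ∑ i, foxCocycle K C i 1 • dlog K (C i) = 0 :=
    h2 (fun x => ∑ i, foxCocycle K C i x • dlog K (C i)) h1
  have h4 : dlog K (1 : G) = 0 := h2 _ (dlog_mul K)
  let S : Subgroup G :=
    { carrier := {x | ∑ i, foxCocycle K C i x • dlog K (C i) = dlog K x}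
      mul_mem' := fun {x y} hx hy => by
        simp only [Set.mem_ofPred_eq] at *
        rw [h1, hx, hy, dlog_mul]
      one_mem' := by
        simp only [Set.mem_ofPred_eq]
        rw [h3, h4]
      inv_mem' := fun {x} hx => by
        simp only [Set.mem_ofPred_eq] at *
        have e1 := h1 x⁻¹ x
        have e2 := dlog_mul K x⁻¹ x
        rw [inv_mul_cancel, h3, hx] at e1
        rw [inv_mul_cancel, h4] at e2
        exact add_right_cancel (e1.symm.trans e2) }
  refine basis_induction C S (fun k => ?_) x
  change ∑ i, foxCocycle K C i (C k) • dlog K (C i) = dlog K (C k)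
  rw [Finset.sum_eq_single k]
  · rw [foxCocycle_basis, if_pos rfl, one_smul]
  · intro i _ hi
    rw [foxCocycle_basis, if_neg hi]
    exact zero_smul (Env K (MonoidAlgebra K G)) (dlog K (C i))
  · exact fun h => absurd (Finset.mem_univ k) h

theorem sum_fox (a : MonoidAlgebra K G) : ∑ i, fox K C i a • dlog K (C i) = dOm K _ a := by
  let f : MonoidAlgebra K G →ₗ[K] Om K (MonoidAlgebra K G) :=
    ∑ i, (Algebra.lsmul K K (Om K (MonoidAlgebra K G))).toLinearMap.flip (dlog K (C i)) ∘ₗ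
      fox K C i
  have hf : ∀ a, f a = ∑ i, fox K C i a • dlog K (C i) := fun a => by simp [f]
  rw [← hf]
  refine LinearMap.congr_fun (grpAlg_hom_ext K fun x => ?_) a
  rw [hf]
  simp only [fox_of, mul_smul]
  rw [← Finset.smul_sum, sum_foxCocycle, dlog, ← mul_smul, Algebra.TensorProduct.tmul_mul_tmul,
    ← op_mul, ← map_mul, inv_mul_cancel, one_mul, map_one, op_one, ← Algebra.TensorProduct.one_def,
    one_smul]

/-- Since a ⊗ b = a db + a b ⊗ 1, the Fox expansion of db recovers a tensor up to its product. -/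
theorem sum_foxEnv (t : Env K (MonoidAlgebra K G)) :
    omIncl K _ (∑ i, foxEnv K C i t • dlog K (C i)) = t - envMul K _ t ⊗ₜ[K] 1 := by
  induction t using TensorProduct.induction_on with
  | zero =>
    rw [map_zero, TensorProduct.zero_tmul, sub_zero, Finset.sum_eq_zero fun i _ => ?_, map_zero]
    rw [map_zero]
    exact zero_smul (Env K (MonoidAlgebra K G)) (dlog K (C i))
  | add a b ha hb =>
    simp only [map_add, add_smul, Finset.sum_add_distrib, ha, hb, TensorProduct.add_tmul]
    abel
  | tmul a b =>
    simp only [foxEnv_tmul, mul_smul]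
    rw [← Finset.smul_sum, sum_fox, omIncl_smul]
    simp [dOm, mul_sub]

theorem sum_foxCoord (ω : Om K (MonoidAlgebra K G)) :
    ∑ i, foxCoord K C i ω • dlog K (C i) = ω := by
  apply omIncl_injective
  have := sum_foxEnv K C (omIncl K _ ω)
  rwa [envMul_omIncl, TensorProduct.zero_tmul, sub_zero] at this

theorem existsUnique_isNablaC : ∃! D : Om K (MonoidAlgebra K G) →ₗ[K]
    BT K (Env K (MonoidAlgebra K G)) (Om K (MonoidAlgebra K G)), IsNablaC C D := by
  obtain ⟨D, hD, hu⟩ := existsUnique_isConn (fun i => dlog K (C i)) (foxCoord K C)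
    (foxCoord_smul K C) (foxCoord_dlog K C) (sum_foxCoord K C)
  exact ⟨D, ⟨hD.1, hD.2⟩, fun D' h => hu D' ⟨h.conn, h.vanish⟩⟩

end Fox

end CompletedConn

end

noncomputable section

open scoped TensorProduct
open MulOpposite

namespace CompletedConn

open Coalgebra Bialgebra HopfAlgebra

attribute [local instance 100] LieRing.ofAssociativeRing

/-! ### Primitive elements of the enveloping algebra of a free Lie algebra -/

section LCS

variable {K : Type*} [Field K] {L : Type*} [LieRing L] [LieAlgebra K L]

theorem lcs_succ_le {k : ℕ} {P : Submodule K L}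
    (h : ∀ a : L, ∀ b ∈ LieModule.lowerCentralSeries K L L k, ⁅a, b⁆ ∈ P) :
    (LieModule.lowerCentralSeries K L L (k + 1)).toSubmodule ≤ P := by
  rw [LieModule.lowerCentralSeries_succ, LieSubmodule.lieIdeal_oper_eq_linear_span]
  refine Submodule.span_le.2 ?_
  rintro _ ⟨a, b, rfl⟩
  exact h a b b.2

theorem lie_mem_lcs_succ (a : L) {b : L} {k : ℕ}
    (hb : b ∈ LieModule.lowerCentralSeries K L L k) :
    ⁅a, b⁆ ∈ LieModule.lowerCentralSeries K L L (k + 1) := by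
  rw [LieModule.lowerCentralSeries_succ]
  exact LieSubmodule.lie_mem_lie (LieSubmodule.mem_top a) hb

/-- Lower central series indices start at 0, so degree is index plus one, whence the extra 1.
Induction on i uses [[p, q], b] = [p, [q, b]] - [q, [p, b]], with j left free. -/
theorem lie_mem_lcs_add {i : ℕ} : ∀ {j : ℕ} {a b : L}, a ∈ LieModule.lowerCentralSeries K L L i →
    b ∈ LieModule.lowerCentralSeries K L L j →
    ⁅a, b⁆ ∈ LieModule.lowerCentralSeries K L L (i + j + 1) := by
  induction i with
  | zero =>
    intro j a b _ hb
    rw [zero_add]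
    exact lie_mem_lcs_succ a hb
  | succ i ih =>
    intro j a b ha hb
    let f : L →ₗ[K] L := (LieModule.toEnd K L L : L →ₗ[K] Module.End K L).flip b
    have hf : ∀ x, f x = ⁅x, b⁆ := fun _ => rfl
    refine lcs_succ_le (P := Submodule.comap f
      (LieModule.lowerCentralSeries K L L (i + 1 + j + 1)).toSubmodule) (fun p q hq => ?_) ha
    rw [Submodule.mem_comap, hf, lie_lie]
    refine sub_mem ?_ ?_
    · rw [show i + 1 + j + 1 = i + j + 1 + 1 by omega]
      exact lie_mem_lcs_succ p (ih hq hb)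
    · rw [show i + 1 + j + 1 = i + (j + 1) + 1 by omega]
      exact ih hq (lie_mem_lcs_succ p hb)

end LCS

/-! ### The Dynkin map and the degree derivation -/

section FreeLie

variable {K : Type*} [Field K] {X : Type*}

theorem freeLie_induction (S : LieSubalgebra K (FreeLieAlgebra K X))
    (h : ∀ i, FreeLieAlgebra.of K i ∈ S) (x : FreeLieAlgebra K X) : x ∈ S := by
  have hf : S.incl.comp (FreeLieAlgebra.lift K fun i => (⟨FreeLieAlgebra.of K i, h i⟩ : S)) =
      LieHom.id := FreeLieAlgebra.hom_ext fun i => by simp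
  have := congrArg (fun f : FreeLieAlgebra K X →ₗ⁅K⁆ FreeLieAlgebra K X => f x) hf
  simp only [LieHom.comp_apply, LieHom.id_apply] at this
  rw [← this]
  exact SetLike.coe_mem _

/-- Step m is the lower central series at m - 1 in truncated subtraction, so steps 0 and 1 are both
the whole algebra. -/
theorem freeLie_fil_one (x : FreeLieAlgebra K X) : x ∈ fil K (FreeLieAlgebra K X) 1 := by
  change x ∈ LieModule.lowerCentralSeries K (FreeLieAlgebra K X) (FreeLieAlgebra K X) 0
  simp

theorem freeLie_lie_mem {i j : ℕ} {a b : FreeLieAlgebra K X} (ha : a ∈ fil K (FreeLieAlgebra K X) i)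
    (hb : b ∈ fil K (FreeLieAlgebra K X) j) : ⁅a, b⁆ ∈ fil K (FreeLieAlgebra K X) (i + j) :=
  LieModule.antitone_lowerCentralSeries K _ _ (by omega) (lie_mem_lcs_add ha hb)

variable (K X)

/-- The action `x (y, c) = ([x, y] + c D x, 0)` of the free Lie algebra, where `D` is the
derivation that multiplies an element by its degree. -/
def dynkinRep : FreeLieAlgebra K X →ₗ⁅K⁆ Module.End K (FreeLieAlgebra K X × K) :=
  FreeLieAlgebra.lift K fun i =>
    LinearMap.inl K _ K ∘ₗ
      (((LieModule.toEnd K (FreeLieAlgebra K X) (FreeLieAlgebra K X) (FreeLieAlgebra.of K i)) ∘ₗ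
        LinearMap.fst K _ K) + (LinearMap.snd K _ K).smulRight (FreeLieAlgebra.of K i))

/-- The derivation of the free Lie algebra that multiplies an element by its degree. -/
def degDer : FreeLieAlgebra K X →ₗ[K] FreeLieAlgebra K X :=
  LinearMap.fst K _ K ∘ₗ LinearMap.applyₗ ((0, 1) : FreeLieAlgebra K X × K) ∘ₗ
    (dynkinRep K X : FreeLieAlgebra K X →ₗ[K] Module.End K (FreeLieAlgebra K X × K))

variable {K X}

theorem degDer_apply (x : FreeLieAlgebra K X) : degDer K X x = (dynkinRep K X x (0, 1)).1 := rfl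

theorem dynkinRep_of (i : X) (p : FreeLieAlgebra K X × K) :
    dynkinRep K X (FreeLieAlgebra.of K i) p =
      (⁅FreeLieAlgebra.of K i, p.1⁆ + p.2 • FreeLieAlgebra.of K i, 0) := by
  simp [dynkinRep]

theorem degDer_of (i : X) : degDer K X (FreeLieAlgebra.of K i) = FreeLieAlgebra.of K i := by
  simp [degDer_apply, dynkinRep_of]

/-- The elements that act by this formula form a Lie subalgebra containing the generators. Since the
action respects brackets, the formula makes D a derivation, obtained without a grading of the free
Lie algebra. -/
theorem dynkinRep_apply (x : FreeLieAlgebra K X) (p : FreeLieAlgebra K X × K) :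
    dynkinRep K X x p = (⁅x, p.1⁆ + p.2 • degDer K X x, 0) := by
  let S : LieSubalgebra K (FreeLieAlgebra K X) :=
    { carrier := {x | ∀ p, dynkinRep K X x p = (⁅x, p.1⁆ + p.2 • degDer K X x, 0)}
      add_mem' := fun {a b} ha hb p => by
        rw [map_add, LinearMap.add_apply, ha, hb, map_add]
        ext <;> simp; abel
      zero_mem' := fun p => by simp; rfl
      smul_mem' := fun c a ha p => by
        rw [map_smul, LinearMap.smul_apply, ha, map_smul]
        ext <;> simp [smul_comm c p.2]
      lie_mem' := fun {a b} ha hb p => by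
        -- Applied to (0, 1), this also computes D[a, b] = [a, D b] - [b, D a], which the closing
        -- identity requires.
        have h : ∀ p, dynkinRep K X ⁅a, b⁆ p =
            (⁅a, ⁅b, p.1⁆ + p.2 • degDer K X b⁆ - ⁅b, ⁅a, p.1⁆ + p.2 • degDer K X a⁆, 0) := by
          intro p
          rw [LieHom.map_lie, LieRing.of_associative_ring_bracket, LinearMap.sub_apply,
            Module.End.mul_apply, Module.End.mul_apply, ha p, hb p, ha, hb]
          ext <;> simp
        rw [degDer_apply, h, h]
        ext
        · simp only [lie_add, lie_smul, lie_zero, zero_add, one_smul, smul_sub, lie_lie]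
          abel
        · rfl }
  refine freeLie_induction S (fun i p => ?_) x p
  rw [dynkinRep_of, degDer_of]

theorem degDer_lie (a b : FreeLieAlgebra K X) :
    degDer K X ⁅a, b⁆ = ⁅a, degDer K X b⁆ - ⁅b, degDer K X a⁆ := by
  rw [degDer_apply, LieHom.map_lie, LieRing.of_associative_ring_bracket, LinearMap.sub_apply,
    Module.End.mul_apply, Module.End.mul_apply]
  simp [dynkinRep_apply]

/-- D acts on F m / F (m + 1) as multiplication by m. It is the identity modulo brackets; and for
[a, b] the derivation rule adds the degree of b to the 1 coming from a. -/
theorem degDer_sub_mem (m : ℕ) : ∀ x ∈ fil K (FreeLieAlgebra K X) m,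
    degDer K X x - (m : K) • x ∈ fil K (FreeLieAlgebra K X) (m + 1) := by
  -- In degree 0 there is nothing to show, since F 1 is everything.
  rcases m with _ | m
  · exact fun x _ => freeLie_fil_one _
  change ∀ x ∈ LieModule.lowerCentralSeries K (FreeLieAlgebra K X) (FreeLieAlgebra K X) m,
    degDer K X x - ((m + 1 : ℕ) : K) • x ∈
      LieModule.lowerCentralSeries K (FreeLieAlgebra K X) (FreeLieAlgebra K X) (m + 1)
  have h1 : ∀ x, degDer K X x - x ∈
      LieModule.lowerCentralSeries K (FreeLieAlgebra K X) (FreeLieAlgebra K X) 1 := by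
    have hb : ∀ a b : FreeLieAlgebra K X, ⁅a, b⁆ ∈
        LieModule.lowerCentralSeries K (FreeLieAlgebra K X) (FreeLieAlgebra K X) 1 :=
      fun a b => lie_mem_lcs_succ a (by simp)
    let S : LieSubalgebra K (FreeLieAlgebra K X) :=
      { Submodule.comap (degDer K X - LinearMap.id) (LieModule.lowerCentralSeries K
          (FreeLieAlgebra K X) (FreeLieAlgebra K X) 1).toSubmodule with
        lie_mem' := fun {a b} _ _ => by
          change degDer K X ⁅a, b⁆ - ⁅a, b⁆ ∈
            LieModule.lowerCentralSeries K (FreeLieAlgebra K X) (FreeLieAlgebra K X) 1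
          rw [degDer_lie]
          exact sub_mem (sub_mem (hb _ _) (hb _ _)) (hb _ _) }
    refine freeLie_induction S fun i => ?_
    change degDer K X (FreeLieAlgebra.of K i) - FreeLieAlgebra.of K i ∈
      LieModule.lowerCentralSeries K (FreeLieAlgebra K X) (FreeLieAlgebra K X) 1
    rw [degDer_of, sub_self]
    exact zero_mem _
  induction m with
  | zero => intro x _; simpa using h1 x
  | succ m ih =>
    intro x hx
    refine lcs_succ_le (P := Submodule.comap (degDer K X - ((m + 1 + 1 : ℕ) : K) • LinearMap.id)
      (LieModule.lowerCentralSeries K (FreeLieAlgebra K X) (FreeLieAlgebra K X)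
        (m + 1 + 1)).toSubmodule) (fun a b hb => ?_) hx
    have e1 := lie_mem_lcs_succ a (ih b hb)
    have e2 := lie_mem_lcs_add hb (h1 a)
    have e3 := sub_mem e1 e2
    simp only [Submodule.mem_comap, LinearMap.sub_apply, LinearMap.smul_apply, LinearMap.id_apply,
      degDer_lie, LieSubmodule.mem_toSubmodule]
    convert e3 using 1
    rw [lie_sub, lie_sub, lie_smul, ← lie_skew b a]
    push_cast
    module

theorem degDer_mem {m : ℕ} {x : FreeLieAlgebra K X} (hx : x ∈ fil K (FreeLieAlgebra K X) m) :
    degDer K X x ∈ fil K (FreeLieAlgebra K X) m := by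
  have := add_mem (fil_anti m.le_succ (degDer_sub_mem m x hx)) (Submodule.smul_mem _ (m : K) hx)
  rwa [sub_add_cancel] at this

variable (K X)

/-- The action of the enveloping algebra that extends `dynkinRep`. -/
def dynkinAct : UEA K (FreeLieAlgebra K X) →ₐ[K] Module.End K (FreeLieAlgebra K X × K) :=
  ueaLift (dynkinRep K X : FreeLieAlgebra K X →ₗ[K] Module.End K (FreeLieAlgebra K X × K))
    fun x y => by
      rw [LieHom.coe_toLinearMap, LieHom.map_lie, LieRing.of_associative_ring_bracket]

/-- The Dynkin map `x₁ ⋯ xₖ ↦ [x₁, [x₂, ⋯, D xₖ]]`. -/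
def dynkin : UEA K (FreeLieAlgebra K X) →ₗ[K] FreeLieAlgebra K X :=
  LinearMap.fst K _ K ∘ₗ LinearMap.applyₗ ((0, 1) : FreeLieAlgebra K X × K) ∘ₗ
    (dynkinAct K X).toLinearMap

variable {K X}

theorem dynkinAct_ι_mul (x : FreeLieAlgebra K X) (v : UEA K (FreeLieAlgebra K X)) :
    dynkinAct K X (ueaι K _ x * v) (0, 1) =
      (⁅x, dynkin K X v⁆ + (dynkinAct K X v (0, 1)).2 • degDer K X x, 0) := by
  rw [map_mul, Module.End.mul_apply, dynkinAct, ueaLift_ι, LieHom.coe_toLinearMap, dynkinRep_apply]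
  rfl

/-- Lie elements act with zero scalar component, so on (0, 1) only the constant term of u
contributes to it. -/
theorem dynkinAct_snd (u : UEA K (FreeLieAlgebra K X)) :
    (dynkinAct K X u (0, 1)).2 = ueaCounit K _ u := by
  let P : Submodule K (UEA K (FreeLieAlgebra K X)) := LinearMap.ker
    (LinearMap.snd K _ K ∘ₗ LinearMap.applyₗ ((0, 1) : FreeLieAlgebra K X × K) ∘ₗ
      (dynkinAct K X).toLinearMap - (ueaCounit K _).toLinearMap)
  have h := uea_submodule_eq_top P ?_ ?_ u
  · simpa [P, sub_eq_zero] using h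
  · simp [P]
  · intro x v _
    simp [P, dynkinAct_ι_mul, ueaCounit_ι, -map_mul, map_mul (ueaCounit K (FreeLieAlgebra K X))]

/-- The recursion behind the nested bracket: D x appears only if the remaining factor has a constant
term, that is, at the innermost position. -/
theorem dynkin_ι_mul (x : FreeLieAlgebra K X) (v : UEA K (FreeLieAlgebra K X)) :
    dynkin K X (ueaι K _ x * v) = ⁅x, dynkin K X v⁆ + ueaCounit K _ v • degDer K X x := by
  rw [← dynkinAct_snd]
  exact congrArg Prod.fst (dynkinAct_ι_mul x v)

theorem dynkin_one : dynkin K X 1 = 0 := by simp [dynkin]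

theorem dynkin_ι (x : FreeLieAlgebra K X) : dynkin K X (ueaι K _ x) = degDer K X x := by
  have := dynkin_ι_mul x 1
  simpa [dynkin_one] using this

theorem ueaCounit_mem {L : Type*} [LieRing L] [LieAlgebra K L] [Filt K L] {u : UEA K L}
    (hu : u ∈ fil K (UEA K L) 1) : ueaCounit K L u = 0 := by
  induction hu using Submodule.span_induction with
  | mem u hu =>
    obtain ⟨l, -, h2, rfl⟩ := hu
    cases l with
    | nil => simp at h2
    | cons p l => simp [ueaCounit_ι]
  | zero => simp
  | add a b _ _ ha hb => rw [map_add, ha, hb, add_zero]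
  | smul c a _ ha => rw [map_smul, ha, smul_zero]

theorem dynkin_mem : IsFilt (dynkin K X) := by
  intro m u hu
  induction hu using Submodule.span_induction with
  | mem u hu =>
    obtain ⟨l, h1, h2, rfl⟩ := hu
    refine fil_anti h2 ?_
    clear h2
    induction l with
    | nil => exact mem_zero _
    | cons p l ih =>
      simp only [List.map_cons, List.prod_cons, List.sum_cons, dynkin_ι_mul]
      refine add_mem (freeLie_lie_mem (h1 p (by simp)) (ih fun q hq => h1 q (by simp [hq]))) ?_
      -- An empty tail contributes D of the last factor; a nonempty tail is killed by the counit.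
      cases l with
      | nil => simpa using degDer_mem (h1 p (by simp))
      | cons q l => simp [ueaCounit_ι]
  | zero => simp
  | add a b _ _ ha hb => rw [map_add]; exact Submodule.add_mem _ ha hb
  | smul c a _ ha => rw [map_smul]; exact Submodule.smul_mem _ c ha

variable (K X)

/-- The map `u ⊗ v ↦ r(u) v`, where `r` is the Dynkin map. -/
def dynkinMul : UEA K (FreeLieAlgebra K X) ⊗[K] UEA K (FreeLieAlgebra K X) →ₗ[K]
    UEA K (FreeLieAlgebra K X) :=
  LinearMap.mul' K _ ∘ₗ TensorProduct.map (ueaι K _ ∘ₗ dynkin K X) LinearMap.id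

/-- The derivation of the enveloping algebra that multiplies an element by its degree. -/
def ueaDeg : UEA K (FreeLieAlgebra K X) →ₗ[K] UEA K (FreeLieAlgebra K X) :=
  dynkinMul K X ∘ₗ (ueaComul K _).toLinearMap

variable {K X}

theorem dynkinMul_tmul (u v : UEA K (FreeLieAlgebra K X)) :
    dynkinMul K X (u ⊗ₜ v) = ueaι K _ (dynkin K X u) * v := rfl

theorem isFilt_dynkinMul : IsFilt (dynkinMul K X) := fun m => by
  refine tensor_le (p := (fil K _ m).comap (dynkinMul K X)) fun i j hij u hu v hv => ?_
  rw [Submodule.mem_comap, dynkinMul_tmul]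
  exact fil_anti hij (mul_mem (ueaι_mem (dynkin_mem i u hu)) hv)

theorem ueaDeg_one : ueaDeg K X 1 = 0 := by
  simp [ueaDeg, Algebra.TensorProduct.one_def, dynkinMul_tmul, dynkin_one]

/-- The Dynkin–Specht–Wever mechanism. For a tensor p ⊗ q, multiplication by Δ(x) gives [x, r(p)] q
+ ε(p) D(x) q + r(p) x q, and the commutator combines with the last term to x r(p) q. So the
convolution r ⋆ id is a derivation extending D. -/
theorem ueaDeg_ι_mul (x : FreeLieAlgebra K X) (v : UEA K (FreeLieAlgebra K X)) :
    ueaDeg K X (ueaι K _ x * v) = ueaι K _ (degDer K X x) * v + ueaι K _ x * ueaDeg K X v := by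
  have h : ∀ t : UEA K (FreeLieAlgebra K X) ⊗[K] UEA K (FreeLieAlgebra K X),
      dynkinMul K X ((ueaι K _ x ⊗ₜ[K] 1 + 1 ⊗ₜ[K] ueaι K _ x) * t) =
        ueaι K _ (degDer K X x) * TensorProduct.lid K _
          ((ueaCounit K (FreeLieAlgebra K X)).toLinearMap.rTensor _ t) +
        ueaι K _ x * dynkinMul K X t := by
    intro t
    induction t with
    | zero => simp
    | add a b ha hb =>
      rw [mul_add, map_add, ha, hb]
      simp only [map_add, mul_add]
      abel
    | tmul p q =>
      simp only [add_mul, Algebra.TensorProduct.tmul_mul_tmul, one_mul, map_add, dynkinMul_tmul,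
        dynkin_ι_mul, map_smul, ueaι_lie, LinearMap.rTensor_tmul, AlgHom.toLinearMap_apply,
        TensorProduct.lid_tmul, sub_mul, smul_mul_assoc, mul_smul_comm, mul_assoc]
      abel
  have h2 : TensorProduct.lid K _ ((ueaCounit K (FreeLieAlgebra K X)).toLinearMap.rTensor _
      (ueaComul K _ v)) = v := by
    have := rTensor_counit_comul (R := K) v
    exact (congrArg _ this).trans (by simp)
  simp only [ueaDeg, LinearMap.comp_apply, AlgHom.toLinearMap_apply, map_mul, ueaComul_ι]
  rw [h, h2]

theorem ueaDeg_sub_mem (m : ℕ) : ∀ u ∈ fil K (UEA K (FreeLieAlgebra K X)) m,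
    ueaDeg K X u - (m : K) • u ∈ fil K (UEA K (FreeLieAlgebra K X)) (m + 1) := by
  intro u hu
  induction hu using Submodule.span_induction with
  | mem u hu =>
    obtain ⟨l, h1, h2, rfl⟩ := hu
    have key : (l.map fun p => ueaι K _ p.2).prod ∈
          fil K (UEA K (FreeLieAlgebra K X)) (l.map Prod.fst).sum ∧
        ueaDeg K X (l.map fun p => ueaι K _ p.2).prod -
        (((l.map Prod.fst).sum : ℕ) : K) • (l.map fun p => ueaι K _ p.2).prod ∈
        fil K (UEA K (FreeLieAlgebra K X)) ((l.map Prod.fst).sum + 1) := by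
      clear h2
      induction l with
      | nil => exact ⟨mem_zero _, by simp [ueaDeg_one]⟩
      | cons p l ih =>
        have hp := h1 p (by simp)
        obtain ⟨i1, i2⟩ := ih fun q hq => h1 q (by simp [hq])
        simp only [List.map_cons, List.prod_cons, List.sum_cons]
        refine ⟨mul_mem (ueaι_mem hp) i1, ?_⟩
        have e1 := mul_mem (ueaι_mem (degDer_sub_mem p.1 p.2 hp)) i1
        have e2 := mul_mem (ueaι_mem hp) i2
        rw [show p.1 + 1 + (l.map Prod.fst).sum = p.1 + (l.map Prod.fst).sum + 1 by omega] at e1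
        have := add_mem e1 e2
        convert this using 1
        rw [ueaDeg_ι_mul]
        simp only [map_sub, map_smul, sub_mul, mul_sub, smul_mul_assoc, mul_smul_comm]
        push_cast
        module
    -- A spanning product may have total degree above m; then both the product and its image already
    -- lie in F (m + 1).
    rcases h2.eq_or_lt with h2 | h2
    · rw [h2]; exact key.2
    · have e1 := fil_anti (show m + 1 ≤ _ from h2) key.1
      have e2 := fil_anti (show m + 1 ≤ _ by omega) key.2
      have e3 := add_mem e2 (Submodule.smul_mem _ (((l.map Prod.fst).sum : ℕ) : K) e1)
      rw [sub_add_cancel] at e3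
      exact sub_mem e3 (Submodule.smul_mem _ _ e1)
  | zero => simp
  | add a b _ _ ha hb =>
    have := add_mem ha hb
    rw [map_add]
    convert this using 1
    module
  | smul c a _ ha =>
    have := Submodule.smul_mem _ c ha
    rw [map_smul]
    convert this using 1
    module

theorem uea_sub_counit_mem {L : Type*} [LieRing L] [LieAlgebra K L] [Filt K L]
    (hL : ∀ x, x ∈ fil K L 1) (u : UEA K L) :
    u - algebraMap K _ (ueaCounit K L u) ∈ fil K (UEA K L) 1 := by
  let P : Submodule K (UEA K L) := (fil K (UEA K L) 1).comap
    (LinearMap.id - Algebra.linearMap K _ ∘ₗ (ueaCounit K L).toLinearMap)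
  refine uea_submodule_eq_top P ?_ (fun x v _ => ?_) u
  · simp [P]
  · simpa [P, ueaCounit_ι] using mul_mem_right v (ueaι_mem (hL x))

variable [CharZero K]

/-- An element of the free Lie algebra of degree at least `m` in the enveloping algebra is of
degree at least `m`. -/
theorem mem_fil_of_ueaι_mem {m : ℕ} {x : FreeLieAlgebra K X}
    (hx : ueaι K _ x ∈ fil K (UEA K (FreeLieAlgebra K X)) m) :
    x ∈ fil K (FreeLieAlgebra K X) m := by
  -- The Dynkin map restricts to D on Lie elements and is filtered. Since D is multiplication by j
  -- on F j / F (j + 1), dividing by j climbs one degree at a time.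
  have hD : degDer K X x ∈ fil K (FreeLieAlgebra K X) m := by
    rw [← dynkin_ι]; exact dynkin_mem m _ hx
  suffices h : ∀ j ≤ m, x ∈ fil K (FreeLieAlgebra K X) j from h m le_rfl
  intro j
  induction j with
  | zero => exact fun _ => mem_zero _
  | succ j ih =>
    intro hj
    rcases j with _ | j
    · exact freeLie_fil_one x
    have h1 := sub_mem (fil_anti hj hD) (degDer_sub_mem (j + 1) x (ih (by omega)))
    rw [sub_sub_cancel] at h1
    have h2 := Submodule.smul_mem _ ((j + 1 : ℕ) : K)⁻¹ h1
    rwa [smul_smul, inv_mul_cancel₀ (Nat.cast_ne_zero.2 j.succ_ne_zero), one_smul] at h2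

/-- Elements that are primitive modulo `F m` are Lie elements modulo `F m`. -/
theorem exists_sub_ueaι_mem {m : ℕ} {u : UEA K (FreeLieAlgebra K X)}
    (hu : ueaComul K _ u - u ⊗ₜ[K] 1 - 1 ⊗ₜ[K] u ∈
      fil K (UEA K (FreeLieAlgebra K X) ⊗[K] UEA K (FreeLieAlgebra K X)) m) :
    ∃ x, u - ueaι K _ x ∈ fil K (UEA K (FreeLieAlgebra K X)) m := by
  suffices h : ∀ j ≤ m, ∃ x, u - ueaι K _ x ∈ fil K (UEA K (FreeLieAlgebra K X)) j from h m le_rfl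
  intro j
  induction j with
  | zero => exact fun _ => ⟨0, mem_zero _⟩
  | succ j ih =>
    intro hj
    rcases j with _ | j
    -- In degree 0 there is no division: ε ⊗ ε of the primitivity defect is ε(u) - 2 ε(u), so ε(u) =
    -- 0 and u is in F 1.
    · refine ⟨0, ?_⟩
      rw [map_zero, sub_zero]
      let f := (TensorProduct.lid K K).toLinearMap ∘ₗ TensorProduct.map
        (ueaCounit K (FreeLieAlgebra K X)).toLinearMap (ueaCounit K (FreeLieAlgebra K X)).toLinearMap
      have hf : ∀ t ∈ fil K (UEA K (FreeLieAlgebra K X) ⊗[K] UEA K (FreeLieAlgebra K X)) 1,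
          f t = 0 := by
        refine tensor_le (p := LinearMap.ker f) fun a b hab v hv w hw => ?_
        rw [LinearMap.mem_ker]
        simp only [f, LinearMap.comp_apply, TensorProduct.map_tmul, AlgHom.toLinearMap_apply,
          LinearEquiv.coe_coe, TensorProduct.lid_tmul]
        rcases Nat.eq_zero_or_pos a with h | h
        · rw [ueaCounit_mem (fil_anti (by omega) hw), smul_zero]
        · rw [ueaCounit_mem (fil_anti (by omega) hv), zero_smul]
      have h1 := hf _ (fil_anti (by omega) hu)
      have h2 : f (ueaComul K _ u) = ueaCounit K _ u := by
        have h3 : (Algebra.TensorProduct.lmul' K).comp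
            ((Algebra.TensorProduct.map (ueaCounit K (FreeLieAlgebra K X))
              (ueaCounit K (FreeLieAlgebra K X))).comp (ueaComul K _)) = ueaCounit K _ :=
          uea_hom_ext fun x => by simp [ueaComul_ι, ueaCounit_ι]
        exact congrArg (fun g : UEA K (FreeLieAlgebra K X) →ₐ[K] K => g u) h3
      have h4 : ueaCounit K _ u = 0 := by
        rw [map_sub, map_sub, h2] at h1
        simpa [f] using h1
      have := uea_sub_counit_mem freeLie_fil_one u
      rwa [h4, map_zero, sub_zero] at this
    · obtain ⟨x, hx⟩ := ih (by omega)
      set v := u - ueaι K _ x with hv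
      have hv' : ueaComul K _ v - v ⊗ₜ[K] 1 - 1 ⊗ₜ[K] v ∈
          fil K (UEA K (FreeLieAlgebra K X) ⊗[K] UEA K (FreeLieAlgebra K X)) m := by
        convert hu using 1
        rw [hv, map_sub, ueaComul_ι, TensorProduct.sub_tmul, TensorProduct.tmul_sub]
        abel
      -- The convolution map u ⊗ v ↦ r(u) v kills 1 ⊗ v and sends v ⊗ 1 to r(v). So the degree
      -- derivation of v is r(v) modulo F m, while it is (j + 1) v modulo F (j + 2).
      have h1 := isFilt_dynkinMul m _ hv'
      rw [map_sub, map_sub, dynkinMul_tmul, dynkinMul_tmul, dynkin_one, map_zero, zero_mul,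
        sub_zero, mul_one] at h1
      have h2 := sub_mem (fil_anti hj h1) (ueaDeg_sub_mem (j + 1) v hx)
      have h3 : ((j + 1 : ℕ) : K) • v - ueaι K _ (dynkin K X v) ∈
          fil K (UEA K (FreeLieAlgebra K X)) (j + 1 + 1) := by
        convert h2 using 1
        change _ = ueaDeg K X v - _ - _
        abel
      refine ⟨x + ((j + 1 : ℕ) : K)⁻¹ • dynkin K X v, ?_⟩
      have h4 := Submodule.smul_mem _ ((j + 1 : ℕ) : K)⁻¹ h3
      rw [smul_sub, smul_smul, inv_mul_cancel₀ (Nat.cast_ne_zero.2 j.succ_ne_zero), one_smul,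
        hv] at h4
      rwa [map_add, map_smul, ← sub_sub]

end FreeLie

end CompletedConn

end

noncomputable section

open scoped TensorProduct
open MulOpposite

namespace CompletedConn

open Coalgebra Bialgebra HopfAlgebra

attribute [local instance 100] LieRing.ofAssociativeRing

/-! ### The Malcev Lie algebra of a free group -/

section Group

variable {K : Type*} [Field K] {G : Type*} [Group G]

theorem grp_of_sub_one_mem (x : G) :
    MonoidAlgebra.of K G x - 1 ∈ fil K (MonoidAlgebra K G) 1 := by
  change _ ∈ grpAug K G ^ 1
  rw [Submodule.pow_one, mem_grpAug]
  simp

/-- If group elements go to 1 + F 1, then f - ε takes values in F 1; so I goes to F 1 and, by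
multiplicativity, I^m to F m. -/
theorem grp_isFilt {S : Type*} [Ring S] [Algebra K S] [FiltAlg K S] (f : MonoidAlgebra K G →ₐ[K] S)
    (h : ∀ x : G, f (MonoidAlgebra.of K G x) - 1 ∈ fil K S 1) : IsFilt f.toLinearMap := by
  have key : ∀ a : MonoidAlgebra K G,
      f a - algebraMap K S (counit (R := K) a) ∈ fil K S 1 := by
    intro a
    induction a using MonoidAlgebra.induction_linear with
    | zero => simp
    | add a b ha hb =>
      have := add_mem ha hb
      rw [map_add, map_add, map_add]
      convert this using 1
      abel
    | single g c =>
      have := Submodule.smul_mem _ c (h g)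
      have hs : MonoidAlgebra.single g c = c • MonoidAlgebra.of K G g := by simp
      rw [hs, map_smul, map_smul]
      convert this using 1
      simp [smul_sub, Algebra.algebraMap_eq_smul_one]
  refine grp_le K G f.toLinearMap fun x hx m y hy => ?_
  have hx' := key x
  rw [(mem_grpAug K G x).1 hx, map_zero, sub_zero] at hx'
  rw [AlgHom.toLinearMap_apply, map_mul, add_comm]
  exact mul_mem hx' hy

end Group

/-! ### Completed tensor squares and primitive elements -/

section Hat

variable (K : Type*) [Field K] (H : Type*) [Ring H] [HopfAlgebra K H] [FiltHopf K H]

/-- The map `Ĥ ⊗ Ĥ → Ĥ ⊗̂ Ĥ`. -/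
def tensorCompHom : Comp K H ⊗[K] Comp K H →ₐ[K] Comp K (H ⊗[K] H) :=
  Algebra.TensorProduct.lift (Comp.mapAlg _ (isFilt_includeLeft K H))
    (Comp.mapAlg _ (isFilt_includeRight K H)) (inl_mul_inr K H)

variable {K H}

theorem tensorCompHom_tmul (x y : Comp K H) :
    tensorCompHom K H (x ⊗ₜ y) = inlHat K H x * inrHat K H y := rfl

/-- Composed with H ⊗ H → Ĥ ⊗ Ĥ this is the canonical map of H ⊗ H to its completion, so
cancellation applies. It allows primitivity defects to be tested in the completed tensor square. -/
theorem isQIso_tensorCompHom : IsQIso (tensorCompHom K H).toLinearMap := by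
  have h1 : IsFilt (tensorCompHom K H).toLinearMap := fun m => by
    refine tensor_le (p := (fil K (Comp K (H ⊗[K] H)) m).comap (tensorCompHom K H).toLinearMap)
      fun i j hij v hv w hw => ?_
    have h1 : inlHat K H v ∈ fil K (Comp K (H ⊗[K] H)) i := Comp.isFilt_map _ i v hv
    have h2 : inrHat K H w ∈ fil K (Comp K (H ⊗[K] H)) j := Comp.isFilt_map _ j w hw
    rw [Submodule.mem_comap, AlgHom.toLinearMap_apply, tensorCompHom_tmul]
    exact fil_anti hij (mul_mem h1 h2)
  have h2 : IsQIso (TensorProduct.map (Comp.of : H →ₗ[K] Comp K H) (Comp.of : H →ₗ[K] Comp K H)) :=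
    Comp.isQIso_of.tensor Comp.isQIso_of
  refine IsQIso.of_comp_right h1 h2.isFilt h2.dense ?_
  have : (tensorCompHom K H).toLinearMap ∘ₗ TensorProduct.map Comp.of Comp.of = Comp.of :=
    TensorProduct.ext' fun a b => by
      simp only [LinearMap.comp_apply, TensorProduct.map_tmul, AlgHom.toLinearMap_apply,
        tensorCompHom_tmul, inlHat, inrHat, Comp.map_of, ← Comp.of_mul]
      simp
  rw [this]
  exact Comp.isQIso_of

theorem comulHat_prim (p : Prim K H) : comulHat K H (primIncl K H p) =
    inlHat K H (primIncl K H p) + inrHat K H (primIncl K H p) := p.2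

theorem primIncl_injective : Function.Injective (primIncl K H) := Subtype.val_injective

theorem mem_fil_prim {m : ℕ} {p : Prim K H} :
    p ∈ fil K (Prim K H) m ↔ primIncl K H p ∈ fil K (Comp K H) m := Iff.rfl

theorem prim_lie_mem {i j : ℕ} {p q : Prim K H} (hp : p ∈ fil K (Prim K H) i)
    (hq : q ∈ fil K (Prim K H) j) : ⁅p, q⁆ ∈ fil K (Prim K H) (i + j) := by
  have h1 := mul_mem (mem_fil_prim.1 hp) (mem_fil_prim.1 hq)
  have h2 := mul_mem (mem_fil_prim.1 hq) (mem_fil_prim.1 hp)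
  rw [add_comm j i] at h2
  exact sub_mem h1 h2

theorem prim_lie_sub_mem {m : ℕ} {p q p' q' : Prim K H} (hp : p - p' ∈ fil K (Prim K H) m)
    (hq : q - q' ∈ fil K (Prim K H) m) : ⁅p, q⁆ - ⁅p', q'⁆ ∈ fil K (Prim K H) m := by
  have h1 := prim_lie_mem hp (mem_zero q)
  have h2 := prim_lie_mem (mem_zero p') hq
  rw [zero_add] at h2
  have := add_mem h1 h2
  rwa [sub_lie, lie_sub, sub_add_sub_cancel] at this

/-- Logarithms of group-like elements are primitive. -/
theorem comulHat_eq_of_exp_eq [CharZero K] {x : H} (hx : comul (R := K) x = x ⊗ₜ[K] x)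
    {z : Comp K H} (hz : z ∈ fil K (Comp K H) 1)
    (h : evalSeries (PowerSeries.exp K) z = Comp.of x) :
    comulHat K H z = inlHat K H z + inrHat K H z := by
  have hc : IsFilt (comulHat K H) := Comp.isFilt_map FiltHopf.comul_mem
  have hl : IsFilt (inlHat K H) := Comp.isFilt_map (isFilt_includeLeft K H)
  have hr : IsFilt (inrHat K H) := Comp.isFilt_map (isFilt_includeRight K H)
  -- Both candidates lie in F 1 and have exponential x ⊗ x: z ⊗ 1 and 1 ⊗ z commute, and x is
  -- group-like.
  refine exp_injOn (hc 1 _ hz) (add_mem (hl 1 _ hz) (hr 1 _ hz)) ?_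
  rw [exp_add (hl 1 _ hz) (hr 1 _ hz) (inl_mul_inr K H z z),
    ← map_evalSeries _ (y := comulHat K H z) hc hz
      (map_pow (Comp.mapAlg (comulAlgHom K H) FiltHopf.comul_mem) z),
    ← map_evalSeries _ (y := inlHat K H z) hl hz
      (map_pow (Comp.mapAlg _ (isFilt_includeLeft K H)) z),
    ← map_evalSeries _ (y := inrHat K H z) hr hz
      (map_pow (Comp.mapAlg _ (isFilt_includeRight K H)) z), h]
  have e : comulHat K H (Comp.of x) = Comp.of (comul x) := Comp.map_of _ x
  rw [e, inlHat, inrHat, Comp.map_of, Comp.map_of, ← Comp.of_mul, AlgHom.toLinearMap_apply,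
    AlgHom.toLinearMap_apply, Algebra.TensorProduct.includeLeft_apply,
    Algebra.TensorProduct.includeRight_apply, hx, Algebra.TensorProduct.tmul_mul_tmul, one_mul, mul_one]

variable (K H) in
/-- The primitive part of a complete Hopf algebra is complete. -/
def primOfEquiv : Prim K H ≃ₗ[K] Comp K (Prim K H) :=
  LinearEquiv.ofBijective Comp.of (by
    have hF : IsFilt (primIncl K H : Prim K H →ₗ[K] Comp K H) := fun m p hp => hp
    constructor
    · rw [injective_iff_map_eq_zero]
      intro p hp
      refine primIncl_injective (Comp.eq_zero_of_mem fun m => ?_)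
      rw [← mem_fil_prim, ← Comp.of_mem_fil, hp]
      exact zero_mem _
    · intro y
      let w := Comp.ofEquiv.symm (Comp.map _ hF y)
      have hw : Comp.of w = Comp.map _ hF y := Comp.ofEquiv.apply_symm_apply _
      have key : ∀ m (p : Prim K H), y - Comp.of p ∈ fil K _ m →
          w - primIncl K H p ∈ fil K (Comp K H) m := fun m p hp => by
        have := Comp.isFilt_map hF m _ hp
        rwa [map_sub, Comp.map_of, ← hw, ← map_sub, Comp.of_mem_fil] at this
      -- The primitivity condition is closed: w is primitive modulo each F m because a primitive
      -- element approximates it there.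
      have hprim : comulHat K H w = inlHat K H w + inrHat K H w := by
        refine Comp.eq_of_sub_mem fun m => ?_
        obtain ⟨p, hp⟩ := Comp.exists_sub_mem m y
        have h := key m p hp
        have h1 := Comp.isFilt_map (FiltHopf.comul_mem (K := K) (H := H)) m _ h
        have h2 := Comp.isFilt_map (isFilt_includeLeft K H) m _ h
        have h3 := Comp.isFilt_map (isFilt_includeRight K H) m _ h
        have h4 := sub_mem h1 (add_mem h2 h3)
        have e : comulHat K H (w - primIncl K H p) - (inlHat K H (w - primIncl K H p) +
            inrHat K H (w - primIncl K H p)) = comulHat K H w - (inlHat K H w + inrHat K H w) := by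
          rw [map_sub, map_sub, map_sub, comulHat_prim]
          abel
        rw [← e]
        exact h4
      obtain ⟨q, hq⟩ : ∃ q : Prim K H, primIncl K H q = w := ⟨(⟨w, hprim⟩ : prim K H), rfl⟩
      refine ⟨q, Comp.eq_of_sub_mem fun m => ?_⟩
      obtain ⟨p, hp⟩ := Comp.exists_sub_mem m y
      have h := key m p hp
      have h1 : (Comp.of q : Comp K (Prim K H)) - Comp.of p ∈ fil K _ m := by
        rw [← map_sub, Comp.of_mem_fil, mem_fil_prim, map_sub, hq]
        exact h
      have := sub_mem h1 hp
      rwa [sub_sub_sub_cancel_right] at this)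

end Hat

/-! ### Functoriality and density for enveloping algebras -/

section UeaMap

variable {K : Type*} [Field K] {L L₂ : Type*} [LieRing L] [LieAlgebra K L] [LieRing L₂]
  [LieAlgebra K L₂]

/-- Functoriality of the enveloping algebra of a Lie algebra. -/
def ueaMap (f : L →ₗ⁅K⁆ L₂) : UEA K L →ₐ[K] UEA K L₂ :=
  ueaLift (ueaι K L₂ ∘ₗ (f : L →ₗ[K] L₂)) fun x y => by
    simp [ueaι_lie]

theorem ueaMap_ι (f : L →ₗ⁅K⁆ L₂) (x : L) : ueaMap f (ueaι K L x) = ueaι K L₂ (f x) := by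
  simp [ueaMap]

/-- The subalgebra of elements that lie in the image of `f` modulo `F m`. -/
def approxSubalgebra {R S : Type*} [Ring R] [Algebra K R] [Ring S] [Algebra K S] [FiltAlg K S]
    (f : R →ₐ[K] S) (m : ℕ) : Subalgebra K S where
  carrier := {w | ∃ u, w - f u ∈ fil K S m}
  mul_mem' := by
    rintro a b ⟨u, hu⟩ ⟨v, hv⟩
    exact ⟨u * v, by rw [map_mul]; exact mul_sub_mul_mem hu hv⟩
  add_mem' := by
    rintro a b ⟨u, hu⟩ ⟨v, hv⟩
    exact ⟨u + v, by rw [map_add, add_sub_add_comm]; exact add_mem hu hv⟩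
  algebraMap_mem' c := ⟨algebraMap K R c, by simp⟩

variable [Filt K L₂]

/-- The elements approximable modulo F m form a subalgebra, so only Lie elements have to be
approximated. -/
theorem ueaMap_dense {f : L →ₗ⁅K⁆ L₂} (hf : ∀ m w, ∃ v, w - f v ∈ fil K L₂ m) (m : ℕ)
    (w : UEA K L₂) : ∃ u, w - ueaMap f u ∈ fil K (UEA K L₂) m :=
  uea_subalgebra_eq_top (approxSubalgebra (ueaMap f) m) (fun x => by
    obtain ⟨v, hv⟩ := hf m x
    exact ⟨ueaι K L v, by rw [ueaMap_ι, ← map_sub]; exact ueaι_mem hv⟩) w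

variable [Filt K L]

theorem isFilt_ueaMap {f : L →ₗ⁅K⁆ L₂} (hf : IsFilt (f : L →ₗ[K] L₂)) :
    IsFilt (ueaMap f).toLinearMap :=
  uea_isFilt _ fun m x hx => by
    rw [ueaMap_ι]
    exact ueaι_mem (hf m x hx)

end UeaMap

/-! ### Exponentials and logarithms between the free group and the free Lie algebra -/

section Malcev

theorem ueaι_freeLie_mem (K : Type*) [Field K] {ι : Type*} (x : FreeLieAlgebra K ι) :
    Comp.of (ueaι K _ x) ∈ fil K (Comp K (UEA K (FreeLieAlgebra K ι))) 1 :=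
  Comp.of_mem_fil.2 (ueaι_mem (freeLie_fil_one x))

variable (K : Type*) [Field K] [CharZero K] {G : Type*} [Group G] {ι : Type*}

theorem exists_log (x : G) : ∃ y ∈ fil K (Comp K (MonoidAlgebra K G)) 1,
    evalSeries (PowerSeries.exp K) y = Comp.ofAlg (MonoidAlgebra.of K G x) := by
  refine exists_exp_eq ?_
  have := Comp.isFilt_of 1 _ (grp_of_sub_one_mem (K := K) x)
  rwa [map_sub] at this

variable (G) in
/-- The logarithm of a group element. -/
def grpLog (x : G) : Comp K (MonoidAlgebra K G) := (exists_log K x).choose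

theorem grpLog_mem (x : G) : grpLog K G x ∈ fil K (Comp K (MonoidAlgebra K G)) 1 :=
  (exists_log K x).choose_spec.1

theorem exp_grpLog (x : G) : evalSeries (PowerSeries.exp K) (grpLog K G x) =
    Comp.ofAlg (MonoidAlgebra.of K G x) := by
  rw [grpLog]
  exact (exists_log K x).choose_spec.2

theorem exp_neg_grpLog (x : G) : evalSeries (PowerSeries.exp K) (-grpLog K G x) =
    Comp.ofAlg (MonoidAlgebra.of K G x⁻¹) := by
  have h1 := exp_neg_mul_exp (grpLog_mem K x)
  rw [exp_grpLog] at h1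
  refine left_inv_eq_right_inv h1 ?_
  rw [← map_mul, ← map_mul, mul_inv_cancel, map_one, map_one]

theorem grpLog_primitive (x : G) : comulHat K (MonoidAlgebra K G) (grpLog K G x) =
    inlHat K (MonoidAlgebra K G) (grpLog K G x) + inrHat K (MonoidAlgebra K G) (grpLog K G x) :=
  comulHat_eq_of_exp_eq (H := MonoidAlgebra K G) (x := MonoidAlgebra.of K G x) (by simp)
    (grpLog_mem K x) (exp_grpLog K x)

/-- The logarithm of a group element as a primitive element. -/
def primLog (x : G) : Prim K (MonoidAlgebra K G) :=
  (⟨grpLog K G x, grpLog_primitive K x⟩ : prim K (MonoidAlgebra K G))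

theorem primIncl_primLog (x : G) : primIncl K _ (primLog K x) = grpLog K G x := rfl

theorem primLog_mem (x : G) : primLog K x ∈ fil K (Prim K (MonoidAlgebra K G)) 1 := grpLog_mem K x

variable (C : FreeGroupBasis ι G)

/-- The homomorphism from the free Lie algebra that takes the generators to the logarithms of the
generators of the group. -/
def malcevLie : FreeLieAlgebra K ι →ₗ⁅K⁆ Prim K (MonoidAlgebra K G) :=
  FreeLieAlgebra.lift K fun i => primLog K (C i)

theorem malcevLie_of (i : ι) : malcevLie K C (FreeLieAlgebra.of K i) = primLog K (C i) := by
  simp [malcevLie]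

/-- Logarithms of generators have degree one and the bracket adds degrees, so each step of the lower
central series gains one. -/
theorem isFilt_malcevLie : IsFilt
    (malcevLie K C : FreeLieAlgebra K ι →ₗ[K] Prim K (MonoidAlgebra K G)) := by
  intro m
  rcases m with _ | m
  · exact fun _ _ => mem_zero _
  have h1 : ∀ x, malcevLie K C x ∈ fil K (Prim K (MonoidAlgebra K G)) 1 := by
    let S : LieSubalgebra K (FreeLieAlgebra K ι) :=
      { Submodule.comap (malcevLie K C : FreeLieAlgebra K ι →ₗ[K] Prim K (MonoidAlgebra K G))
          (fil K (Prim K (MonoidAlgebra K G)) 1) with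
        lie_mem' := fun {a b} ha hb => by
          change malcevLie K C ⁅a, b⁆ ∈ fil K (Prim K (MonoidAlgebra K G)) 1
          rw [LieHom.map_lie]
          exact prim_lie_mem (i := 1) (j := 0) ha (mem_zero _) }
    refine freeLie_induction S fun i => ?_
    change malcevLie K C (FreeLieAlgebra.of K i) ∈ fil K (Prim K (MonoidAlgebra K G)) 1
    rw [malcevLie_of]
    exact primLog_mem K _
  change ∀ x ∈ LieModule.lowerCentralSeries K (FreeLieAlgebra K ι) (FreeLieAlgebra K ι) m,
    malcevLie K C x ∈ fil K (Prim K (MonoidAlgebra K G)) (m + 1)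
  induction m with
  | zero => exact fun x _ => h1 x
  | succ m ih =>
    intro x hx
    refine lcs_succ_le (P := Submodule.comap
      (malcevLie K C : FreeLieAlgebra K ι →ₗ[K] Prim K (MonoidAlgebra K G))
      (fil K (Prim K (MonoidAlgebra K G)) (m + 1 + 1))) (fun a b hb => ?_) hx
    change malcevLie K C ⁅a, b⁆ ∈ fil K (Prim K (MonoidAlgebra K G)) (m + 1 + 1)
    rw [LieHom.map_lie, add_comm (m + 1) 1]
    exact prim_lie_mem (h1 a) (ih b hb)

/-- The homomorphism `U(L) → Â` for the free Lie algebra `L`. -/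
def malcevHom : UEA K (FreeLieAlgebra K ι) →ₐ[K] Comp K (MonoidAlgebra K G) :=
  (primHom K (MonoidAlgebra K G)).comp (ueaMap (malcevLie K C))

theorem malcevHom_ι (x : FreeLieAlgebra K ι) :
    malcevHom K C (ueaι K _ x) = primIncl K _ (malcevLie K C x) := by
  rw [malcevHom, AlgHom.comp_apply, ueaMap_ι, primHom, ueaLift_ι]
  rfl

theorem isFilt_malcevHom : IsFilt (malcevHom K C).toLinearMap :=
  (isFilt_primHom K (MonoidAlgebra K G)).comp (isFilt_ueaMap (isFilt_malcevLie K C))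

/-- The exponential of a free generator as a unit. -/
def expUnit (i : ι) : (Comp K (UEA K (FreeLieAlgebra K ι)))ˣ where
  val := evalSeries (PowerSeries.exp K) (Comp.of (ueaι K _ (FreeLieAlgebra.of K i)))
  inv := evalSeries (PowerSeries.exp K) (-Comp.of (ueaι K _ (FreeLieAlgebra.of K i)))
  val_inv := exp_mul_exp_neg (ueaι_freeLie_mem K _)
  inv_val := exp_neg_mul_exp (ueaι_freeLie_mem K _)

/-- The homomorphism `A → Û(L)` that takes the generators of the group to exponentials. -/
def magnusHom : MonoidAlgebra K G →ₐ[K] Comp K (UEA K (FreeLieAlgebra K ι)) :=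
  MonoidAlgebra.lift K _ G ((Units.coeHom _).comp (C.lift (expUnit K)))

theorem magnusHom_of (x : G) : magnusHom K C (MonoidAlgebra.of K G x) = C.lift (expUnit K) x := by
  simp [magnusHom]

theorem magnusHom_basis (i : ι) : magnusHom K C (MonoidAlgebra.of K G (C i)) =
    evalSeries (PowerSeries.exp K) (Comp.of (ueaι K _ (FreeLieAlgebra.of K i))) := by
  rw [magnusHom_of, show C.lift (expUnit K) (C i) = expUnit K i by simp]
  rfl

theorem isFilt_magnusHom : IsFilt (magnusHom K C).toLinearMap := by
  refine grp_isFilt _ fun x => ?_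
  rw [magnusHom_of]
  let S : Subgroup G :=
    { carrier := {x | (C.lift (expUnit K) x : Comp K (UEA K (FreeLieAlgebra K ι))) - 1 ∈ fil K _ 1}
      mul_mem' := fun {a b} ha hb => by
        rw [Set.mem_ofPred_eq] at *
        have := mul_sub_mul_mem ha hb
        simpa using this
      one_mem' := by simp
      inv_mem' := fun {a} ha => by
        rw [Set.mem_ofPred_eq] at *
        have := neg_mem (mul_mem_left
          ((C.lift (expUnit K) a)⁻¹ : (Comp K (UEA K (FreeLieAlgebra K ι)))ˣ).val ha)
        simpa [mul_sub] using this }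
  refine basis_induction C S (fun i => ?_) x
  change (C.lift (expUnit K) (C i) : Comp K (UEA K (FreeLieAlgebra K ι))) - 1 ∈ fil K _ 1
  rw [← magnusHom_of, magnusHom_basis]
  exact exp_sub_one_mem (ueaι_freeLie_mem K _)

/-- The extension of `magnusHom` to the completed group algebra. -/
def magnusHat : Comp K (MonoidAlgebra K G) →ₐ[K] Comp K (UEA K (FreeLieAlgebra K ι)) :=
  Comp.extendAlg (magnusHom K C) (isFilt_magnusHom K C)

theorem isFilt_magnusHat : IsFilt (magnusHat K C).toLinearMap := Comp.isFilt_extendAlg _ _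

/-- Both sides lie in F 1 and have the same exponential, where exp is injective. -/
theorem magnusHat_log (i : ι) : magnusHat K C (grpLog K G (C i)) =
    Comp.of (ueaι K _ (FreeLieAlgebra.of K i)) := by
  have hz := grpLog_mem K (C i)
  refine exp_injOn (isFilt_magnusHat K C 1 _ hz) (ueaι_freeLie_mem K _) ?_
  rw [← AlgHom.toLinearMap_apply, AlgHom.toLinearMap_apply,
    ← map_evalSeries_algHom _ (isFilt_magnusHat K C) hz, exp_grpLog, Comp.ofAlg_apply, magnusHat,
    Comp.extendAlg_of, magnusHom_basis]

/-- Two homomorphisms from U(L) that agree on free generators. The resulting left inverse makes U(L)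
→ Â injective modulo every F m. -/
theorem magnusHat_malcevHom (u : UEA K (FreeLieAlgebra K ι)) :
    magnusHat K C (malcevHom K C u) = Comp.of u := by
  have h : (magnusHat K C).comp (malcevHom K C) = Comp.ofAlg := by
    refine uea_hom_ext fun x => ?_
    let f₁ : FreeLieAlgebra K ι →ₗ⁅K⁆ Comp K (UEA K (FreeLieAlgebra K ι)) :=
      (magnusHat K C).toLieHom.comp ((primIncl K _).comp (malcevLie K C))
    let f₂ : FreeLieAlgebra K ι →ₗ⁅K⁆ Comp K (UEA K (FreeLieAlgebra K ι)) :=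
      (Comp.ofAlg : _ →ₐ[K] Comp K (UEA K (FreeLieAlgebra K ι))).toLieHom.comp
        (UniversalEnvelopingAlgebra.ι K)
    have hf : f₁ = f₂ := FreeLieAlgebra.hom_ext fun i => by
      change magnusHat K C (primIncl K _ (malcevLie K C (FreeLieAlgebra.of K i))) =
        Comp.of (ueaι K _ (FreeLieAlgebra.of K i))
      rw [malcevLie_of, primIncl_primLog, magnusHat_log]
    have := congrArg (fun f : FreeLieAlgebra K ι →ₗ⁅K⁆ Comp K (UEA K (FreeLieAlgebra K ι)) => f x) hf
    rw [AlgHom.comp_apply, malcevHom_ι]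
    exact this
  exact congrArg (fun f : UEA K (FreeLieAlgebra K ι) →ₐ[K] _ => f u) h

/-- The filtered left inverse gives reflection. For density, truncating the exponential series
approximates generators and their inverses by polynomials in the logarithms; these generate the
group algebra, which is dense. -/
theorem isQIso_malcevHom : IsQIso (malcevHom K C).toLinearMap := by
  refine ⟨isFilt_malcevHom K C, fun {m u} hu => ?_, fun m w => ?_⟩
  · have := isFilt_magnusHat K C m _ hu
    rw [AlgHom.toLinearMap_apply, AlgHom.toLinearMap_apply, magnusHat_malcevHom] at this
    exact Comp.of_mem_fil.1 this
  · have hexp : ∀ z : UEA K (FreeLieAlgebra K ι),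
        malcevHom K C z ∈ fil K (Comp K (MonoidAlgebra K G)) 1 →
        evalSeries (PowerSeries.exp K) (malcevHom K C z) ∈
          approxSubalgebra (malcevHom K C) m := fun z hz =>
      ⟨∑ k ∈ Finset.range m, (PowerSeries.exp K).coeff k • z ^ k, by
        simpa using evalSeries_sub_mem (PowerSeries.exp K) hz m⟩
    have hlog : ∀ i, malcevHom K C (ueaι K _ (FreeLieAlgebra.of K i)) = grpLog K G (C i) := fun i => by
      rw [malcevHom_ι, malcevLie_of, primIncl_primLog]
    -- Inverses are carried along because a subalgebra need not contain them; those of generators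
    -- come from exp(-log).
    let S : Subgroup G :=
      { carrier := {x | Comp.ofAlg (MonoidAlgebra.of K G x) ∈ approxSubalgebra (malcevHom K C) m ∧
          Comp.ofAlg (MonoidAlgebra.of K G x⁻¹) ∈ approxSubalgebra (malcevHom K C) m}
        mul_mem' := fun {a b} ha hb => by
          simp only [Set.mem_ofPred_eq, mul_inv_rev, map_mul]
          exact ⟨Subalgebra.mul_mem _ ha.1 hb.1, Subalgebra.mul_mem _ hb.2 ha.2⟩
        one_mem' := by
          simp only [Set.mem_ofPred_eq, inv_one, map_one]
          exact ⟨Subalgebra.one_mem _, Subalgebra.one_mem _⟩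
        inv_mem' := fun {a} ha => by
          simp only [Set.mem_ofPred_eq, inv_inv]
          exact ⟨ha.2, ha.1⟩ }
    have hS : ∀ x : G, x ∈ S := basis_induction C S fun i => by
      refine ⟨?_, ?_⟩
      · rw [← exp_grpLog, ← hlog]
        exact hexp _ (by rw [hlog]; exact grpLog_mem K _)
      · rw [← exp_neg_grpLog, ← hlog, ← map_neg]
        exact hexp _ (by rw [map_neg, hlog]; exact neg_mem (grpLog_mem K _))
    have hA : ∀ a, Comp.ofAlg a ∈ approxSubalgebra (malcevHom K C) m := fun a => by
      induction a using MonoidAlgebra.induction_linear with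
      | zero => rw [map_zero]; exact Subalgebra.zero_mem _
      | add a b ha hb => rw [map_add]; exact Subalgebra.add_mem _ ha hb
      | single g c =>
        have hs : MonoidAlgebra.single g c = c • MonoidAlgebra.of K G g := by simp
        rw [hs, map_smul]
        exact Subalgebra.smul_mem _ (hS g).1 c
    obtain ⟨a, ha⟩ := Comp.exists_sub_mem m w
    obtain ⟨u, hu⟩ := hA a
    refine ⟨u, ?_⟩
    have := add_mem ha hu
    rwa [Comp.ofAlg_apply, sub_add_sub_cancel] at this

/-- Compatibility with coproducts: both sides are algebra homomorphisms in u, and they agree on L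
because its elements go to primitives. -/
theorem comulHat_malcevHom (u : UEA K (FreeLieAlgebra K ι)) :
    comulHat K _ (malcevHom K C u) = tensorCompHom K _
      (TensorProduct.map (malcevHom K C).toLinearMap (malcevHom K C).toLinearMap
        (ueaComul K _ u)) := by
  have h : (Comp.mapAlg (comulAlgHom K (MonoidAlgebra K G)) FiltHopf.comul_mem).comp
      (malcevHom K C) = (tensorCompHom K _).comp
        ((Algebra.TensorProduct.map (malcevHom K C) (malcevHom K C)).comp (ueaComul K _)) := by
    refine uea_hom_ext fun x => ?_
    simp only [AlgHom.comp_apply, ueaComul_ι, map_add, Algebra.TensorProduct.map_tmul,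
      map_one, tensorCompHom_tmul, malcevHom_ι]
    have e1 : inrHat K (MonoidAlgebra K G) 1 = 1 :=
      map_one (Comp.mapAlg _ (isFilt_includeRight K (MonoidAlgebra K G)))
    have e2 : inlHat K (MonoidAlgebra K G) 1 = 1 :=
      map_one (Comp.mapAlg _ (isFilt_includeLeft K (MonoidAlgebra K G)))
    rw [e1, e2, mul_one, one_mul]
    exact comulHat_prim _
  exact congrArg (fun f : UEA K (FreeLieAlgebra K ι) →ₐ[K] _ => f u) h

/-- Reflection passes through U(L) and the Dynkin argument. For density, approximate a primitive p
by some u of U(L); then u is primitive modulo F m, hence a Lie element modulo F m. -/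
theorem isQIso_malcevLie : IsQIso
    (malcevLie K C : FreeLieAlgebra K ι →ₗ[K] Prim K (MonoidAlgebra K G)) := by
  have hq := isQIso_malcevHom K C
  refine ⟨isFilt_malcevLie K C, fun {m x} hx => ?_, fun m p => ?_⟩
  · refine mem_fil_of_ueaι_mem (hq.reflects ?_)
    rw [AlgHom.toLinearMap_apply, malcevHom_ι]
    exact hx
  · obtain ⟨u, hu⟩ := hq.dense m (primIncl K _ p)
    rw [AlgHom.toLinearMap_apply] at hu
    have hp : ueaComul K _ u - u ⊗ₜ[K] 1 - 1 ⊗ₜ[K] u ∈ fil K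
        (UEA K (FreeLieAlgebra K ι) ⊗[K] UEA K (FreeLieAlgebra K ι)) m := by
      refine (isQIso_tensorCompHom.comp (hq.tensor hq)).reflects ?_
      have h1 := Comp.isFilt_map (FiltHopf.comul_mem (K := K) (H := MonoidAlgebra K G)) m _ hu
      have h2 := Comp.isFilt_map (isFilt_includeLeft K (MonoidAlgebra K G)) m _ hu
      have h3 := Comp.isFilt_map (isFilt_includeRight K (MonoidAlgebra K G)) m _ hu
      have h4 := sub_mem (add_mem h2 h3) h1
      have e1 : inrHat K (MonoidAlgebra K G) 1 = 1 :=
        map_one (Comp.mapAlg _ (isFilt_includeRight K (MonoidAlgebra K G)))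
      have e2 : inlHat K (MonoidAlgebra K G) 1 = 1 :=
        map_one (Comp.mapAlg _ (isFilt_includeLeft K (MonoidAlgebra K G)))
      -- Primitivity of p cancels its contribution, so the defect of u is a combination of images of
      -- p - u, which are all in F m.
      have e : inlHat K _ (primIncl K _ p - malcevHom K C u) +
          inrHat K _ (primIncl K _ p - malcevHom K C u) -
          comulHat K _ (primIncl K _ p - malcevHom K C u) =
          ((tensorCompHom K (MonoidAlgebra K G)).toLinearMap ∘ₗ TensorProduct.map (malcevHom K C).toLinearMap
            (malcevHom K C).toLinearMap) (ueaComul K _ u - u ⊗ₜ[K] 1 - 1 ⊗ₜ[K] u) := by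
        rw [map_sub, map_sub, map_sub, comulHat_prim, comulHat_malcevHom, map_sub, map_sub]
        simp only [LinearMap.comp_apply, TensorProduct.map_tmul, AlgHom.toLinearMap_apply, map_one,
          tensorCompHom_tmul, e1, e2, mul_one, one_mul]
        abel
      rw [← e]
      exact h4
    obtain ⟨x, hx⟩ := exists_sub_ueaι_mem hp
    refine ⟨x, ?_⟩
    have h5 := hq.isFilt m _ hx
    rw [AlgHom.toLinearMap_apply, map_sub, malcevHom_ι] at h5
    have := add_mem hu h5
    rw [sub_add_sub_cancel] at this
    exact this

/-- The homomorphism U(L) → Â factors as U(L) → U(P(Â)) → Â and its first factor has dense image, so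
cancellation applies. -/
theorem isQIso_primHom (C : FreeGroupBasis ι G) :
    IsQIso (primHom K (MonoidAlgebra K G)).toLinearMap :=
  IsQIso.of_comp_right (isFilt_primHom K _) (isFilt_ueaMap (isFilt_malcevLie K C))
    (ueaMap_dense (isQIso_malcevLie K C).dense) (isQIso_malcevHom K C)

/-- The isomorphism of the completed free Lie algebra with the primitive part, as a linear map. -/
def malcevLinearEquiv : Comp K (FreeLieAlgebra K ι) ≃ₗ[K] Prim K (MonoidAlgebra K G) :=
  (LinearEquiv.ofBijective _ (Comp.isFiltIso_map (isQIso_malcevLie K C)).1).trans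
    (primOfEquiv K (MonoidAlgebra K G)).symm

theorem of_malcevLinearEquiv (x : Comp K (FreeLieAlgebra K ι)) :
    Comp.of (malcevLinearEquiv K C x) = Comp.map _ (isFilt_malcevLie K C) x :=
  (primOfEquiv K (MonoidAlgebra K G)).apply_symm_apply _

theorem malcevLinearEquiv_of (x : FreeLieAlgebra K ι) :
    malcevLinearEquiv K C (Comp.of x) = malcevLie K C x :=
  (primOfEquiv K (MonoidAlgebra K G)).injective (of_malcevLinearEquiv K C (Comp.of x))

theorem malcevLinearEquiv_mem {m : ℕ} {x : Comp K (FreeLieAlgebra K ι)} :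
    x ∈ fil K (Comp K (FreeLieAlgebra K ι)) m ↔
      malcevLinearEquiv K C x ∈ fil K (Prim K (MonoidAlgebra K G)) m := by
  rw [(Comp.isFiltIso_map (isQIso_malcevLie K C)).2 m x, ← of_malcevLinearEquiv, Comp.of_mem_fil]

/-- The isomorphism of the completed free Lie algebra with the primitive part. -/
def malcevEquiv : Comp K (FreeLieAlgebra K ι) ≃ₗ⁅K⁆ Prim K (MonoidAlgebra K G) :=
  { malcevLinearEquiv K C with
    map_lie' := fun {x y} => by
      change malcevLinearEquiv K C ⁅x, y⁆ = ⁅malcevLinearEquiv K C x, malcevLinearEquiv K C y⁆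
      -- Brackets are compared modulo each F m on representatives from the uncompleted free Lie
      -- algebra, where the map is a Lie homomorphism.
      refine primIncl_injective (Comp.eq_of_sub_mem fun m => ?_)
      rw [← map_sub, ← mem_fil_prim]
      obtain ⟨a, ha, -⟩ := Comp.exists_rep m x
      obtain ⟨b, hb, -⟩ := Comp.exists_rep m y
      have h1 := (malcevLinearEquiv_mem K C).1 (Comp.proj_eq_iff.1 (Comp.proj_lie ha hb))
      have h2 := (malcevLinearEquiv_mem K C).1 (Comp.proj_eq_iff.1 ha)
      have h3 := (malcevLinearEquiv_mem K C).1 (Comp.proj_eq_iff.1 hb)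
      rw [map_sub, malcevLinearEquiv_of] at h1 h2 h3
      rw [LieHom.map_lie] at h1
      have := sub_mem h1 (prim_lie_sub_mem h2 h3)
      rwa [sub_sub_sub_cancel_right] at this }

theorem malcevEquiv_of (x : FreeLieAlgebra K ι) :
    malcevEquiv K C (Comp.of x) = malcevLie K C x := malcevLinearEquiv_of K C x

theorem malcevEquiv_mem (m : ℕ) (x : Comp K (FreeLieAlgebra K ι)) :
    x ∈ fil K (Comp K (FreeLieAlgebra K ι)) m ↔
      malcevEquiv K C x ∈ fil K (Prim K (MonoidAlgebra K G)) m := malcevLinearEquiv_mem K C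

end Malcev

end CompletedConn

end

noncomputable section

open scoped TensorProduct
open MulOpposite

namespace CompletedConn

open Coalgebra Bialgebra HopfAlgebra

/-! ### Continuous connections on topologically free modules -/

section Maps

variable {K : Type*} [Field K]
variable {V W X : Type*} [AddCommGroup V] [Module K V] [AddCommGroup W] [Module K W]
  [AddCommGroup X] [Module K X] [Filt K V] [Filt K W] [Filt K X]

theorem Comp.map₂_mem_left (f : V →ₗ[K] W →ₗ[K] X) (h₁) (h₂) {m : ℕ} {x : Comp K V}
    (hx : x ∈ fil K (Comp K V) m) (y : Comp K W) :
    Comp.map₂ f h₁ h₂ x y ∈ fil K (Comp K X) m := by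
  obtain ⟨w, hw, -⟩ := Comp.exists_rep m y
  have hx : Comp.proj m x = Submodule.Quotient.mk 0 := hx
  rw [Comp.mem_fil, Comp.proj_map₂ f h₁ h₂ hx hw, map_zero, LinearMap.zero_apply]
  rfl

theorem Comp.proj_mapShift (s : ℕ) (f : V →ₗ[K] W) (hf) {m : ℕ} {x : Comp K V} {v : V}
    (hv : Comp.proj (m + s) x = Submodule.Quotient.mk v) :
    Comp.proj m (Comp.mapShift s f hf x) = Submodule.Quotient.mk (f v) := by
  change Submodule.mapQ _ _ f (hf m) (Comp.proj (m + s) x) = _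
  rw [hv]
  rfl

theorem Comp.map_injective {f : V →ₗ[K] W} (hf : IsFilt f)
    (h : ∀ m v, f v ∈ fil K W m → v ∈ fil K V m) : Function.Injective (Comp.map f hf) := by
  rw [injective_iff_map_eq_zero]
  intro x hx
  refine Comp.eq_zero_of_mem fun m => ?_
  obtain ⟨v, hv, -⟩ := Comp.exists_rep m x
  have h1 := Comp.proj_map f hf hv
  rw [hx, map_zero] at h1
  rw [Comp.mem_fil, hv, Submodule.Quotient.mk_eq_zero]
  exact h m v ((Submodule.Quotient.mk_eq_zero _).1 h1.symm)

theorem isCont_sum {ι : Type*} (s : Finset ι) {f : ι → V →ₗ[K] W} (hf : ∀ i, IsCont (f i)) :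
    IsCont (∑ i ∈ s, f i) := fun m => by
  choose k hk using fun i => hf i m
  refine ⟨s.sup k, fun v hv => ?_⟩
  rw [LinearMap.sum_apply]
  exact Submodule.sum_mem _ fun i hi => hk i v (fil_anti (Finset.le_sup hi) hv)

/-- The isomorphism of completions induced by a map that is an isomorphism modulo each `F m`. -/
def IsQIso.compEquiv {f : V →ₗ[K] W} (hf : IsQIso f) : Comp K V ≃ₗ[K] Comp K W :=
  LinearEquiv.ofBijective _ (Comp.isFiltIso_map hf).1

theorem IsQIso.compEquiv_apply {f : V →ₗ[K] W} (hf : IsQIso f) (x : Comp K V) :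
    hf.compEquiv x = Comp.map f hf.isFilt x := rfl

theorem IsQIso.isFilt_compEquiv {f : V →ₗ[K] W} (hf : IsQIso f) :
    IsFilt hf.compEquiv.toLinearMap := Comp.isFilt_map hf.isFilt

theorem IsQIso.isFilt_compEquiv_symm {f : V →ₗ[K] W} (hf : IsQIso f) :
    IsFilt hf.compEquiv.symm.toLinearMap := fun m y hy => by
  refine ((Comp.isFiltIso_map hf).2 m _).2 ?_
  have : Comp.map f hf.isFilt (hf.compEquiv.symm y) = y := hf.compEquiv.apply_symm_apply y
  rw [LinearEquiv.coe_coe, this]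
  exact hy

end Maps

/-! ### Topological bases and the connections they determine -/

section Conn

variable {K : Type*} [Field K]
variable {R S : Type*} [Ring R] [Algebra K R] [FiltAlg K R] [Ring S] [Algebra K S] [FiltAlg K S]
variable {M : Type*} [AddCommGroup M] [Module K M] [Filt K M] [Module R M] [IsScalarTower K R M]
  [FiltSMul K R M]
variable {N : Type*} [AddCommGroup N] [Module K N] [Filt K N] [Module S N] [IsScalarTower K S N]
  [FiltSMul K S N]

theorem Comp.proj_smul {m : ℕ} {r : Comp K R} {x : Comp K M} {a : R} {v : M}
    (ha : Comp.proj m r = Submodule.Quotient.mk a) (hv : Comp.proj m x = Submodule.Quotient.mk v) :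
    Comp.proj m (r • x) = Submodule.Quotient.mk (a • v) := Comp.proj_act ha hv

theorem Comp.map_smul_map {f : R →ₐ[K] S} (hf : IsFilt f.toLinearMap) {h : M →ₗ[K] N}
    (hh : IsFilt h) (hs : ∀ (r : R) (m : M), h (r • m) = f r • h m) (r : Comp K R) (x : Comp K M) :
    Comp.map h hh (r • x) = Comp.map f.toLinearMap hf r • Comp.map h hh x := by
  ext m
  obtain ⟨a, ha, -⟩ := Comp.exists_rep m r
  obtain ⟨v, hv, -⟩ := Comp.exists_rep m x
  rw [Comp.proj_map h hh (Comp.proj_smul ha hv),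
    Comp.proj_smul (Comp.proj_map _ hf ha) (Comp.proj_map h hh hv), hs]
  rfl

omit [IsScalarTower K R M] [FiltSMul K R M] in
theorem proj_tensorHat {m : ℕ} {r : Comp K R} {x : Comp K M} {a : R} {v : M}
    (ha : Comp.proj m r = Submodule.Quotient.mk a) (hv : Comp.proj m x = Submodule.Quotient.mk v) :
    Comp.proj m (tensorHat K R M (dHat K R r) x) =
      Submodule.Quotient.mk (btMk K R M (dOm K R a ⊗ₜ[K] v)) :=
  Comp.proj_map₂ _ _ _ (Comp.proj_map _ _ ha) hv

theorem tensorHat_dHat_mul (r s : Comp K R) (x : Comp K M) :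
    tensorHat K R M (dHat K R (r * s)) x =
      tensorHat K R M (dHat K R r) (s • x) + r • tensorHat K R M (dHat K R s) x := by
  ext m
  obtain ⟨a, ha, -⟩ := Comp.exists_rep m r
  obtain ⟨b, hb, -⟩ := Comp.exists_rep m s
  obtain ⟨v, hv, -⟩ := Comp.exists_rep m x
  rw [map_add, proj_tensorHat (Comp.proj_mul ha hb) hv, proj_tensorHat ha (Comp.proj_smul hb hv),
    Comp.proj_smul ha (proj_tensorHat hb hv), btMk_dOm_mul]
  rfl

omit [IsScalarTower K R M] [FiltSMul K R M] in
theorem tensorHat_dHat_one (x : Comp K M) : tensorHat K R M (dHat K R 1) x = 0 := by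
  have : dHat K R 1 = 0 := by
    change Comp.of (dOm K R 1) = 0
    rw [dOm_one, map_zero]
  rw [this, map_zero, LinearMap.zero_apply]

omit [FiltAlg K R] [FiltAlg K S] in
theorem omMap_dOm (f : R →ₐ[K] S) (a : R) : omMap f (dOm K R a) = dOm K S (f a) :=
  omIncl_injective (by
    rw [omIncl_omMap]
    simp [dOm, envMap])

omit [IsScalarTower K R M] [FiltSMul K R M] in
theorem tensorHat_dHat_of (a : R) (v : M) :
    tensorHat K R M (dHat K R (Comp.of a)) (Comp.of v) =
      Comp.of (btMk K R M (dOm K R a ⊗ₜ[K] v)) :=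
  Comp.ext fun m => proj_tensorHat (Comp.proj_of m a) (Comp.proj_of m v)

omit [IsScalarTower K R M] [FiltSMul K R M] [IsScalarTower K S N] [FiltSMul K S N] in
theorem map_tensorHat {f : R →ₐ[K] S} (hf : IsFilt f.toLinearMap) {h : M →ₗ[K] N}
    (hh : IsFilt h) (hs : ∀ (r : R) (m : M), h (r • m) = f r • h m) (r : Comp K R) (x : Comp K M) :
    Comp.map (btMap f h hs) (isFilt_btMap hf hh hs) (tensorHat K R M (dHat K R r) x) =
      tensorHat K S N (dHat K S (Comp.map f.toLinearMap hf r)) (Comp.map h hh x) := by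
  ext m
  obtain ⟨a, ha, -⟩ := Comp.exists_rep m r
  obtain ⟨v, hv, -⟩ := Comp.exists_rep m x
  rw [Comp.proj_map _ _ (proj_tensorHat ha hv),
    proj_tensorHat (Comp.proj_map _ hf ha) (Comp.proj_map h hh hv), btMap_mk,
    TensorProduct.map_tmul]
  rw [omMap_dOm]
  rfl

omit [Filt K M] [FiltAlg K R] [IsScalarTower K R M] [FiltSMul K R M] in
/-- Connections that vanish at an element agree at its multiples. -/
theorem IsContConn.apply_of_smul {f : R →ₐ[K] S} {h : M →ₗ[K] N}
    (hs : ∀ (r : R) (m : M), h (r • m) = f r • h m) {D : M →ₗ[K] BT K R M} (hD : IsConn D)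
    {E : PreConn K S N} (hE : IsContConn E) {v : M} (h0 : D v = 0)
    (h0' : E (Comp.of (h v)) = 0) (r : R) :
    E (Comp.of (h (r • v))) = Comp.of (btMap f h hs (D (r • v))) := by
  have h1 : (Comp.of (f r • h v) : Comp K N) = (Comp.of (f r) : Comp K S) • Comp.of (h v) :=
    Comp.ext fun m => (Comp.proj_smul (Comp.proj_of m (f r)) (Comp.proj_of m (h v))).symm
  rw [hs, h1, hE.leibniz, h0', smul_zero, add_zero, hD, h0, smul_zero, add_zero, btMap_mk,
    TensorProduct.map_tmul, omMap_dOm, tensorHat_dHat_of]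

variable {ι : Type*} [Fintype ι]

omit [Filt K M] [FiltAlg K R] [IsScalarTower K R M] [FiltSMul K R M] in
/-- Connections that vanish at generators of a module agree. -/
theorem IsContConn.apply_of {f : R →ₐ[K] S} {h : M →ₗ[K] N}
    (hs : ∀ (r : R) (m : M), h (r • m) = f r • h m) {D : M →ₗ[K] BT K R M} (hD : IsConn D)
    {E : PreConn K S N} (hE : IsContConn E) {e : ι → M} (h0 : ∀ i, D (e i) = 0)
    (h0' : ∀ i, E (Comp.of (h (e i))) = 0) {m : M} (c : ι → R) (hc : ∑ i, c i • e i = m) :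
    E (Comp.of (h m)) = Comp.of (btMap f h hs (D m)) := by
  rw [← hc, map_sum, map_sum, map_sum, map_sum, map_sum, map_sum]
  exact Finset.sum_congr rfl fun i _ => IsContConn.apply_of_smul hs hD hE (h0 i) (h0' i) (c i)

variable [DecidableEq ι]

variable (R) in
/-- A finite topological basis of a complete module: each element is a linear combination, with
unique coefficients that depend continuously on it. -/
structure TopBasis (e : ι → Comp K M) where
  coord : ι → Comp K M →ₗ[K] Comp K R
  coord_smul : ∀ i (r : Comp K R) x, coord i (r • x) = r * coord i x
  cont : ∀ i, IsCont (coord i)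
  coord_self : ∀ i j, coord i (e j) = if i = j then 1 else 0
  sum_coord : ∀ x, ∑ i, coord i x • e i = x

/-- A topological basis of the completion of a module from a basis of the module. -/
def TopBasis.ofBasis (e : ι → M) (c : ι → M →ₗ[K] R)
    (hc : ∀ i (r : R) m, c i (r • m) = r * c i m) (he : ∀ i j, c i (e j) = if i = j then 1 else 0)
    (hs : ∀ m, ∑ i, c i m • e i = m) (s : ℕ)
    (hm : ∀ i m, ∀ v ∈ fil K M (m + s), c i v ∈ fil K R m) :
    TopBasis R (fun i => (Comp.of (e i) : Comp K M)) where
  coord i := Comp.mapShift s (c i) (hm i)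
  coord_smul i r x := by
    -- Coordinates lose s degrees, so representatives are chosen modulo F (m + s) to obtain values
    -- modulo F m.
    ext m
    obtain ⟨a, -, ha⟩ := Comp.exists_rep (m + s) r
    obtain ⟨v, hv, -⟩ := Comp.exists_rep (m + s) x
    rw [Comp.proj_mapShift s _ _ (Comp.proj_smul (ha _ le_rfl) hv),
      Comp.proj_mul (ha m (by omega)) (Comp.proj_mapShift s _ _ hv), hc]
  cont i := Comp.isCont_mapShift s _ _
  coord_self i j := by
    rw [Comp.mapShift_of, he]
    split_ifs
    · rfl
    · rw [map_zero]
  sum_coord x := by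
    ext m
    obtain ⟨v, hv, hv'⟩ := Comp.exists_rep (m + s) x
    rw [map_sum, hv' m (by omega), ← hs v, ← Submodule.mkQ_apply, map_sum]
    refine Finset.sum_congr rfl fun i _ => ?_
    rw [Comp.proj_smul (Comp.proj_mapShift s _ _ hv) (Comp.proj_of m (e i))]
    rfl

/-- The negative of a topological basis. -/
def TopBasis.neg {e : ι → Comp K M} (B : TopBasis R e) : TopBasis R (fun i => -e i) where
  coord i := -B.coord i
  coord_smul i r x := by simp [B.coord_smul]
  cont i m := by
    obtain ⟨k, hk⟩ := B.cont i m
    exact ⟨k, fun v hv => neg_mem (hk v hv)⟩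
  coord_self i j := by simp [B.coord_self]
  sum_coord x := by simpa using B.sum_coord x

/-- Equal families are simultaneously topological bases. -/
def TopBasis.congr {e e' : ι → Comp K M} (B : TopBasis R e) (h : ∀ i, e i = e' i) :
    TopBasis R e' where
  coord := B.coord
  coord_smul := B.coord_smul
  cont := B.cont
  coord_self i j := by rw [← h, B.coord_self]
  sum_coord x := by simp only [← h, B.sum_coord]

/-- Topological bases are preserved by isomorphisms. -/
def TopBasis.map {e : ι → Comp K M} (B : TopBasis R e) {f : R →ₐ[K] S} (hf : IsQIso f.toLinearMap)
    {h : M →ₗ[K] N} (hh : IsQIso h) (hs : ∀ (r : R) (m : M), h (r • m) = f r • h m) :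
    TopBasis S (fun i => Comp.map h hh.isFilt (e i)) where
  coord i := hf.compEquiv.toLinearMap ∘ₗ B.coord i ∘ₗ hh.compEquiv.symm.toLinearMap
  coord_smul i r y := by
    obtain ⟨a, rfl⟩ := hf.compEquiv.surjective r
    obtain ⟨x, rfl⟩ := hh.compEquiv.surjective y
    have e1 : hf.compEquiv a • hh.compEquiv x = hh.compEquiv (a • x) :=
      (Comp.map_smul_map hf.isFilt hh.isFilt hs a x).symm
    simp only [LinearMap.comp_apply, LinearEquiv.coe_coe]
    rw [e1, LinearEquiv.symm_apply_apply, LinearEquiv.symm_apply_apply, B.coord_smul]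
    exact Comp.map_mul hf.isFilt _ _
  cont i := hf.isFilt_compEquiv.isCont.comp ((B.cont i).comp hh.isFilt_compEquiv_symm.isCont)
  coord_self i j := by
    simp only [LinearMap.comp_apply, LinearEquiv.coe_coe, ← hh.compEquiv_apply,
      LinearEquiv.symm_apply_apply, B.coord_self]
    split_ifs
    · exact map_one (Comp.mapAlg f hf.isFilt)
    · rw [map_zero]
  sum_coord y := by
    obtain ⟨x, rfl⟩ := hh.compEquiv.surjective y
    simp only [LinearMap.comp_apply, LinearEquiv.coe_coe, LinearEquiv.symm_apply_apply]
    conv_rhs => rw [← B.sum_coord x, map_sum]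
    exact Finset.sum_congr rfl fun i _ => (Comp.map_smul_map hf.isFilt hh.isFilt hs _ _).symm

/-- Topological bases are reflected by isomorphisms. -/
def TopBasis.comap {f : R →ₐ[K] S} (hf : IsQIso f.toLinearMap)
    {h : M →ₗ[K] N} (hh : IsQIso h) (hs : ∀ (r : R) (m : M), h (r • m) = f r • h m)
    {e : ι → Comp K M} (B : TopBasis S (fun i => Comp.map h hh.isFilt (e i))) : TopBasis R e where
  coord i := hf.compEquiv.symm.toLinearMap ∘ₗ B.coord i ∘ₗ hh.compEquiv.toLinearMap
  coord_smul i r x := by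
    have e1 : hh.compEquiv (r • x) = hf.compEquiv r • hh.compEquiv x :=
      Comp.map_smul_map hf.isFilt hh.isFilt hs r x
    refine hf.compEquiv.injective ?_
    have e2 : ∀ a b, hf.compEquiv (a * b) = hf.compEquiv a * hf.compEquiv b :=
      Comp.map_mul hf.isFilt
    simp only [LinearMap.comp_apply, LinearEquiv.coe_coe, e1, e2, LinearEquiv.apply_symm_apply,
      B.coord_smul]
  cont i := hf.isFilt_compEquiv_symm.isCont.comp ((B.cont i).comp hh.isFilt_compEquiv.isCont)
  coord_self i j := by
    refine hf.compEquiv.injective ?_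
    simp only [LinearMap.comp_apply, LinearEquiv.coe_coe, hh.compEquiv_apply,
      LinearEquiv.apply_symm_apply, B.coord_self]
    split_ifs
    · exact (map_one (Comp.mapAlg f hf.isFilt)).symm
    · rw [map_zero]
  sum_coord x := by
    refine hh.compEquiv.injective ?_
    conv_rhs => rw [← B.sum_coord (hh.compEquiv x)]
    rw [map_sum]
    refine Finset.sum_congr rfl fun i _ => ?_
    refine (Comp.map_smul_map hf.isFilt hh.isFilt hs _ _).trans ?_
    congr 1
    exact hf.compEquiv.apply_symm_apply _

/-- The Leibniz rule applied to the finite expansion of x leaves no choice; all uniqueness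
statements for completed connections rest on this formula. -/
theorem TopBasis.apply_eq {e : ι → Comp K M} (B : TopBasis R e) {D : PreConn K R M}
    (hD : IsContConn D) (h0 : ∀ i, D (e i) = 0) (x : Comp K M) :
    D x = ∑ i, tensorHat K R M (dHat K R (B.coord i x)) (e i) := by
  conv_lhs => rw [← B.sum_coord x, map_sum]
  refine Finset.sum_congr rfl fun i _ => ?_
  rw [hD.leibniz, h0, smul_zero, add_zero]

omit [IsScalarTower K R M] [FiltSMul K R M] in
theorem isFilt_tensorHat_flip (x : Comp K M) : IsFilt ((tensorHat K R M).flip x) := by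
  intro m ω hω
  rw [LinearMap.flip_apply, tensorHat]
  exact Comp.map₂_mem_left _ _ _ hω x

/-- The connection that vanishes on a given topological basis. -/
def TopBasis.conn {e : ι → Comp K M} (B : TopBasis R e) : PreConn K R M :=
  ∑ i, (tensorHat K R M).flip (e i) ∘ₗ dHat K R ∘ₗ B.coord i

theorem TopBasis.conn_apply {e : ι → Comp K M} (B : TopBasis R e) (x : Comp K M) :
    B.conn x = ∑ i, tensorHat K R M (dHat K R (B.coord i x)) (e i) := by
  rw [TopBasis.conn, LinearMap.sum_apply]
  rfl

theorem TopBasis.isContConn {e : ι → Comp K M} (B : TopBasis R e) : IsContConn B.conn where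
  cont := by
    refine isCont_sum _ fun i => ?_
    have h : IsFilt (dHat K R) := Comp.isFilt_map isFilt_dOm
    exact (isFilt_tensorHat_flip (e i)).isCont.comp (h.isCont.comp (B.cont i))
  leibniz r x := by
    have h : tensorHat K R M (dHat K R r) x =
        ∑ i, tensorHat K R M (dHat K R r) (B.coord i x • e i) := by
      rw [← map_sum, B.sum_coord]
    rw [h, B.conn_apply, B.conn_apply, Finset.smul_sum, ← Finset.sum_add_distrib]
    exact Finset.sum_congr rfl fun i _ => by rw [B.coord_smul, tensorHat_dHat_mul]

theorem TopBasis.conn_self {e : ι → Comp K M} (B : TopBasis R e) (j : ι) : B.conn (e j) = 0 := by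
  rw [B.conn_apply]
  refine Finset.sum_eq_zero fun i _ => ?_
  rw [B.coord_self]
  split_ifs
  · exact tensorHat_dHat_one _
  · rw [map_zero, map_zero, LinearMap.zero_apply]

theorem TopBasis.eq_conn {e : ι → Comp K M} (B : TopBasis R e) {D : PreConn K R M}
    (hD : IsContConn D) (h0 : ∀ i, D (e i) = 0) : D = B.conn :=
  LinearMap.ext fun x => by rw [B.apply_eq hD h0, B.conn_apply]

/-- Homomorphisms that preserve topological bases intertwine the connections that vanish on
them. -/
theorem TopBasis.intertwine {e : ι → Comp K M} (B : TopBasis R e) {f : R →ₐ[K] S}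
    (hf : IsFilt f.toLinearMap) {h : M →ₗ[K] N} (hh : IsFilt h)
    (hs : ∀ (r : R) (m : M), h (r • m) = f r • h m) {D : PreConn K R M} (hD : IsContConn D)
    (h0 : ∀ i, D (e i) = 0) {D' : PreConn K S N} (hD' : IsContConn D')
    (h0' : ∀ i, D' (Comp.map h hh (e i)) = 0) (x : Comp K M) :
    D' (Comp.map h hh x) = Comp.map (btMap f h hs) (isFilt_btMap hf hh hs) (D x) := by
  rw [B.apply_eq hD h0, map_sum]
  conv_lhs => rw [← B.sum_coord x, map_sum, map_sum]
  refine Finset.sum_congr rfl fun i _ => ?_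
  rw [Comp.map_smul_map hf hh hs, hD'.leibniz, h0', smul_zero, add_zero, map_tensorHat hf hh hs]

end Conn

end CompletedConn

end

noncomputable section

open scoped TensorProduct
open MulOpposite

namespace CompletedConn

open Coalgebra Bialgebra HopfAlgebra

/-! ### The functor `Φ` -/

section PhiBasis

variable {K : Type*} [Field K] {H : Type*} [Ring H] [HopfAlgebra K H]

/-- Makes Φ_H(H) a filtered module, through which the inverse of `phiEnv` is shown to be filtered.
-/
instance regularFiltSMul {R : Type*} [Ring R] [Algebra K R] [FiltAlg K R] : FiltSMul K R R where
  smul_mem ha hv := mul_mem ha hv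

variable (K H)

/-- The projection `x ↦ x - ε(x)` to the augmentation ideal. -/
def augProj : H →ₗ[K] Aug K H where
  toFun x := ⟨x - algebraMap K H (counit (R := K) x), by
    rw [RingHom.mem_ker]
    simp [counit_algebraMap]⟩
  map_add' x y := Subtype.ext (by simp; abel)
  map_smul' c x := Subtype.ext (by simp [Algebra.smul_def, mul_sub])

/-- The inverse `x ⊗ y ↦ x₁ ⊗ x₂ y` of `phiEnv`. -/
def phiEnvInv : Env K H →ₗ[K] Aug K H ⊗[K] H :=
  (augProj K H).rTensor H ∘ₗ (phiAct K H H).toLinearMap.flip ((1 : H) ⊗ₜ[K] (1 : H))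

variable {K H}

theorem phiEnvInv_phiEnv (t : Aug K H ⊗[K] H) : phiEnvInv K H (phiEnv K H t) = t := by
  induction t with
  | zero => simp
  | add a b ha hb => rw [map_add, map_add, ha, hb]
  | tmul m b =>
    -- The map j is linear over Δ̃, so Δ̃(m) acts on 1 ⊗ 1 as j(m); this is where the antipode
    -- identity enters.
    have h : phiAct K H H (deltaTilde K H m.1) ((1 : H) ⊗ₜ[K] (1 : H)) = m.1 ⊗ₜ[K] (1 : H) := by
      have := phiJ_smul (K := K) (M := H) m.1 1
      rw [smul_eq_mul, mul_one] at this
      exact this.symm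
    have h2 : augProj K H m.1 = m := Subtype.ext (by
      have hm : counit (R := K) m.1 = 0 := m.2
      simp [augProj, hm])
    rw [phiEnv_tmul, phiEnvInv, LinearMap.comp_apply, LinearMap.flip_apply,
      AlgHom.toLinearMap_apply, map_mul, Module.End.mul_apply, h]
    simp [phiAct, h2]

/-- The discrepancy comes from the constant parts that the projection to Ker ε discards; it depends
only on the product of t and so vanishes on `1`-forms. -/
theorem phiEnv_phiEnvInv (t : Env K H) :
    phiEnv K H (phiEnvInv K H t) = t - (1 : H) ⊗ₜ[K] op (envMul K H t) := by
  induction t using TensorProduct.induction_on with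
  | zero => simp
  | add a b ha hb =>
    rw [map_add, map_add, ha, hb, map_add, op_add, TensorProduct.tmul_add]
    abel
  | tmul x y =>
    have h : ∀ s : H ⊗[K] H, phiEnv K H ((augProj K H).rTensor H
        (phiLeft₂ K H H s ((1 : H) ⊗ₜ[K] (unop y)))) = ((1 : H) ⊗ₜ[K] y) *
        (TensorProduct.lift ((LinearMap.mul K (Env K H)).flip.compl₁₂ (deltaTilde K H).toLinearMap
          ((Algebra.TensorProduct.includeRight : Hᵐᵒᵖ →ₐ[K] Env K H).toLinearMap ∘ₗ
            (opLinearEquiv K).toLinearMap)) s) -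
        (1 : H) ⊗ₜ[K] op (TensorProduct.lid K H ((counit (R := K)).rTensor H s) * unop y) := by
      intro s
      induction s with
      | zero => simp
      | add a b ha hb =>
        simp only [map_add, LinearMap.add_apply, mul_add, add_mul, ha, hb, op_add,
          TensorProduct.tmul_add]
        abel
      | tmul p q =>
        rw [phiLeft₂_tmul, LinearMap.rTensor_tmul, phiEnv_tmul]
        simp [augProj, mul_sub, ← mul_assoc, Algebra.algebraMap_eq_smul_one,
          TensorProduct.smul_tmul']
    have h2 := h (comul x)
    rw [deltaTilde_comul, rTensor_counit_comul] at h2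
    have h3 : phiEnvInv K H (x ⊗ₜ[K] y) = (augProj K H).rTensor H
        (phiLeft₂ K H H (comul x) ((1 : H) ⊗ₜ[K] (unop y))) := by
      rw [phiEnvInv, LinearMap.comp_apply, LinearMap.flip_apply, AlgHom.toLinearMap_apply, phiAct,
        Algebra.TensorProduct.lift_tmul, Module.End.mul_apply, phiRight_tmul, one_mul]
      rfl
    rw [h3, h2]
    simp

variable (K H)

/-- The homomorphism `x ⊗ y ↦ x ε(y)`. -/
def envCounit : Env K H →ₐ[K] H :=
  Algebra.TensorProduct.lift (AlgHom.id K H)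
    ((Algebra.ofId K H).comp ((counitAlgHom K H).fromOpposite fun _ _ => Commute.all _ _))
    (fun x _ => (Algebra.commutes _ x).symm)

variable {K H}

theorem envCounit_tmul (x : H) (y : Hᵐᵒᵖ) :
    envCounit K H (x ⊗ₜ[K] y) = x * algebraMap K H (counit (R := K) (unop y)) := rfl

/-- As ε ∘ S = ε, the counit on the second factor inverts Δ̃ from the left. With the corresponding
retraction of Φ(M) onto M it lets bases descend. -/
theorem envCounit_deltaTilde (x : H) : envCounit K H (deltaTilde K H x) = x := by
  have h : ∀ t : H ⊗[K] H, envCounit K H (Algebra.TensorProduct.map (AlgHom.id K H)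
      (antipodeAlgHomOp K H) t) = TensorProduct.rid K H ((counit (R := K)).lTensor H t) := by
    intro t
    induction t with
    | zero => simp
    | add a b ha hb => simp only [map_add, ha, hb]
    | tmul a b =>
      simp [envCounit_tmul, counit_antipode, Algebra.algebraMap_eq_smul_one]
  refine (h (comul x)).trans ?_
  rw [lTensor_counit_comul]
  simp

variable {M : Type*} [AddCommGroup M] [Module K M]

variable (K H M) in
/-- The map `m ⊗ a ↦ ε(a) m`. -/
def phiCounit : M ⊗[K] H →ₗ[K] M :=
  (TensorProduct.rid K M).toLinearMap ∘ₗ (counit (R := K)).lTensor M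

theorem phiCounit_tmul (m : M) (a : H) :
    phiCounit K H M (m ⊗ₜ[K] a) = counit (R := K) a • m := by simp [phiCounit]

variable [Module H M] [IsScalarTower K H M]

theorem phiCounit_phiLeft₂ (s : H ⊗[K] H) (m : M) (a : H) :
    phiCounit K H M (phiLeft₂ K H M s (m ⊗ₜ[K] a)) =
      counit (R := K) a • (TensorProduct.rid K H ((counit (R := K)).lTensor H s)) • m := by
  induction s with
  | zero => simp
  | add a b ha hb => simp only [map_add, LinearMap.add_apply, add_smul, smul_add, ha, hb]
  | tmul p q =>
    rw [phiLeft₂_tmul, phiCounit_tmul, Bialgebra.counit_mul, LinearMap.lTensor_tmul,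
      TensorProduct.rid_tmul, smul_assoc, mul_comm, mul_smul]

theorem phiCounit_phiAct (r : Env K H) (t : M ⊗[K] H) :
    phiCounit K H M (phiAct K H M r t) = envCounit K H r • phiCounit K H M t := by
  induction r using TensorProduct.induction_on with
  | zero => simp
  | add a b ha hb => rw [map_add, LinearMap.add_apply, map_add, ha, hb, map_add, add_smul]
  | tmul x y =>
    induction t with
    | zero => simp
    | add a b ha hb => rw [map_add, map_add, map_add, ha, hb, smul_add]
    | tmul m a =>
      have h : phiAct K H M (x ⊗ₜ y) (m ⊗ₜ[K] a) =
        phiLeft₂ K H M (comul x) (m ⊗ₜ[K] (a * unop y)) := rfl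
      rw [h, phiCounit_phiLeft₂, lTensor_counit_comul, TensorProduct.rid_tmul, one_smul,
        envCounit_tmul, phiCounit_tmul, Bialgebra.counit_mul, mul_smul x, algebraMap_smul,
        mul_comm, mul_smul, smul_algebra_smul_comm _ x, smul_algebra_smul_comm _ x]

variable (K H M) in
/-- The map `Φ(M) → M`, `m ⊗ a ↦ ε(a) m`. -/
def phiRetract : Phi K H M →ₗ[K] M := phiCounit K H M

omit [Module H M] [IsScalarTower K H M] in
theorem phiRetract_phiJ (m : M) : phiRetract K H M (phiJ K H M m) = m := by
  refine (phiCounit_tmul m (1 : H)).trans ?_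
  rw [Bialgebra.counit_one, one_smul]

theorem phiRetract_smul (r : Env K H) (t : Phi K H M) :
    phiRetract K H M (r • t) = envCounit K H r • phiRetract K H M t := phiCounit_phiAct r t

variable [FiltHopf K H]

/-- In positive degree nothing is subtracted, and degree 0 imposes no condition. -/
theorem isFilt_augProj (hε : ∀ x ∈ fil K H 1, counit (R := K) x = 0) : IsFilt (augProj K H) := by
  intro m x hx
  change x - algebraMap K H (counit (R := K) x) ∈ fil K H m
  rcases m with _ | m
  · exact mem_zero _
  · rw [hε x (fil_anti (by omega) hx), map_zero, sub_zero]
    exact hx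

theorem isQIso_phiOm (hε : ∀ x ∈ fil K H 1, counit (R := K) x = 0) : IsQIso (phiOm K H) := by
  have hF : IsFilt (phiEnvInv K H) := fun m t ht => by
    -- The inverse is the orbit map of 1 ⊗ 1 in Φ_H(H) followed by the projection to Ker ε; both are
    -- filtered.
    have h1 : t • (show Phi K H H from (1 : H) ⊗ₜ[K] (1 : H)) ∈ fil K (Phi K H H) (m + 0) :=
      FiltSMul.smul_mem ht (mem_zero _)
    exact isFilt_map (isFilt_augProj hε) (fun _ _ hv => hv) m _ h1
  refine IsFiltIso.isQIso ⟨⟨fun s t h => ?_, fun ω => ?_⟩,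
    fun m t => ⟨isFilt_phiOm m t, fun h => ?_⟩⟩
  · have := congrArg (fun ω => phiEnvInv K H (omIncl K H ω)) h
    exact (phiEnvInv_phiEnv s).symm.trans (this.trans (phiEnvInv_phiEnv t))
  · refine ⟨phiEnvInv K H (omIncl K H ω), omIncl_injective ?_⟩
    refine (phiEnv_phiEnvInv (omIncl K H ω)).trans ?_
    rw [envMul_omIncl, op_zero, TensorProduct.tmul_zero, sub_zero]
  · have h1 : phiEnvInv K H (phiEnv K H t) = t := phiEnvInv_phiEnv t
    have h2 : phiEnvInv K H (phiEnv K H t) ∈ fil K (Aug K H ⊗[K] H) m := hF m (phiEnv K H t) h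
    rw [h1] at h2
    exact h2

theorem isFilt_envCounit (hε : ∀ x ∈ fil K H 1, counit (R := K) x = 0) :
    IsFilt (envCounit K H).toLinearMap := fun m => by
  refine tensor_le (p := (fil K H m).comap (envCounit K H).toLinearMap) fun i j hij x hx y hy => ?_
  rw [Submodule.mem_comap, AlgHom.toLinearMap_apply, envCounit_tmul]
  rcases j with _ | j
  · exact fil_anti hij (mul_mem hx (mem_zero _))
  · rw [hε (unop y) (fil_anti (by omega) hy), map_zero, mul_zero]
    exact zero_mem _

variable [Filt K M] [FiltSMul K H M]

omit [Module H M] [IsScalarTower K H M] [FiltSMul K H M] in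
theorem isFilt_phiRetract (hε : ∀ x ∈ fil K H 1, counit (R := K) x = 0) :
    IsFilt (phiRetract K H M) := fun m => by
  refine tensor_le (V := M) (W := H) (p := (fil K M m).comap (phiCounit K H M))
    fun i j hij v hv a ha => ?_
  rw [Submodule.mem_comap, phiCounit_tmul]
  rcases j with _ | j
  · exact Submodule.smul_mem _ _ (fil_anti hij hv)
  · rw [hε a (fil_anti (by omega) ha), zero_smul]
    exact zero_mem _

theorem map_envCounit_deltaTilde (hε : ∀ x ∈ fil K H 1, counit (R := K) x = 0) (r : Comp K H) :
    Comp.map (envCounit K H).toLinearMap (isFilt_envCounit hε)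
      (Comp.map (deltaTilde K H).toLinearMap isFilt_deltaTilde r) = r := by
  ext m
  obtain ⟨a, ha, -⟩ := Comp.exists_rep m r
  rw [Comp.proj_map _ _ (Comp.proj_map _ _ ha), ha]
  exact congrArg _ (envCounit_deltaTilde a)

theorem map_phiRetract_phiJ (hε : ∀ x ∈ fil K H 1, counit (R := K) x = 0) (y : Comp K M) :
    Comp.map (phiRetract K H M) (isFilt_phiRetract hε)
      (Comp.map (phiJ K H M) isFilt_phiJ y) = y := by
  ext m
  obtain ⟨v, hv, -⟩ := Comp.exists_rep m y
  rw [Comp.proj_map _ _ (Comp.proj_map _ _ hv), hv, phiRetract_phiJ]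

variable {ι : Type*} [Fintype ι] [DecidableEq ι]

/-- A family whose image in `Φ(M)` is a topological basis is a topological basis. -/
def TopBasis.ofPhi (hε : ∀ x ∈ fil K H 1, counit (R := K) x = 0) {e : ι → Comp K M}
    (B : TopBasis (Env K H) (fun i => Comp.map (phiJ K H M) isFilt_phiJ (e i))) :
    TopBasis H e where
  coord i := Comp.map (envCounit K H).toLinearMap (isFilt_envCounit hε) ∘ₗ B.coord i ∘ₗ
    Comp.map (phiJ K H M) isFilt_phiJ
  coord_smul i r x := by
    have h1 : Comp.map (phiJ K H M) isFilt_phiJ (r • x) =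
        Comp.map (deltaTilde K H).toLinearMap isFilt_deltaTilde r •
          Comp.map (phiJ K H M) isFilt_phiJ x :=
      Comp.map_smul_map (f := deltaTilde K H) (h := phiJ K H M) isFilt_deltaTilde isFilt_phiJ
        phiJ_smul r x
    rw [LinearMap.comp_apply, LinearMap.comp_apply, h1, B.coord_smul]
    refine (Comp.map_mul (f := envCounit K H) (isFilt_envCounit hε) _ _).trans ?_
    rw [map_envCounit_deltaTilde hε]
    rfl
  cont i :=
    (Comp.isFilt_map (f := (envCounit K H).toLinearMap) (isFilt_envCounit hε)).isCont.comp
      ((B.cont i).comp (Comp.isFilt_map (f := phiJ K H M) isFilt_phiJ).isCont)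
  coord_self i j := by
    rw [LinearMap.comp_apply, LinearMap.comp_apply, B.coord_self]
    split_ifs
    · exact map_one (Comp.mapAlg (envCounit K H) (isFilt_envCounit hε))
    · rw [map_zero]
  sum_coord x := by
    have h : ∀ (r : Comp K (Env K H)) (t : Comp K (Phi K H M)),
        Comp.map (phiRetract K H M) (isFilt_phiRetract hε) (r • t) =
          Comp.map (envCounit K H).toLinearMap (isFilt_envCounit hε) r •
            Comp.map (phiRetract K H M) (isFilt_phiRetract hε) t :=
      Comp.map_smul_map (f := envCounit K H) (h := phiRetract K H M) (isFilt_envCounit hε)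
        (isFilt_phiRetract hε) phiRetract_smul
    -- Expand j(x) in Φ(M) and retract: each coefficient passes through the counit on its second
    -- factor and each j(e i) returns to e i.
    have h2 := congrArg (Comp.map (phiRetract K H M) (isFilt_phiRetract hε))
      (B.sum_coord (Comp.map (phiJ K H M) isFilt_phiJ x))
    rw [map_phiRetract_phiJ hε, map_sum] at h2
    refine Eq.trans (Finset.sum_congr rfl fun i _ => ?_) h2
    rw [h, map_phiRetract_phiJ hε]
    rfl

end PhiBasis

end CompletedConn

end

noncomputable section

open scoped TensorProduct
open MulOpposite

namespace CompletedConn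

open Coalgebra Bialgebra HopfAlgebra

/-! ### The logarithmic forms -/

section ExpEnv

variable {K : Type*} [Field K] [CharZero K] {R : Type*} [Ring R] [Algebra K R] [FiltAlg K R]

/-- The summands a ⊗ 1 and -(1 ⊗ a) commute, so the exponential of their sum factors. -/
theorem exp_env {a : Comp K R} (ha : a ∈ fil K (Comp K R) 1) :
    evalSeries (PowerSeries.exp K) (Comp.of (a ⊗ₜ[K] (1 : (Comp K R)ᵐᵒᵖ) - 1 ⊗ₜ[K] op a) :
      Comp K (Env K (Comp K R))) =
    Comp.of (evalSeries (PowerSeries.exp K) a ⊗ₜ[K] op (evalSeries (PowerSeries.exp K) (-a))) := by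
  let f₁ : Comp K R →ₗ[K] Comp K (Env K (Comp K R)) :=
    Comp.of ∘ₗ (TensorProduct.mk K (Comp K R) (Comp K R)ᵐᵒᵖ).flip 1
  let f₂ : Comp K R →ₗ[K] Comp K (Env K (Comp K R)) :=
    Comp.of ∘ₗ TensorProduct.mk K (Comp K R) (Comp K R)ᵐᵒᵖ 1 ∘ₗ (opLinearEquiv K).toLinearMap
  have e₁ : ∀ b, f₁ b = Comp.of (b ⊗ₜ[K] 1) := fun _ => rfl
  have e₂ : ∀ b, f₂ b = Comp.of (1 ⊗ₜ[K] op b) := fun _ => rfl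
  have h₁ : IsFilt f₁ := fun m b hb => Comp.isFilt_of m _
    (tmul_mem (i := m) (j := 0) (by simp) hb (mem_zero _))
  have h₂ : IsFilt f₂ := fun m b hb => Comp.isFilt_of m _
    (tmul_mem (i := 0) (j := m) (by simp) (mem_zero _) (op_mem hb))
  have p₁ : ∀ b c, f₁ (b * c) = f₁ b * f₁ c := fun b c => by
    rw [e₁, e₁, e₁, ← Comp.of_mul, Algebra.TensorProduct.tmul_mul_tmul, one_mul]
  have p₂ : ∀ b c, f₂ (b * c) = f₂ c * f₂ b := fun b c => by
    rw [e₂, e₂, e₂, ← Comp.of_mul, Algebra.TensorProduct.tmul_mul_tmul, one_mul, op_mul]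
  have q₁ : ∀ b (k : ℕ), f₁ (b ^ k) = f₁ b ^ k := fun b k => by
    induction k with
    | zero => rw [pow_zero, pow_zero, e₁]; exact Comp.of_one
    | succ k ih => rw [pow_succ, pow_succ, p₁, ih]
  -- The second embedding reverses products, but it preserves powers, and evaluating a power series
  -- needs no more.
  have q₂ : ∀ b (k : ℕ), f₂ (b ^ k) = f₂ b ^ k := fun b k => by
    induction k with
    | zero => rw [pow_zero, pow_zero, e₂]; exact Comp.of_one
    | succ k ih => rw [pow_succ', pow_succ, p₂, ih]
  have hc : Commute (f₁ a) (f₂ (-a)) := by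
    change f₁ a * f₂ (-a) = f₂ (-a) * f₁ a
    rw [e₁, e₂, ← Comp.of_mul, ← Comp.of_mul, Algebra.TensorProduct.tmul_mul_tmul,
      Algebra.TensorProduct.tmul_mul_tmul, one_mul, mul_one, one_mul, mul_one]
  have h : (Comp.of (a ⊗ₜ[K] (1 : (Comp K R)ᵐᵒᵖ) - 1 ⊗ₜ[K] op a) : Comp K (Env K (Comp K R))) =
      f₁ a + f₂ (-a) := by
    rw [map_neg, e₁, e₂, map_sub, sub_eq_add_neg]
  rw [h, exp_add (h₁ 1 a ha) (h₂ 1 (-a) (neg_mem ha)) hc,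
    ← map_evalSeries (PowerSeries.exp K) h₁ ha (q₁ a),
    ← map_evalSeries (PowerSeries.exp K) h₂ (neg_mem ha) (q₂ (-a)), e₁, e₂, ← Comp.of_mul,
    Algebra.TensorProduct.tmul_mul_tmul, one_mul, mul_one]

end ExpEnv

/-! ### Lie `1`-forms inside the enveloping algebra -/

section Aug

variable (K : Type*) [Field K] (H : Type*) [Ring H] [HopfAlgebra K H] [FiltHopf K H]

/-- The inclusion of the augmentation ideal. -/
def augIncl : Aug K H →ₗ[K] H :=
  (Submodule.subtype (RingHom.ker (counitAlgHom K H) : Ideal H)).restrictScalars K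

theorem isFilt_augIncl : IsFilt (augIncl K H) := fun _ _ hv => hv

variable {K H}

theorem map_augIncl_smul (r : Comp K H) (v : Aug K H) :
    Comp.map (augIncl K H) (isFilt_augIncl K H) (r • Comp.of v) = r * Comp.of (augIncl K H v) := by
  ext m
  obtain ⟨a, ha, -⟩ := Comp.exists_rep m r
  rw [Comp.proj_map _ _ (Comp.proj_smul ha (Comp.proj_of m v)),
    Comp.proj_mul ha (Comp.proj_of m (augIncl K H v))]
  rfl

/-- The reason for the factor (e^z - 1)/z: inside the algebra dz is z itself, and the form becomes
e^z - 1. -/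
theorem map_augIncl_expForm [CharZero K] {L : Type*} [LieRing L] [LieAlgebra K L] [Filt K L] {z : L}
    (hz : z ∈ fil K L 1) :
    Comp.map (augIncl K (UEA K L)) (isFilt_augIncl K _) (expForm z) =
      evalSeries (PowerSeries.exp K) (Comp.of (ueaι K L z)) - 1 := by
  rw [expForm, map_augIncl_smul]
  exact expSubOneDiv_mul (Comp.isFilt_of 1 _ (ueaι_mem hz))

end Aug

section PrimForm

variable (K : Type*) [Field K] (H : Type*) [Ring H] [HopfAlgebra K H] [FiltHopf K H]

/-- The homomorphism `x ↦ x₁ ⊗ S(x₂)` from `U(P(Ĥ))` to the enveloping algebra of `Ĥ`. -/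
def primDelta : UEA K (Prim K H) →ₐ[K] Env K (Comp K H) :=
  (envMap (primHom K H)).comp (deltaTilde K (UEA K (Prim K H)))

theorem isFilt_primDelta : IsFilt (primDelta K H).toLinearMap := fun m x hx =>
  isFilt_envMap (isFilt_primHom K H) m _ (isFilt_deltaTilde m x hx)

variable {K H}

theorem primDelta_ι (z : Prim K H) : primDelta K H (ueaι K _ z) =
    primIncl K H z ⊗ₜ[K] (1 : (Comp K H)ᵐᵒᵖ) - 1 ⊗ₜ[K] op (primIncl K H z) := by
  have h1 : deltaTilde K (UEA K (Prim K H)) (ueaι K _ z) =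
      ueaι K _ z ⊗ₜ[K] (1 : (UEA K (Prim K H))ᵐᵒᵖ) - 1 ⊗ₜ[K] op (ueaι K _ z) := by
    have h2 : antipodeAlgHomOp K (UEA K (Prim K H)) (ueaι K _ z) = - op (ueaι K _ z) :=
      ueaAntipode_ι z
    rw [deltaTilde, AlgHom.comp_apply, comulAlgHom_apply, uea_comul_apply, ueaComul_ι, map_add,
      Algebra.TensorProduct.map_tmul, Algebra.TensorProduct.map_tmul, h2, map_one, map_one,
      TensorProduct.tmul_neg, sub_eq_add_neg]
    rfl
  have h3 : primHom K H (ueaι K _ z) = primIncl K H z := ueaLift_ι _ _ z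
  rw [primDelta, AlgHom.comp_apply, h1, map_sub, envMap, Algebra.TensorProduct.map_tmul,
    Algebra.TensorProduct.map_tmul, map_one, map_one, h3]
  exact congrArg (fun x => primIncl K H z ⊗ₜ[K] (1 : (Comp K H)ᵐᵒᵖ) - 1 ⊗ₜ[K] op x) h3

theorem omIncl_primPhiOm_phiJ (v : OmLie K (Prim K H)) :
    omIncl K (Comp K H) (primPhiOm K H (phiJ K _ _ v)) = primDelta K H (augIncl K _ v) := by
  have h : phiEnv K (UEA K (Prim K H)) (v ⊗ₜ[K] 1) = deltaTilde K _ v.1 := by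
    rw [phiEnv_tmul]
    exact one_mul _
  exact congrArg (envMap (primHom K H)) h

theorem isFilt_omIncl {R : Type*} [Ring R] [Algebra K R] [FiltAlg K R] : IsFilt (omIncl K R) :=
  fun _ _ hv => hv

/-- On forms ω ⊗ 1 the comparison map is the algebra homomorphism Δ̃ followed by U(P(Ĥ)) → Ĥ on both
factors. It commutes with exp and sends z to z ⊗ 1 - 1 ⊗ z, so e^z - 1 becomes e^z ⊗ e^{-z} - 1. -/
theorem map_omIncl_expForm [CharZero K] {z : Prim K H} (hz : z ∈ fil K (Prim K H) 1) :
    Comp.map (omIncl K (Comp K H)) isFilt_omIncl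
      (primPhiOmHat K H (Comp.map (phiJ K _ _) isFilt_phiJ (expForm z))) =
    Comp.of (evalSeries (PowerSeries.exp K) (primIncl K H z) ⊗ₜ[K]
      op (evalSeries (PowerSeries.exp K) (-primIncl K H z)) - 1) := by
  have h1 : ∀ x : Comp K (OmLie K (Prim K H)),
      Comp.map (omIncl K (Comp K H)) isFilt_omIncl
        (primPhiOmHat K H (Comp.map (phiJ K _ _) isFilt_phiJ x)) =
      Comp.mapAlg (primDelta K H) (isFilt_primDelta K H)
        (Comp.map (augIncl K _) (isFilt_augIncl K _) x) := fun x => by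
    ext m
    obtain ⟨v, hv, -⟩ := Comp.exists_rep m x
    rw [Comp.mapAlg_apply, primPhiOmHat, Comp.proj_map _ _ (Comp.proj_map _ _ (Comp.proj_map _ _ hv)),
      Comp.proj_map _ _ (Comp.proj_map _ _ hv), omIncl_primPhiOm_phiJ]
    rfl
  have hf : IsFilt (Comp.mapAlg (primDelta K H) (isFilt_primDelta K H)).toLinearMap :=
    Comp.isFilt_map (isFilt_primDelta K H)
  have h2 : Comp.mapAlg (primDelta K H) (isFilt_primDelta K H) (Comp.of (ueaι K _ z)) =
      Comp.of (primIncl K H z ⊗ₜ[K] (1 : (Comp K H)ᵐᵒᵖ) - 1 ⊗ₜ[K] op (primIncl K H z)) := by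
    rw [Comp.mapAlg_apply, Comp.map_of, ← primDelta_ι]
    rfl
  have hz' : primIncl K H z ∈ fil K (Comp K H) 1 := hz
  rw [h1, map_augIncl_expForm hz, map_sub, map_one,
    map_evalSeries_algHom _ hf (Comp.isFilt_of 1 _ (ueaι_mem hz)), h2, exp_env hz', map_sub,
    Comp.of_one]

end PrimForm

end CompletedConn

end

noncomputable section

open scoped TensorProduct
open MulOpposite

namespace CompletedConn

open Coalgebra Bialgebra HopfAlgebra

/-! ### The connections of a free group -/

section Intertwine

variable {K : Type*} [Field K] {H : Type*} [Ring H] [HopfAlgebra K H] [FiltHopf K H]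
variable {ι : Type*} [Fintype ι] [DecidableEq ι]

theorem TopBasis.primPhiOmHat_intertwine
    {e : ι → Comp K (Phi K (UEA K (Prim K H)) (OmLie K (Prim K H)))}
    (B : TopBasis (Env K (UEA K (Prim K H))) e)
    {E : PreConn K (Env K (UEA K (Prim K H))) (Phi K (UEA K (Prim K H)) (OmLie K (Prim K H)))}
    (hE : IsContConn E) (h0 : ∀ i, E (e i) = 0)
    {D : PreConn K (Env K (Comp K H)) (Om K (Comp K H))} (hD : IsContConn D)
    (h0' : ∀ i, D (primPhiOmHat K H (e i)) = 0)
    (t : Comp K (Phi K (UEA K (Prim K H)) (OmLie K (Prim K H)))) :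
    D (primPhiOmHat K H t) = primPhiBTHat K H (E t) :=
  B.intertwine (f := envMap (primHom K H)) (isFilt_envMap (isFilt_primHom K H))
    (isFilt_primPhiOm K H) (primPhiOm_smul K H) hE h0 hD h0' t

end Intertwine

section Free

variable (K : Type*) [Field K] {G : Type*} [Group G] {ι : Type*}

theorem isQIso_ofAlg {R : Type*} [Ring R] [Algebra K R] [FiltAlg K R] :
    IsQIso (Comp.ofAlg : R →ₐ[K] Comp K R).toLinearMap := Comp.isQIso_of

variable {K} in
theorem uea_counit_eq_zero {L : Type*} [LieRing L] [LieAlgebra K L] [Filt K L] (u : UEA K L)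
    (hu : u ∈ fil K (UEA K L) 1) : counit (R := K) u = 0 := ueaCounit_mem hu

section Dlog

variable [CharZero K]

/-- For z = log c the previous formula reads c ⊗ c⁻¹ - 1. The sign reflects the convention da = 1 ⊗
a - a ⊗ 1, under which dc c⁻¹ = 1 - c ⊗ c⁻¹. The comparison takes place in the completed enveloping
algebra, into which the completed forms inject. -/
theorem primPhiOmHat_expForm (c : G) :
    primPhiOmHat K (MonoidAlgebra K G) (Comp.map (phiJ K _ _) isFilt_phiJ (expForm (primLog K c))) =
      -Comp.of (omMap Comp.ofAlg (dlog K c)) := by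
  refine Comp.map_injective isFilt_omIncl (fun _ _ h => h) ?_
  rw [map_omIncl_expForm (H := MonoidAlgebra K G) (primLog_mem K c), primIncl_primLog, exp_grpLog,
    exp_neg_grpLog, map_neg,
    Comp.map_of, omIncl_omMap, dlog_eq, ← map_neg, adEnv_apply, ← map_neg, neg_sub,
    map_sub (envMap _), map_one (envMap _), envMap, Algebra.TensorProduct.map_tmul,
    AlgHom.op_apply_apply, unop_op]

theorem isQIso_primPhiOm (C : FreeGroupBasis ι G) :
    IsQIso (primPhiOm K (MonoidAlgebra K G)) :=
  (isQIso_omMap (isQIso_primHom K C)).comp (isQIso_phiOm uea_counit_eq_zero)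

end Dlog

variable [DecidableEq ι] [Fintype ι] (C : FreeGroupBasis ι G)

/-- The logarithmic forms `dx x⁻¹` of the free generators are a basis of the completed `1`-forms. -/
def omBasis : TopBasis (Env K (MonoidAlgebra K G))
    (fun i => (Comp.of (dlog K (C i)) : Comp K (Om K (MonoidAlgebra K G)))) :=
  TopBasis.ofBasis (fun i => dlog K (C i)) (foxCoord K C) (foxCoord_smul K C) (foxCoord_dlog K C)
    -- The shift is 1 because Fox coordinates lower the filtration by at most one.
    (sum_foxCoord K C) 1 (foxCoord_mem K C)

/-- The logarithmic forms `dx x⁻¹` of the free generators as a basis of the completed `1`-forms on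
the completed group algebra. -/
def omHatBasis : TopBasis (Env K (Comp K (MonoidAlgebra K G)))
    (fun i => Comp.map (omMap (Comp.ofAlg : MonoidAlgebra K G →ₐ[K] Comp K (MonoidAlgebra K G)))
      (isQIso_omMap (isQIso_ofAlg K)).isFilt (Comp.of (dlog K (C i)))) :=
  (omBasis K C).map (isQIso_envMap (isQIso_ofAlg K)) (isQIso_omMap (isQIso_ofAlg K))
    (omMap_smul Comp.ofAlg)

theorem omHatBasis_conn (i : ι) :
    (omHatBasis K C).conn (Comp.of (omMap Comp.ofAlg (dlog K (C i)))) = 0 := by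
  have := (omHatBasis K C).conn_self i
  rwa [Comp.map_of] at this

theorem isContExt_conn {D : Om K (MonoidAlgebra K G) →ₗ[K]
    BT K (Env K (MonoidAlgebra K G)) (Om K (MonoidAlgebra K G))} (hD : IsNablaC C D) :
    IsContExt D (omHatBasis K C).conn where
  conn := (omHatBasis K C).isContConn
  extends_ ω :=
    IsContConn.apply_of (f := envMap (Comp.ofAlg : MonoidAlgebra K G →ₐ[K] _))
      (h := omMap Comp.ofAlg) (omMap_smul Comp.ofAlg) hD.conn (omHatBasis K C).isContConn
      hD.vanish (omHatBasis_conn K C) (fun i => foxCoord K C i ω) (sum_foxCoord K C ω)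

/-- An extension must kill the images of the forms dx_i x_i⁻¹, and these are a topological basis
over the completed algebra. -/
theorem IsContExt.eq_conn {D : Om K (MonoidAlgebra K G) →ₗ[K]
    BT K (Env K (MonoidAlgebra K G)) (Om K (MonoidAlgebra K G))} (hD : IsNablaC C D)
    {E : PreConn K (Env K (Comp K (MonoidAlgebra K G))) (Om K (Comp K (MonoidAlgebra K G)))}
    (hE : IsContExt D E) : E = (omHatBasis K C).conn := by
  refine (omHatBasis K C).eq_conn hE.conn fun i => ?_
  rw [Comp.map_of, hE.extends_, hD.vanish, map_zero, map_zero]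

variable [CharZero K]

/-- The forms `((e^z - 1) / z) dz ⊗ 1`, `z` the logarithms of the free generators, as a basis of the
completion of `Φ(Ω¹_Lie)`. -/
def phiBasis : TopBasis (Env K (UEA K (Prim K (MonoidAlgebra K G)))) (fun i =>
    Comp.map (phiJ K (UEA K (Prim K (MonoidAlgebra K G))) (OmLie K (Prim K (MonoidAlgebra K G))))
      isFilt_phiJ (expForm (primLog K (C i)))) :=
  TopBasis.comap (isQIso_envMap (isQIso_primHom K C)) (isQIso_primPhiOm K C)
    (primPhiOm_smul K (MonoidAlgebra K G)) <|
    -- The comparison map produces the forms -dx_i x_i⁻¹, so the basis is negated before it is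
    -- pulled back.
    (omHatBasis K C).neg.congr fun i => by
      rw [Comp.map_of]
      exact (primPhiOmHat_expForm K (C i)).symm

/-- The forms `((e^z - 1) / z) dz`, `z` the logarithms of the free generators, as a basis of the
completed Lie `1`-forms. -/
def lieBasis : TopBasis (UEA K (Prim K (MonoidAlgebra K G)))
    (fun i => expForm (K := K) (primLog K (C i))) :=
  (phiBasis K C).ofPhi uea_counit_eq_zero

theorem isNablaLie_conn : IsNablaLie (fun i => primLog K (C i)) (lieBasis K C).conn where
  conn := (lieBasis K C).isContConn
  vanish := (lieBasis K C).conn_self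

theorem isPhiConn_conn : IsPhiConn (lieBasis K C).conn (phiBasis K C).conn where
  conn := (phiBasis K C).isContConn
  comm m := (lieBasis K C).intertwine (f := deltaTilde K (UEA K (Prim K (MonoidAlgebra K G))))
    isFilt_deltaTilde isFilt_phiJ phiJ_smul (lieBasis K C).isContConn (lieBasis K C).conn_self
    (phiBasis K C).isContConn (phiBasis K C).conn_self m

/-- The relation E ∘ j = (Δ̃ ⊗ j) ∘ D makes E vanish on the images of the Lie forms, which are a
topological basis of the completed Φ(Ω¹_Lie). -/
theorem IsPhiConn.eq_conn {E : PreConn K (Env K (UEA K (Prim K (MonoidAlgebra K G))))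
    (Phi K (UEA K (Prim K (MonoidAlgebra K G))) (OmLie K (Prim K (MonoidAlgebra K G))))}
    (hE : IsPhiConn (lieBasis K C).conn E) : E = (phiBasis K C).conn := by
  refine (phiBasis K C).eq_conn hE.conn fun i => ?_
  rw [hE.comm, (lieBasis K C).conn_self, map_zero]

theorem omHatBasis_conn_expForm (i : ι) :
    (omHatBasis K C).conn (primPhiOmHat K (MonoidAlgebra K G)
      (Comp.map (phiJ K (UEA K (Prim K (MonoidAlgebra K G))) (OmLie K (Prim K (MonoidAlgebra K G))))
        isFilt_phiJ (expForm (primLog K (C i))))) = 0 := by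
  rw [primPhiOmHat_expForm, map_neg, omHatBasis_conn, neg_zero]

theorem omHatBasis_conn_primPhiOmHat
    (t : Comp K (Phi K (UEA K (Prim K (MonoidAlgebra K G))) (OmLie K (Prim K (MonoidAlgebra K G))))) :
    (omHatBasis K C).conn (primPhiOmHat K (MonoidAlgebra K G) t) =
      primPhiBTHat K (MonoidAlgebra K G) ((phiBasis K C).conn t) :=
  TopBasis.primPhiOmHat_intertwine (H := MonoidAlgebra K G) (phiBasis K C)
    (phiBasis K C).isContConn (phiBasis K C).conn_self (omHatBasis K C).isContConn
    (omHatBasis_conn_expForm K C) t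

end Free

end CompletedConn

end

/-! ### The main theorem -/

open CompletedConn in
theorem mainTheorem8 {K : Type*} [Field K] [CharZero K] (g n : ℕ) {F : Type*} [Group F]
    (C : FreeGroupBasis (Fin (2 * g + n)) F) :
    -- `P(Â)` is the completed free Lie algebra on elements `z i` with `exp (z i) = C i`
    ∃ ψ : Comp K (FreeLieAlgebra K (Fin (2 * g + n))) ≃ₗ⁅K⁆ Prim K (MonoidAlgebra K F),
      (∀ m x, x ∈ fil K (Comp K (FreeLieAlgebra K (Fin (2 * g + n)))) m ↔
        ψ x ∈ fil K (Prim K (MonoidAlgebra K F)) m) ∧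
      ∃ z : Fin (2 * g + n) → Prim K (MonoidAlgebra K F),
      (∀ i, z i = ψ (Comp.of (FreeLieAlgebra.of K i))) ∧
      (∀ i, evalSeries (PowerSeries.exp K) (primIncl K (MonoidAlgebra K F) (z i)) =
        Comp.ofAlg (MonoidAlgebra.of K F (C i))) ∧
      -- the canonical maps `Û(P(Â)) → Â` and `Φ(Ω¹_Lie P(Â)) → Ω¹Â` are isomorphisms
      IsFiltIso (primHomHat K (MonoidAlgebra K F)) ∧
      IsFiltIso (primPhiOmHat K (MonoidAlgebra K F)) ∧
      -- the connection `∇_C` on `Ω¹A`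
      ∃ D : Om K (MonoidAlgebra K F) →ₗ[K]
          BT K (Env K (MonoidAlgebra K F)) (Om K (MonoidAlgebra K F)),
        (IsNablaC C D ∧ ∀ D₁, IsNablaC C D₁ → D₁ = D) ∧
      -- its continuous extension to `Ω¹Â`
      ∃ Dhat : PreConn K (Env K (Comp K (MonoidAlgebra K F))) (Om K (Comp K (MonoidAlgebra K F))),
        (IsContExt D Dhat ∧ ∀ D₁, IsContExt D D₁ → D₁ = Dhat) ∧
      -- the connection `∇''` on `Ω¹_Lie P(Â)`
      ∃ D'' : PreConn K (UEA K (Prim K (MonoidAlgebra K F))) (OmLie K (Prim K (MonoidAlgebra K F))),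
        (IsNablaLie z D'' ∧ ∀ D₁, IsNablaLie z D₁ → D₁ = D'') ∧
      -- the induced connection `Φ(∇'')`
      ∃ E : PreConn K (Env K (UEA K (Prim K (MonoidAlgebra K F))))
          (Phi K (UEA K (Prim K (MonoidAlgebra K F))) (OmLie K (Prim K (MonoidAlgebra K F)))),
        (IsPhiConn D'' E ∧ ∀ E₁, IsPhiConn D'' E₁ → E₁ = E) ∧
      -- the isomorphism `Φ(Ω¹_Lie P(Â)) → Ω¹Â` takes `Φ(∇'')` to the continuous extension of `∇_C`
      ∀ t, Dhat (primPhiOmHat K (MonoidAlgebra K F) t) =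
        primPhiBTHat K (MonoidAlgebra K F) (E t) := by
  obtain ⟨D, hD, hD'⟩ := existsUnique_isNablaC K C
  refine ⟨malcevEquiv K C, malcevEquiv_mem K C, fun i => primLog K (C i), fun i => ?_, fun i => ?_,
    Comp.isFiltIso_map (isQIso_primHom K C), Comp.isFiltIso_map (isQIso_primPhiOm K C),
    D, ⟨hD, hD'⟩, (omHatBasis K C).conn, ⟨isContExt_conn K C hD, fun D₁ h => h.eq_conn K C hD⟩,
    (lieBasis K C).conn,
    ⟨isNablaLie_conn K C, fun D₁ h => (lieBasis K C).eq_conn h.conn h.vanish⟩,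
    (phiBasis K C).conn, ⟨isPhiConn_conn K C, fun E₁ h => h.eq_conn K C⟩,
    omHatBasis_conn_primPhiOmHat K C⟩
  · rw [malcevEquiv_of, malcevLie_of]
  · rw [primIncl_primLog, exp_grpLog]
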